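/- Let $M$ be a smooth $n$-manifold (Hausdorff, second countable, without boundary) and let $g_\rho$, $\rho\in(-\epsilon,\epsilon)$, be a smooth one-parameter family of (pseudo-)Riemannian metrics on $M$ with $g:=g_0$; for instance, the family in a straight and normal ambient space of $(M,[g])$. Let $\widetilde\Delta$ be the Laplacian of $\widetilde g = 2\rho\,d\tau^2+2\tau\,d\tau\,d\rho+\tau^2 g_\rho$, let $w(\rho)=(\det g_\rho/\det g)^{1/4}$, and let $\widetilde{\mathcal M}(\rho)$ be the operator on functions on $M$ determined by $$(w\circ\widetilde\Delta\circ w^{-1})(\tau^\gamma u)=\tau^{\gamma-2}\left[-2\rho\,\partial_\rho^2+(2\gamma+n-2)\,\partial_\rho+\widetilde{\mathcal M}(\rho)\right]u .$$ The operators $\mathcal M_{2(N+1)}$ ($N\ge 0$) on $C^\infty(M)$ are given by the expansion $\widetilde{\mathcal M}(\rho)=\sum_{N\ge0}\frac{1}{(N!)^2}\left(-\frac{\rho}{2}\right)^N\mathcal M_{2(N+1)}$ at $\rho=0$. Put $\mathcal R_j=-2\rho\,\partial_\rho^2+2j\,\partial_\rho+\widetilde{\mathcal M}(\rho)$ and $\widetilde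 D_{m,\Lambda}=\mathcal R_{\Lambda+1-2m}\cdots\mathcal R_{\Lambda-3}\mathcal R_{\Lambda-1}$. For an integer $U\ge0$, a real number $L$ and $u,v\in C^\infty(M)$ let $$D_{U,0,L,0,0}(u\otimes v)=\sum_{\substack{M^*,M^\diamond,M'\ge0\\ M^*+M^\diamond+M'=U}}\frac{(U!)^2}{M^*!\,M^\diamond!\,M'!}\,\frac{\Gamma(L-M^*)\Gamma(L-M^\diamond)\Gamma(L-M')}{\Gamma(L-U)\Gamma(L)^2}\;\widetilde D_{M',-L+2M'}\left(\widetilde D_{M^*,L}(u)\,\widetilde D_{M^\diamond,L}(v)\right)\Big|_{\rho=0}.$$ The Gamma quotients, and the coefficients below, are rational functions of $L$, and are given the values of these rational functions wherever they are regular (removable singularities are filled in). All of them are regular if $L\ne m$ for every integer $m$ with $1\le m\le U/2$, which is assumed. Then \begin{align*} D_{U,0,L,0,0}(u\otimes v)=\sum_{\mathbf A',\mathbf A^*,\mathbf A^\diamond}&\mathcal C_{\mathbf A',\mathbf A^*,\mathbf A^\diamond}\;\mathcal M_{2(A'_{r'}+1)}\cdots\mathcal M_{2(A'_1+1)}\\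 &\left(\mathcal M_{2(A^*_{r^*}+1)}\cdots\mathcal M_{2(A^*_1+1)}(u)\;\mathcal M_{2(A^\diamond_{r^\diamond}+1)}\cdots\mathcal M_{2(A^\diamond_1+1)}(v)\right), \end{align*} where the sum runs over all finite (possibly empty) sequences $\mathbf A'=(A'_1,\dots,A'_{r'})$, $\mathbf A^*=(A^*_1,\dots,A^*_{r^*})$, $\mathbf A^\diamond=(A^\diamond_1,\dots,A^\diamond_{r^\diamond})$ of nonnegative integers with $$\sum_{j=1}^{r^*}(A^*_j+1)+\sum_{j=1}^{r^\diamond}(A^\diamond_j+1)+\sum_{j=1}^{r'}(A'_j+1)=U,$$ and where \begin{align*} \mathcal C_{\mathbf A',\mathbf A^*,\mathbf A^\diamond}=\;&(U!)^2\prod_{m=1}^U(L-m)\;\prod_{i=1}^{r^*}\frac1{(A^*_i!)^2}\prod_{i=1}^{r^\diamond}\frac1{(A^\diamond_i!)^2}\prod_{i=1}^{r'}\frac1{(A'_i!)^2}\\ &\times\prod_{i=1}^{r^*}\frac{1}{\sum_{j=1}^i(A^*_j+1)}\cdot\frac{1}{L-\sum_{j=1}^i(A^*_j+1)}\;\prod_{i=1}^{r^\diamond}\frac{1}{\sum_{j=1}^i(A^\diamond_j+1)}\cdot\frac{1}{L-\sum_{j=1}^i(A^\diamond_j+1)}\\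 &\times\prod_{i=1}^{r'}\frac{1}{\sum_{j=1}^i(A'_{r'+1-j}+1)}\cdot\frac{1}{L-\sum_{j=1}^i(A'_{r'+1-j}+1)} . \end{align*} If moreover $L\notin\{1,\dots,U\}$, no singularity occurs in $\mathcal C_{\mathbf A',\mathbf A^*,\mathbf A^\diamond}$, and the formula holds as written. Furthermore, $D_{U,0,L,0,0}$ is formally self-adjoint: the Dirichlet form $u_0\otimes u_1\otimes u_2\mapsto\int_M u_0\,D_{U,0,L,0,0}(u_1\otimes u_2)\,d\mathrm{vol}_g$ on smooth functions with compact support (all smooth functions if $M$ is compact) is well defined and symmetric in its three arguments. -/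

import Mathlib

open scoped Manifold ContDiff Topology

noncomputable section

namespace OvsienkoRedou

/-! ### Metrics, ambient metric, ambient Laplacian -/

section Geometry

variable {n : ℕ} {M : Type*} [TopologicalSpace M]
  [ChartedSpace (EuclideanSpace ℝ (Fin n)) M] [IsManifold (𝓡 n) ∞ M]

/-- The components `g(∂ᵢ, ∂ⱼ)` at the point with coordinates `y`, in the local coordinates given by
`e`, of a field `g` of bilinear forms on the tangent spaces of `M`. -/
def components (g : ∀ x : M, LinearMap.BilinForm ℝ (TangentSpace (𝓡 n) x))
    (e : OpenPartialHomeomorph M (EuclideanSpace ℝ (Fin n))) (y : EuclideanSpace ℝ (Fin n)) :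
    Matrix (Fin n) (Fin n) ℝ :=
  Matrix.of fun i j =>
    g (e.symm y)
      (mfderiv 𝓘(ℝ, EuclideanSpace ℝ (Fin n)) (𝓡 n) e.symm y (EuclideanSpace.single i (1 : ℝ)))
      (mfderiv 𝓘(ℝ, EuclideanSpace ℝ (Fin n)) (𝓡 n) e.symm y (EuclideanSpace.single j (1 : ℝ)))

variable (n M) in
/-- A smooth one-parameter family `g_ρ`, `ρ ∈ (-ε, ε)`, of (pseudo-)Riemannian metrics on `M`:
symmetric nondegenerate bilinear forms on the tangent spaces whose components in every chart are
smooth functions of `ρ` and of the coordinates. The values for `|ρ| ≥ ε` play no role. -/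
structure MetricFamily where
  /-- the size of the interval of parameters -/
  ε : ℝ
  ε_pos : 0 < ε
  /-- the metric `g_ρ` -/
  toFun : ℝ → ∀ x : M, LinearMap.BilinForm ℝ (TangentSpace (𝓡 n) x)
  symm : ∀ ρ ∈ Set.Ioo (-ε) ε, ∀ (x : M) (v w : TangentSpace (𝓡 n) x),
    toFun ρ x v w = toFun ρ x w v
  nondegenerate : ∀ ρ ∈ Set.Ioo (-ε) ε, ∀ (x : M) (v : TangentSpace (𝓡 n) x),
    (∀ w, toFun ρ x v w = 0) → v = 0
  smooth : ∀ e ∈ atlas (EuclideanSpace ℝ (Fin n)) M, ∀ i j : Fin n,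
    ContDiffOn ℝ ∞ (fun p : ℝ × EuclideanSpace ℝ (Fin n) => components (toFun p.1) e p.2 i j)
      (Set.Ioo (-ε) ε ×ˢ e.target)

/-- `μ` is the volume measure of the metric `g`: in every chart it is `√|det (gᵢⱼ)| dy`. -/
def IsVolumeMeasure [MeasurableSpace M]
    (g : ∀ x : M, LinearMap.BilinForm ℝ (TangentSpace (𝓡 n) x)) (μ : MeasureTheory.Measure M) :
    Prop :=
  ∀ e ∈ atlas (EuclideanSpace ℝ (Fin n)) M, ∀ s : Set M, MeasurableSet s → s ⊆ e.source →
    μ s = ∫⁻ y in e '' s, ENNReal.ofReal (Real.sqrt |(components g e y).det|)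

/-- The Laplace–Beltrami operator `|det G|^(-1/2) ∑ ∂ₐ (|det G|^(1/2) Gᵃᵇ ∂_b f)` of the metric with
components `G` in coordinates indexed by `ι`. -/
def coordLaplacian {ι : Type*} [Fintype ι] [DecidableEq ι] (G : (ι → ℝ) → Matrix ι ι ℝ)
    (f : (ι → ℝ) → ℝ) (z : ι → ℝ) : ℝ :=
  (Real.sqrt |(G z).det|)⁻¹ * ∑ a, ∑ b,
    fderiv ℝ (fun y => Real.sqrt |(G y).det| * (G y)⁻¹ a b * fderiv ℝ f y (Pi.single b 1)) z
      (Pi.single a 1)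

/-- Coordinates on the ambient space `ℝ₊ × M × (-ε, ε)` induced by coordinates `y` on `M`:
`inl i` is `yᵢ`, `inr 0` is `τ` and `inr 1` is `ρ`. -/
def ambientCoords (τ : ℝ) (y : EuclideanSpace ℝ (Fin n)) (ρ : ℝ) : Fin n ⊕ Fin 2 → ℝ :=
  Sum.elim (fun i => y i) ![τ, ρ]

/-- The coordinates of the base point in `M`. -/
def baseCoords (z : Fin n ⊕ Fin 2 → ℝ) : EuclideanSpace ℝ (Fin n) :=
  WithLp.toLp 2 fun i => z (Sum.inl i)

/-- The components of the straight and normal ambient metric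
`2 ρ dτ² + 2 τ dτ dρ + τ² g_ρ`. -/
def ambientMetric (g : MetricFamily n M) (e : OpenPartialHomeomorph M (EuclideanSpace ℝ (Fin n)))
    (z : Fin n ⊕ Fin 2 → ℝ) : Matrix (Fin n ⊕ Fin 2) (Fin n ⊕ Fin 2) ℝ :=
  let τ := z (Sum.inr 0)
  let ρ := z (Sum.inr 1)
  Matrix.fromBlocks (τ ^ 2 • components (g.toFun ρ) e (baseCoords z)) 0 0 !![2 * ρ, τ; τ, 0]

/-- The Laplacian of the ambient metric, on functions `F τ x ρ`. -/
def ambientLaplacian (g : MetricFamily n M) (F : ℝ → M → ℝ → ℝ) (τ : ℝ) (x : M) (ρ : ℝ) : ℝ :=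
  let e := chartAt (EuclideanSpace ℝ (Fin n)) x
  coordLaplacian (ambientMetric g e)
    (fun z => F (z (Sum.inr 0)) (e.symm (baseCoords z)) (z (Sum.inr 1)))
    (ambientCoords τ (e x) ρ)

/-- `w(ρ) = (det g_ρ / det g₀) ^ (1/4)`, a function on `M`. -/
def weight (g : MetricFamily n M) (ρ : ℝ) (x : M) : ℝ :=
  let e := chartAt (EuclideanSpace ℝ (Fin n)) x
  ((components (g.toFun ρ) e (e x)).det / (components (g.toFun 0) e (e x)).det) ^ (1 / 4 : ℝ)

/-- `w ∘ Δ̃ ∘ w⁻¹`. -/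
def conjLaplacian (g : MetricFamily n M) (F : ℝ → M → ℝ → ℝ) (τ : ℝ) (x : M) (ρ : ℝ) : ℝ :=
  weight g ρ x * ambientLaplacian g (fun τ' x' ρ' => (weight g ρ' x')⁻¹ * F τ' x' ρ') τ x ρ

/-- The operator `ℳ̃(ρ)` on functions on `M`. It is the zeroth-order-in-`∂_ρ` part of the expansion
`(w ∘ Δ̃ ∘ w⁻¹)(τ^γ u) = τ^(γ-2) (-2ρ ∂_ρ² + (2γ+n-2) ∂_ρ + ℳ̃(ρ)) u`,
read off from `γ = 0` and functions that do not depend on `ρ`. -/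
def genM (g : MetricFamily n M) (ρ : ℝ) (u : M → ℝ) (x : M) : ℝ :=
  conjLaplacian g (fun _ x' _ => u x') 1 x ρ

/-- The operator `ℳ_{2(N+1)}`, that is, the coefficients in the expansion at `ρ = 0`
`ℳ̃(ρ) = ∑_N (1 / N!²) (-ρ/2)^N ℳ_{2(N+1)}`. -/
def opM (g : MetricFamily n M) (N : ℕ) (u : M → ℝ) (x : M) : ℝ :=
  (N.factorial : ℝ) * (-2) ^ N * iteratedDeriv N (fun ρ => genM g ρ u x) 0

/-! ### The operators `ℛ_j` and the bidifferential operators built from them -/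

/-- `ℛ_j = -2ρ ∂_ρ² + 2j ∂_ρ + ℳ̃(ρ)` on functions `F ρ x`. -/
def opR (g : MetricFamily n M) (j : ℝ) (F : ℝ → M → ℝ) (ρ : ℝ) (x : M) : ℝ :=
  -2 * ρ * iteratedDeriv 2 (fun s => F s x) ρ + 2 * j * deriv (fun s => F s x) ρ
    + genM g ρ (F ρ) x

/-- `D̃_{m,L} = ℛ_{L+1-2m} ⋯ ℛ_{L-3} ℛ_{L-1}`. -/
def opDTilde (g : MetricFamily n M) : ℕ → ℝ → (ℝ → M → ℝ) → (ℝ → M → ℝ)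
  | 0, _, F => F
  | m + 1, L, F => opR g (L + 1 - 2 * ((m : ℝ) + 1)) (opDTilde g m L F)

/-- `D_{[m',L'],[m₁,L₁],[m₂,L₂]}(u ⊗ v)`, which is
`D̃_{m',L'} (D̃_{m₁,L₁}(u) D̃_{m₂,L₂}(v))` at `ρ = 0`. -/
def opDTriple (g : MetricFamily n M) (m' : ℕ) (L' : ℝ) (m₁ : ℕ) (L₁ : ℝ) (m₂ : ℕ) (L₂ : ℝ)
    (u v : M → ℝ) (x : M) : ℝ :=
  opDTilde g m' L'
    (fun ρ y => opDTilde g m₁ L₁ (fun _ => u) ρ y * opDTilde g m₂ L₂ (fun _ => v) ρ y) 0 x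

/-- The value at `a` of a function with at most a removable singularity at `a`. -/
def regularValue (f : ℝ → ℝ) (a : ℝ) : ℝ := Filter.limUnder (𝓝[≠] a) f

/-- The quotient of Gamma functions in front of `D_{[m',…],[m₁,…],[m₂,…]}`. -/
def gammaQuotient (U V : ℕ) (L K₁ K₂ : ℝ) (m₁ m₂ m' : ℕ) : ℝ :=
  Real.Gamma (U + K₁ + 1) * Real.Gamma (U + K₂ + 1)
      / (Real.Gamma (m₁ + K₁ + 1) * Real.Gamma (m₂ + K₂ + 1) * Real.Gamma (m' + 1))
    * (Real.Gamma (L - m₁) * Real.Gamma (L - m₂) * Real.Gamma (L + V - m')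
      / (Real.Gamma (L - U) * Real.Gamma L ^ 2))

/-- The coefficient in front of `D_{[m',…],[m₁,…],[m₂,…]}`. The quotient of Gamma functions is a
rational function of the indeterminates `L, K₁, K₂`; at points where individual Gamma factors have
poles, this is the value of that rational function. -/
def gammaCoeff (U V : ℕ) (L K₁ K₂ : ℝ) (m₁ m₂ m' : ℕ) : ℝ :=
  regularValue (fun t => gammaQuotient U V (L + t) (K₁ + t) (K₂ + t) m₁ m₂ m') 0

/-- The triples of natural numbers with sum `U`. -/
def triples (U : ℕ) : Finset (ℕ × ℕ × ℕ) :=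
  (Finset.range (U + 1) ×ˢ Finset.range (U + 1) ×ˢ Finset.range (U + 1)).filter
    fun p => p.1 + p.2.1 + p.2.2 = U

/-- The operator `D_{U,V,L,K₁,K₂}` (the triple is `(m₁, m₂, m')`). -/
def opD (g : MetricFamily n M) (U V : ℕ) (L K₁ K₂ : ℝ) (u v : M → ℝ) (x : M) : ℝ :=
  ∑ p ∈ triples U, gammaCoeff U V L K₁ K₂ p.1 p.2.1 p.2.2 *
    opDTriple g p.2.2 (-L - V + 2 * p.2.2) p.1 (L - K₁) p.2.1 (L - K₂) u v x

/-- A bidifferential operator on `M` is formally self-adjoint (with respect to `μ`) if its Dirichlet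
form `u₀ ⊗ u₁ ⊗ u₂ ↦ ∫ u₀ D(u₁ ⊗ u₂) dμ` is symmetric. The functions `uᵢ` are smooth with compact
support (that is, arbitrary smooth functions if `M` is compact). -/
def IsFormallySelfAdjoint [MeasurableSpace M] (μ : MeasureTheory.Measure M)
    (D : (M → ℝ) → (M → ℝ) → (M → ℝ)) : Prop :=
  ∀ u : Fin 3 → M → ℝ, (∀ i, ContMDiff (𝓡 n) 𝓘(ℝ, ℝ) ∞ (u i)) → (∀ i, HasCompactSupport (u i)) →
    ∀ σ : Equiv.Perm (Fin 3),
      MeasureTheory.Integrable (fun x => u (σ 0) x * D (u (σ 1)) (u (σ 2)) x) μ ∧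
      ∫ x, u (σ 0) x * D (u (σ 1)) (u (σ 2)) x ∂μ = ∫ x, u 0 x * D (u 1) (u 2) x ∂μ

/-- The composition `ℳ_{2(A_r+1)} ⋯ ℳ_{2(A_1+1)}` for `A = [A_1, …, A_r]`. -/
def opMList (g : MetricFamily n M) (A : List ℕ) (u : M → ℝ) : M → ℝ :=
  A.foldl (fun v a => opM g a v) u

end Geometry

/-! ### Sequences and coefficients -/

/-- The number `∑ (A_j + 1)`. -/
def weightSum (A : List ℕ) : ℕ := (A.map (· + 1)).sum

/-- The finite set of all finite sequences `A` of nonnegative integers with `∑ (A_j + 1) = N`. -/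
def seqs (N : ℕ) : Finset (List ℕ) :=
  Finset.univ.image fun c : Composition N => c.blocks.map (· - 1)

theorem mem_seqs {N : ℕ} {A : List ℕ} : A ∈ seqs N ↔ weightSum A = N := by
  constructor
  · intro h
    obtain ⟨c, -, rfl⟩ := Finset.mem_image.1 h
    have h1 : (c.blocks.map (· - 1)).map (· + 1) = c.blocks := by
      rw [List.map_map]
      conv_rhs => rw [← List.map_id c.blocks]
      apply List.map_congr_left
      intro a ha
      have := c.blocks_pos ha
      simp only [Function.comp_apply, id_eq]
      omega
    rw [weightSum, h1, c.blocks_sum]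
  · intro h
    refine Finset.mem_image.2 ⟨⟨A.map (· + 1), ?_, h⟩, Finset.mem_univ _, ?_⟩
    · intro i hi
      obtain ⟨a, -, rfl⟩ := List.mem_map.1 hi
      omega
    · simp [List.map_map, Function.comp_def]

/-- The finite set of all triples `(A', A₁, A₂)` of finite sequences of nonnegative integers with
`∑ (A'_j + 1) + ∑ (A₁_j + 1) + ∑ (A₂_j + 1) = U`. -/
def seqTriples (U : ℕ) : Finset (List ℕ × List ℕ × List ℕ) :=
  (triples U).biUnion fun p => seqs p.1 ×ˢ seqs p.2.1 ×ˢ seqs p.2.2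

theorem mem_seqTriples {U : ℕ} {A : List ℕ × List ℕ × List ℕ} :
    A ∈ seqTriples U ↔ weightSum A.1 + weightSum A.2.1 + weightSum A.2.2 = U := by
  simp only [seqTriples, triples, Finset.mem_biUnion, Finset.mem_filter, Finset.mem_product,
    Finset.mem_range, mem_seqs]
  constructor
  · rintro ⟨p, ⟨-, h⟩, h1, h2, h3⟩
    omega
  · intro h
    exact ⟨(weightSum A.1, weightSum A.2.1, weightSum A.2.2), ⟨by dsimp only; omega, h⟩,
      rfl, rfl, rfl⟩

/-- `∏_{i=1}^r 1 / A_i!²`. -/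
def factorialCoeff (A : List ℕ) : ℝ := (A.map fun a => 1 / (a.factorial : ℝ) ^ 2).prod

/-- `∏_{i=1}^r 1 / ∑_{j=1}^i (A_j+1) · ∏_{i=1}^r 1 / (L - ∑_{j=1}^i (A_j+1))`. -/
def partialSumCoeff (L : ℝ) (A : List ℕ) : ℝ :=
  (∏ i ∈ Finset.range A.length, 1 / (weightSum (A.take (i + 1)) : ℝ)) *
    ∏ i ∈ Finset.range A.length, 1 / (L - (weightSum (A.take (i + 1)) : ℝ))

/-- The coefficient of the composition that belongs to `(A', A₁, A₂)`. For `A'` the partial sums are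
those of the reversed sequence. -/
def juhlCoeff (U : ℕ) (L : ℝ) (A' A₁ A₂ : List ℕ) : ℝ :=
  (U.factorial : ℝ) ^ 2 * (∏ m ∈ Finset.Icc 1 U, (L - m))
    * (factorialCoeff A₁ * factorialCoeff A₂ * factorialCoeff A')
    * (partialSumCoeff L A₁ * partialSumCoeff L A₂ * partialSumCoeff L A'.reverse)

end OvsienkoRedou

end

noncomputable section

namespace OvsienkoRedou

open Finset

/-! ### Sequences -/

/-! The proof has an algebraic half, which gives the formula, and an analytic half, which shows that
the operators `ℳ_{2(N+1)}` are smooth, linear and formally self-adjoint.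

Algebra. In the variable `s = -ρ/2` the operator `ℛ_j` becomes `s ∂² - j ∂ + ∑ s^N/N!² T_N` with
`T_N = ℳ_{2(N+1)}`. Since everything is evaluated at `ρ = 0`, only Taylor coefficients matter, and
the problem is one about formal power series over a commutative algebra with arbitrary linear maps
`T_N`. Let `Φ = ∑ s^k φ_k(u)` be the formal solution of `ℛ_{L-1} Φ = 0` with constant term `u`.
Solving for one coefficient after the other divides by `k (L - k)` at stage `k`, which is how the
products over partial sums arise (`phi_succ`). The same series is `∑ α_a s^a D̃_{a,L} u` with `α_a =
1/(a! (L-1)⋯(L-a))` (`phi_eq_sum_jetD`). Dually, the constant term of `α_c D̃_{c,-L+2c} G` is `∑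
ψ_k(G_{c-k})`, where `ψ_k` is the formal transpose of `φ_k` (`jetD_zero_eq_sum_psi`). The Gamma
quotients are `(U!)² ∏ (L-m) α_a α_b α_c`. Multiplying the series therefore turns the left side into
`(U!)² ∏ (L-m) ∑ ψ_k(φ_l(u) φ_m(v))`, and expanding `φ` and `ψ` is the claim
(`sum_jetTriple_eq_juhl`).

This argument needs `L ∉ {1, …, U}`. In general both sides are limits of their values at nearby
nonintegral parameters: the operators are polynomial in `L`, and the coefficients have limits
because for `m > U/2` at most one of three blocks of total size `U` reaches `m`, so that the pole at
`m` is simple and is cancelled by `∏ (L-m)` (`eval_sum_jetTriple_eq_juhl`).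

Analysis. The volume density of `g_ρ` is `w²` times that of `g₀`. Conjugation by `w` thus puts
`ℳ̃(ρ)` into divergence form with respect to the fixed density of `g₀`, plus a potential
(`ambForm_eq`). The local expressions agree on overlaps of charts (`divForm_change`), so `ℳ̃(ρ)`
preserves smooth families and its `ρ`-derivatives can be computed in charts. These derivatives again
have divergence form with symmetric coefficients, so each `ℳ_{2(N+1)}` is formally self-adjoint by
Green's identity and a partition of unity (`integral_mul_opM`).

Symmetry of the Dirichlet form follows from the formula. Moving the outer composition onto `u₀`
reverses `A'`; the reversal of `A'` in the coefficient is exactly what makes the three sequences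
enter alike (`juhlCoeff_reverse_eq_prod`). -/

theorem weightSum_append (A B : List ℕ) : weightSum (A ++ B) = weightSum A + weightSum B := by
  simp [weightSum]

theorem weightSum_singleton (a : ℕ) : weightSum [a] = a + 1 := by simp [weightSum]

theorem weightSum_cons (a : ℕ) (A : List ℕ) : weightSum (a :: A) = a + 1 + weightSum A := by
  simp [weightSum]

theorem weightSum_reverse (A : List ℕ) : weightSum A.reverse = weightSum A := by
  simp [weightSum]

theorem weightSum_nil : weightSum [] = 0 := rfl

theorem weightSum_eq_zero {A : List ℕ} : weightSum A = 0 ↔ A = [] := by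
  cases A with
  | nil => simp [weightSum]
  | cons a A => simp [weightSum_cons]

theorem seqs_zero : seqs 0 = {[]} := by
  ext A
  rw [mem_seqs, weightSum_eq_zero, Finset.mem_singleton]

theorem sum_seqs_reverse {V : Type*} [AddCommMonoid V] (k : ℕ) (f : List ℕ → V) :
    ∑ A ∈ seqs k, f A.reverse = ∑ A ∈ seqs k, f A :=
  Finset.sum_nbij' List.reverse List.reverse (by simp [mem_seqs, weightSum_reverse])
    (by simp [mem_seqs, weightSum_reverse]) (by simp) (by simp) (by simp)

theorem sum_seqs_succ {V : Type*} [AddCommMonoid V] (k : ℕ) (f : List ℕ → V) :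
    ∑ A ∈ seqs (k + 1), f A
      = ∑ p ∈ antidiagonal k, ∑ B ∈ seqs p.2, f (p.1 :: B) := by
  rw [Finset.sum_sigma']
  symm
  refine Finset.sum_bij (fun q _ => q.1.1 :: q.2) ?_ ?_ ?_ ?_
  · rintro ⟨⟨a, b⟩, B⟩ h
    simp only [mem_sigma, HasAntidiagonal.mem_antidiagonal, mem_seqs] at h
    simp only [mem_seqs, weightSum_cons]
    omega
  · rintro ⟨⟨a, b⟩, B⟩ h ⟨⟨a', b'⟩, B'⟩ h' e
    simp only [mem_sigma, HasAntidiagonal.mem_antidiagonal, mem_seqs] at h h'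
    simp only [List.cons.injEq] at e
    obtain ⟨rfl, rfl⟩ := e
    obtain ⟨-, rfl⟩ := h
    obtain ⟨-, rfl⟩ := h'
    rfl
  · intro A hA
    rw [mem_seqs] at hA
    cases A with
    | nil => simp [weightSum_nil] at hA
    | cons a A =>
      refine ⟨⟨(a, weightSum A), A⟩, ?_, rfl⟩
      rw [weightSum_cons] at hA
      simp only [mem_sigma, HasAntidiagonal.mem_antidiagonal, mem_seqs, and_true]
      omega
  · intros; rfl

theorem sum_seqs_succ' {V : Type*} [AddCommMonoid V] (k : ℕ) (f : List ℕ → V) :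
    ∑ A ∈ seqs (k + 1), f A
      = ∑ p ∈ antidiagonal k, ∑ B ∈ seqs p.2, f (B ++ [p.1]) := by
  rw [← sum_seqs_reverse, sum_seqs_succ]
  refine Finset.sum_congr rfl fun p _ => ?_
  rw [← sum_seqs_reverse p.2]
  simp

theorem factorialCoeff_append (A B : List ℕ) :
    factorialCoeff (A ++ B) = factorialCoeff A * factorialCoeff B := by
  simp [factorialCoeff]

theorem factorialCoeff_singleton (a : ℕ) : factorialCoeff [a] = 1 / (a.factorial : ℝ) ^ 2 := by
  simp [factorialCoeff]

theorem factorialCoeff_cons (a : ℕ) (A : List ℕ) :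
    factorialCoeff (a :: A) = 1 / (a.factorial : ℝ) ^ 2 * factorialCoeff A := by
  simp [factorialCoeff]

theorem factorialCoeff_reverse (A : List ℕ) : factorialCoeff A.reverse = factorialCoeff A := by
  rw [factorialCoeff, List.map_reverse, List.prod_reverse, factorialCoeff]

theorem partialSumCoeff_concat (L : ℝ) (B : List ℕ) (a : ℕ) :
    partialSumCoeff L (B ++ [a]) = partialSumCoeff L B *
      (1 / ((weightSum B + a + 1 : ℕ) : ℝ) * (1 / (L - ((weightSum B + a + 1 : ℕ) : ℝ)))) := by
  have h : ∀ f : ℕ → ℝ, ∏ i ∈ range B.length, f (weightSum ((B ++ [a]).take (i + 1)))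
      = ∏ i ∈ range B.length, f (weightSum (B.take (i + 1))) := by
    intro f
    refine Finset.prod_congr rfl fun i hi => ?_
    rw [List.take_append_of_le_length (by simpa using Finset.mem_range.1 hi)]
  have h2 : weightSum ((B ++ [a]).take (B.length + 1)) = weightSum B + a + 1 := by
    rw [List.take_of_length_le (by simp), weightSum_append, weightSum_singleton, add_assoc]
  simp only [partialSumCoeff, List.length_append, List.length_singleton, Finset.prod_range_succ]
  rw [h (fun k => 1 / (k : ℝ)), h (fun k => 1 / (L - (k : ℝ))), h2]
  ring

/-! ### The operators on jets -/

section Jets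

variable {V : Type*} [AddCommGroup V] [Module ℝ V] (T : ℕ → V →ₗ[ℝ] V)

/-- The composition `T_{A_r} ⋯ T_{A_1}` for `A = [A_1, …, A_r]`. -/
def compList (A : List ℕ) (u : V) : V := A.foldl (fun v a => T a v) u

theorem compList_nil (u : V) : compList T [] u = u := rfl

theorem compList_cons (a : ℕ) (A : List ℕ) (u : V) :
    compList T (a :: A) u = compList T A (T a u) := rfl

theorem compList_concat (a : ℕ) (A : List ℕ) (u : V) :
    compList T (A ++ [a]) u = T a (compList T A u) := by simp [compList]

theorem compList_add (A : List ℕ) (u v : V) :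
    compList T A (u + v) = compList T A u + compList T A v := by
  induction A generalizing u v with
  | nil => rfl
  | cons a A ih => simp only [compList_cons, map_add, ih]

theorem compList_smul (A : List ℕ) (c : ℝ) (u : V) :
    compList T A (c • u) = c • compList T A u := by
  induction A generalizing u with
  | nil => rfl
  | cons a A ih => simp only [compList_cons, map_smul, ih]

/-- The operator `s ∂² - j ∂ + ∑ s^N / N!² T_N` on the coefficients of formal power series. -/
def jetR (j : ℝ) (F : ℕ → V) (k : ℕ) : V :=
  (((k : ℝ) + 1) * (k - j)) • F (k + 1)
    + ∑ p ∈ antidiagonal k, (1 / (p.1.factorial : ℝ) ^ 2) • T p.1 (F p.2)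

/-- The composition `jetR (L + 1 - 2m) ∘ ⋯ ∘ jetR (L - 1)`. -/
def jetD : ℕ → ℝ → (ℕ → V) → (ℕ → V)
  | 0, _, F => F
  | m + 1, L, F => jetR T (L + 1 - 2 * ((m : ℝ) + 1)) (jetD m L F)

/-- The constant formal power series. -/
def jetConst (u : V) : ℕ → V := fun k => if k = 0 then u else 0

/-- The definition splits off the factor applied last; the induction for the transpose has to split
off the factor applied first, `ℛ_{L-1}`. The remaining chain starts at `ℛ_{L-3} = ℛ_{(L-2)-1}`. -/
theorem jetD_succ_right (c : ℕ) (L : ℝ) (F : ℕ → V) :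
    jetD T (c + 1) L F = jetD T c (L - 2) (jetR T (L - 1) F) := by
  induction c with
  | zero =>
    simp only [jetD]
    congr 1
    push_cast; ring
  | succ c ih =>
    rw [jetD, ih, jetD]
    congr 1
    push_cast; ring

/-- `∑ E_A T_A` over the sequences with `∑ (A_j + 1) = k`. -/
def phi (L : ℝ) (k : ℕ) (u : V) : V :=
  ∑ A ∈ seqs k, (factorialCoeff A * partialSumCoeff L A) • compList T A u

/-- The formal transpose of `phi`. -/
def psi (L : ℝ) (k : ℕ) (u : V) : V :=
  ∑ A ∈ seqs k, (factorialCoeff A * partialSumCoeff L A.reverse) • compList T A u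

theorem phi_zero (L : ℝ) (u : V) : phi T L 0 u = u := by
  simp [phi, seqs_zero, factorialCoeff, partialSumCoeff, compList_nil]

theorem psi_zero (L : ℝ) (u : V) : psi T L 0 u = u := by
  simp [psi, seqs_zero, factorialCoeff, partialSumCoeff, compList_nil]

theorem psi_add (L : ℝ) (k : ℕ) (u v : V) : psi T L k (u + v) = psi T L k u + psi T L k v := by
  simp only [psi, compList_add, smul_add, Finset.sum_add_distrib]

theorem psi_smul (L : ℝ) (k : ℕ) (c : ℝ) (u : V) : psi T L k (c • u) = c • psi T L k u := by
  simp only [psi, compList_smul, Finset.smul_sum, smul_comm c]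

/-- `psi` as a linear map. -/
def psiLin (L : ℝ) (k : ℕ) : V →ₗ[ℝ] V where
  toFun := psi T L k
  map_add' := psi_add T L k
  map_smul' := psi_smul T L k

theorem psi_sum (L : ℝ) (k : ℕ) {ι : Type*} (s : Finset ι) (f : ι → V) :
    psi T L k (∑ i ∈ s, f i) = ∑ i ∈ s, psi T L k (f i) :=
  map_sum (psiLin T L k) f s

/-- Splitting off the last entry of a sequence removes the outermost operator and the last partial
sum, which is the full weight `k + 1`. The recursion says that the coefficient of `s^k` in `ℛ_{L-1}
∑ s^k φ_k(u)` vanishes. -/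
theorem phi_succ (L : ℝ) (k : ℕ) (hk : L ≠ (k + 1 : ℕ)) (u : V) :
    (((k : ℝ) + 1) * (L - (k + 1))) • phi T L (k + 1) u
      = ∑ p ∈ antidiagonal k, (1 / (p.1.factorial : ℝ) ^ 2) • T p.1 (phi T L p.2 u) := by
  rw [phi, sum_seqs_succ', Finset.smul_sum]
  refine Finset.sum_congr rfl fun p hp => ?_
  rw [phi, map_sum, Finset.smul_sum, Finset.smul_sum]
  refine Finset.sum_congr rfl fun B hB => ?_
  rw [mem_seqs] at hB
  rw [HasAntidiagonal.mem_antidiagonal] at hp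
  rw [compList_concat, factorialCoeff_append, factorialCoeff_singleton, partialSumCoeff_concat,
    map_smul, smul_smul, smul_smul]
  congr 1
  have e : weightSum B + p.1 + 1 = k + 1 := by omega
  rw [e]
  push_cast at hk ⊢
  have h1 : (k : ℝ) + 1 ≠ 0 := by positivity
  have h2 : L - (k + 1) ≠ 0 := sub_ne_zero.2 hk
  field_simp

/-- The transpose of `phi_succ`: the partial sums now run from the other end, so the first entry,
which belongs to the innermost operator, carries the factor of the full weight. -/
theorem psi_succ (L : ℝ) (k : ℕ) (hk : L ≠ (k + 1 : ℕ)) (u : V) :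
    (((k : ℝ) + 1) * (L - (k + 1))) • psi T L (k + 1) u
      = ∑ p ∈ antidiagonal k, (1 / (p.1.factorial : ℝ) ^ 2) • psi T L p.2 (T p.1 u) := by
  rw [psi, sum_seqs_succ, Finset.smul_sum]
  refine Finset.sum_congr rfl fun p hp => ?_
  rw [psi, Finset.smul_sum, Finset.smul_sum]
  refine Finset.sum_congr rfl fun B hB => ?_
  rw [mem_seqs] at hB
  rw [HasAntidiagonal.mem_antidiagonal] at hp
  rw [compList_cons, factorialCoeff_cons, List.reverse_cons, partialSumCoeff_concat,
    weightSum_reverse, smul_smul, smul_smul]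
  congr 1
  have e : weightSum B + p.1 + 1 = k + 1 := by omega
  rw [e]
  push_cast at hk ⊢
  have h1 : (k : ℝ) + 1 ≠ 0 := by positivity
  have h2 : L - (k + 1) ≠ 0 := sub_ne_zero.2 hk
  field_simp

/-- The number `1 / (a! (L-1) ⋯ (L-a))`. -/
def alpha (L : ℝ) (a : ℕ) : ℝ := 1 / ((a.factorial : ℝ) * ∏ m ∈ Icc 1 a, (L - m))

theorem alpha_zero (L : ℝ) : alpha L 0 = 1 := by simp [alpha]

theorem alpha_succ (L : ℝ) (a : ℕ) (h : L ≠ (a + 1 : ℕ)) :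
    ((a : ℝ) + 1) * (L - (a + 1)) * alpha L (a + 1) = alpha L a := by
  rw [alpha, alpha, Finset.prod_Icc_succ_top (by omega), Nat.factorial_succ]
  push_cast at h ⊢
  have h1 : (a : ℝ) + 1 ≠ 0 := by positivity
  have h2 : L - (a + 1) ≠ 0 := sub_ne_zero.2 h
  have h3 : (a.factorial : ℝ) ≠ 0 := by positivity
  -- If an earlier factor vanishes, both sides are `0` by the convention `1 / 0 = 0`.
  by_cases h4 : ∏ m ∈ Icc 1 a, (L - (m : ℝ)) = 0
  · simp [h4]
  · field_simp

/-- Both sides run over the triples of sum `k`; the two splittings differ in which of the first two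
entries is fixed first. -/
theorem sum_antidiagonal_assoc {W : Type*} [AddCommMonoid W] (k : ℕ) (f : ℕ → ℕ → ℕ → W) :
    ∑ p ∈ antidiagonal k, ∑ q ∈ antidiagonal p.2, f p.1 q.1 q.2
      = ∑ q ∈ antidiagonal k, ∑ p ∈ antidiagonal q.2, f p.1 q.1 p.2 := by
  rw [Finset.sum_sigma', Finset.sum_sigma']
  refine Finset.sum_nbij' (fun x => ⟨(x.2.1, x.1.1 + x.2.2), (x.1.1, x.2.2)⟩)
    (fun x => ⟨(x.2.1, x.1.1 + x.2.2), (x.1.1, x.2.2)⟩) ?_ ?_ ?_ ?_ ?_ <;>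
  · rintro ⟨⟨a, b⟩, ⟨c, d⟩⟩ h
    simp only [mem_sigma, HasAntidiagonal.mem_antidiagonal, and_true] at h ⊢
    all_goals first
    | omega
    | (obtain ⟨rfl, rfl⟩ := h; rfl)

/-- As series, `Φ = ∑ α_a s^a D̃_{a,L} u`. The right side satisfies the recursion of `phi_succ`:
`D̃_{a+1,L} = ℛ_{L-1-2a} D̃_{a,L}` expresses the terms with `T_N` through `D̃_{a+1,L}` and a shifted
coefficient of `D̃_{a,L}`, and the choice of `α_a` makes the contributions combine. -/
theorem phi_eq_sum_jetD (L : ℝ) (u : V) (k : ℕ) (hL : ∀ m : ℕ, 1 ≤ m → m ≤ k → L ≠ m) :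
    phi T L k u
      = ∑ p ∈ antidiagonal k, alpha L p.1 • jetD T p.1 L (jetConst u) p.2 := by
  induction k using Nat.strong_induction_on with
  | _ k ih =>
  cases k with
  | zero => simp [phi_zero, alpha_zero, jetD, jetConst]
  | succ k =>
    have hk := hL (k + 1) (by omega) le_rfl
    have hne : ((k : ℝ) + 1) * (L - (k + 1)) ≠ 0 := by
      push_cast at hk
      exact mul_ne_zero (by positivity) (sub_ne_zero.2 hk)
    refine smul_right_injective V hne ?_
    dsimp only
    rw [phi_succ T L k hk]
    have h1 : ∑ p ∈ antidiagonal k, (1 / (p.1.factorial : ℝ) ^ 2) • T p.1 (phi T L p.2 u)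
        = ∑ p ∈ antidiagonal k, alpha L p.1 • ∑ q ∈ antidiagonal p.2,
          (1 / (q.1.factorial : ℝ) ^ 2) • T q.1 (jetD T p.1 L (jetConst u) q.2) := by
      simp only [Finset.smul_sum]
      rw [sum_antidiagonal_assoc k fun a N b =>
        alpha L a • (1 / (N.factorial : ℝ) ^ 2) • T N (jetD T a L (jetConst u) b)]
      refine Finset.sum_congr rfl fun p hp => ?_
      rw [HasAntidiagonal.mem_antidiagonal] at hp
      rw [ih p.2 (by omega) (fun m h h' => hL m h (by omega)), map_sum, Finset.smul_sum]
      refine Finset.sum_congr rfl fun q _ => ?_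
      rw [map_smul, smul_comm]
    -- The defining equation of `D̃_{a+1,L}`, solved for the terms with `T_N`.
    have h2 : ∀ p ∈ antidiagonal k, alpha L p.1 • ∑ q ∈ antidiagonal p.2,
          (1 / (q.1.factorial : ℝ) ^ 2) • T q.1 (jetD T p.1 L (jetConst u) q.2)
        = (((p.1 : ℝ) + 1) * (L - (p.1 + 1)) * alpha L (p.1 + 1)) •
            jetD T (p.1 + 1) L (jetConst u) p.2
          - (alpha L p.1 * (((p.2 : ℝ) + 1) * (p.2 - (L + 1 - 2 * ((p.1 : ℝ) + 1))))) •
            jetD T p.1 L (jetConst u) (p.2 + 1) := by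
      intro p hp
      rw [HasAntidiagonal.mem_antidiagonal] at hp
      rw [alpha_succ L p.1 (hL _ (by omega) (by omega)), jetD, jetR, smul_add, smul_smul,
        add_sub_cancel_left]
    rw [h1, Finset.sum_congr rfl h2, Finset.sum_sub_distrib]
    -- Here and in `h4` the index is shifted so that both sums run over `a + b = k + 1`; the added
    -- boundary term carries the factor `a = 0` or `b = 0`.
    have h3 : ∑ p ∈ antidiagonal k, (((p.1 : ℝ) + 1) * (L - (p.1 + 1)) * alpha L (p.1 + 1)) •
            jetD T (p.1 + 1) L (jetConst u) p.2
        = ∑ p ∈ antidiagonal (k + 1), ((p.1 : ℝ) * (L - p.1) * alpha L p.1) •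
            jetD T p.1 L (jetConst u) p.2 := by
      rw [Finset.Nat.sum_antidiagonal_succ]
      simp
    have h4 : ∑ p ∈ antidiagonal k,
          (alpha L p.1 * (((p.2 : ℝ) + 1) * (p.2 - (L + 1 - 2 * ((p.1 : ℝ) + 1))))) •
            jetD T p.1 L (jetConst u) (p.2 + 1)
        = ∑ p ∈ antidiagonal (k + 1),
          (alpha L p.1 * ((p.2 : ℝ) * (p.2 + 2 * p.1 - L))) • jetD T p.1 L (jetConst u) p.2 := by
      rw [Finset.Nat.sum_antidiagonal_succ']
      simp only [Nat.cast_zero, zero_mul, mul_zero, zero_smul, zero_add]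
      refine Finset.sum_congr rfl fun p _ => ?_
      congr 1
      push_cast; ring
    rw [h3, h4, ← Finset.sum_sub_distrib, Finset.smul_sum]
    refine Finset.sum_congr rfl fun p hp => ?_
    rw [HasAntidiagonal.mem_antidiagonal] at hp
    rw [← sub_smul, smul_smul]
    congr 1
    -- What remains is `(a+b)(L-a-b) = a(L-a) - b(b+2a-L)`.
    have e : (k : ℝ) + 1 = p.1 + p.2 := by exact_mod_cast hp.symm
    rw [e]; ring

/-- The transpose of `phi_eq_sum_jetD`, by induction on `c` for all `G` at once. The first applied
factor `ℛ_{-L+2c+1}` is absorbed into `G`, the induction hypothesis is used with the parameter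
`-L+2c`, and `psi_succ` evaluates the terms with `T_N`. The same quadratic identity closes the
induction. -/
theorem jetD_zero_eq_sum_psi (L : ℝ) (c : ℕ) (hL : ∀ m : ℕ, 1 ≤ m → m ≤ c → L ≠ m)
    (G : ℕ → V) :
    alpha L c • jetD T c (-L + 2 * c) G 0 = ∑ p ∈ antidiagonal c, psi T L p.1 (G p.2) := by
  induction c generalizing G with
  | zero => simp [psi_zero, alpha_zero, jetD]
  | succ c ih =>
    have hc := hL (c + 1) (by omega) le_rfl
    have hne : ((c : ℝ) + 1) * (L - (c + 1)) ≠ 0 := by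
      push_cast at hc
      exact mul_ne_zero (by positivity) (sub_ne_zero.2 hc)
    refine smul_right_injective V hne ?_
    dsimp only
    rw [smul_smul, alpha_succ L c hc, jetD_succ_right]
    have e : -L + 2 * ((c + 1 : ℕ) : ℝ) - 2 = -L + 2 * c := by push_cast; ring
    rw [e, ih (fun m h h' => hL m h (by omega))]
    simp only [jetR, psi_add, psi_smul, psi_sum, Finset.sum_add_distrib]
    have h2 : ∑ p ∈ antidiagonal c, ∑ q ∈ antidiagonal p.2,
          (1 / (q.1.factorial : ℝ) ^ 2) • psi T L p.1 (T q.1 (G q.2))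
        = ∑ p ∈ antidiagonal c, (((p.1 : ℝ) + 1) * (L - (p.1 + 1))) • psi T L (p.1 + 1) (G p.2) := by
      rw [← Finset.Nat.sum_antidiagonal_swap, ← Finset.Nat.sum_antidiagonal_swap (n := c)
        (f := fun p => (((p.1 : ℝ) + 1) * (L - (p.1 + 1))) • psi T L (p.1 + 1) (G p.2))]
      have : ∀ p ∈ antidiagonal c, ((((Prod.swap p).1 : ℝ) + 1) * (L - ((Prod.swap p).1 + 1))) •
          psi T L ((Prod.swap p).1 + 1) (G (Prod.swap p).2)
          = ∑ q ∈ antidiagonal p.2, (1 / (q.1.factorial : ℝ) ^ 2) •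
              psi T L q.2 (T q.1 (G p.1)) := by
        intro p hp
        rw [HasAntidiagonal.mem_antidiagonal] at hp
        exact psi_succ T L p.2 (hL _ (by omega) (by omega)) (G p.1)
      rw [Finset.sum_congr rfl this]
      simp only [Prod.fst_swap, Prod.snd_swap]
      rw [Finset.sum_sigma', Finset.sum_sigma']
      refine Finset.sum_nbij' (fun x => ⟨(x.2.2, x.2.1 + x.1.2), (x.2.1, x.1.2)⟩)
        (fun x => ⟨(x.1.1 + x.2.1, x.2.2), (x.2.1, x.1.1)⟩) ?_ ?_ ?_ ?_ ?_ <;>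
      · rintro ⟨⟨a, b⟩, ⟨c, d⟩⟩ h
        simp only [mem_sigma, HasAntidiagonal.mem_antidiagonal, and_true] at h ⊢
        all_goals first
        | omega
        | (obtain ⟨rfl, rfl⟩ := h; simp only [add_comm])
    rw [h2]
    have h3 : ∑ p ∈ antidiagonal c, (((p.1 : ℝ) + 1) * (L - (p.1 + 1))) • psi T L (p.1 + 1) (G p.2)
        = ∑ p ∈ antidiagonal (c + 1), ((p.1 : ℝ) * (L - p.1)) • psi T L p.1 (G p.2) := by
      rw [Finset.Nat.sum_antidiagonal_succ]
      simp
    have h4 : ∑ p ∈ antidiagonal c,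
          (((p.2 : ℝ) + 1) * (p.2 - (-L + 2 * ((c + 1 : ℕ) : ℝ) - 1))) • psi T L p.1 (G (p.2 + 1))
        = ∑ p ∈ antidiagonal (c + 1),
          ((p.2 : ℝ) * (p.2 + L - 2 * (c + 1))) • psi T L p.1 (G p.2) := by
      rw [Finset.Nat.sum_antidiagonal_succ']
      simp only [Nat.cast_zero, zero_mul, zero_smul, zero_add]
      refine Finset.sum_congr rfl fun p _ => ?_
      congr 1
      push_cast; ring
    rw [h3, h4, ← Finset.sum_add_distrib, Finset.smul_sum]
    refine Finset.sum_congr rfl fun p hp => ?_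
    rw [HasAntidiagonal.mem_antidiagonal] at hp
    rw [← add_smul]
    congr 1
    have e : (c : ℝ) + 1 = p.1 + p.2 := by exact_mod_cast hp.symm
    rw [e]; ring

end Jets

end OvsienkoRedou

namespace OvsienkoRedou

open Finset Filter

/-! ### The product formula for generic parameters -/

theorem mem_triples {U : ℕ} {p : ℕ × ℕ × ℕ} : p ∈ triples U ↔ p.1 + p.2.1 + p.2.2 = U := by
  simp only [triples, Finset.mem_filter, Finset.mem_product, Finset.mem_range]
  constructor
  · exact fun h => h.2
  · intro h
    exact ⟨by omega, h⟩

theorem sum_seqTriples {W : Type*} [AddCommMonoid W] (U : ℕ) (f : List ℕ → List ℕ → List ℕ → W) :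
    ∑ A ∈ seqTriples U, f A.1 A.2.1 A.2.2
      = ∑ p ∈ triples U, ∑ A' ∈ seqs p.1, ∑ A₁ ∈ seqs p.2.1, ∑ A₂ ∈ seqs p.2.2, f A' A₁ A₂ := by
  rw [seqTriples, Finset.sum_biUnion]
  · refine Finset.sum_congr rfl fun p _ => ?_
    rw [Finset.sum_product]
    refine Finset.sum_congr rfl fun A' _ => ?_
    rw [Finset.sum_product]
  · rintro ⟨a, b, c⟩ - ⟨a', b', c'⟩ - hne
    rw [Function.onFun, Finset.disjoint_left]
    rintro ⟨A, B, C⟩ h h'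
    simp only [Finset.mem_product, mem_seqs] at h h'
    obtain ⟨rfl, rfl, rfl⟩ := h
    obtain ⟨rfl, rfl, rfl⟩ := h'
    exact hne rfl

/-- The coefficient `(U!)² ∏ (L - m) α_a α_b α_c`. -/
def tripleCoeff (U : ℕ) (L : ℝ) (a b c : ℕ) : ℝ :=
  (U.factorial : ℝ) ^ 2 * (∏ m ∈ Icc 1 U, (L - m)) * (alpha L a * alpha L b * alpha L c)

section Product

variable {V : Type*} [CommRing V] [Algebra ℝ V] (T : ℕ → V →ₗ[ℝ] V)

/-- The product of formal power series. -/
def cauchy (F G : ℕ → V) (k : ℕ) : V := ∑ p ∈ antidiagonal k, F p.1 * G p.2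

/-- The constant term of `D̃_{c,-L+2c}(D̃_{a,L}(u) D̃_{b,L}(v))`. -/
def jetTriple (L : ℝ) (a b c : ℕ) (u v : V) : V :=
  jetD T c (-L + 2 * c) (cauchy (jetD T a L (jetConst u)) (jetD T b L (jetConst v))) 0

/-- Both sides expand to the sum of `α_a α_b ψ_k((D̃_a u)_i (D̃_b v)_j)` over `a + b + k + i + j =
U`. On the left `k + i + j` is grouped together, on the right `a + i` and `b + j`. -/
theorem sum_jetTriple_eq_psi (U : ℕ) (L : ℝ) (hL : ∀ m : ℕ, 1 ≤ m → m ≤ U → L ≠ m) (u v : V) :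
    ∑ p ∈ triples U, (alpha L p.1 * alpha L p.2.1 * alpha L p.2.2) •
        jetTriple T L p.1 p.2.1 p.2.2 u v
      = ∑ q ∈ triples U, psi T L q.1 (phi T L q.2.1 u * phi T L q.2.2 v) := by
  have h1 : ∀ p ∈ triples U, (alpha L p.1 * alpha L p.2.1 * alpha L p.2.2) •
        jetTriple T L p.1 p.2.1 p.2.2 u v
      = ∑ r ∈ antidiagonal p.2.2, ∑ s ∈ antidiagonal r.2, (alpha L p.1 * alpha L p.2.1) •
        psi T L r.1 (jetD T p.1 L (jetConst u) s.1 * jetD T p.2.1 L (jetConst v) s.2) := by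
    intro p hp
    rw [mem_triples] at hp
    rw [mul_smul, jetTriple, jetD_zero_eq_sum_psi T L _ (fun m h h' => hL m h (by omega)),
      Finset.smul_sum]
    refine Finset.sum_congr rfl fun r _ => ?_
    rw [cauchy, psi_sum, Finset.smul_sum]
  have h2 : ∀ q ∈ triples U, psi T L q.1 (phi T L q.2.1 u * phi T L q.2.2 v)
      = ∑ r ∈ antidiagonal q.2.1, ∑ s ∈ antidiagonal q.2.2, (alpha L r.1 * alpha L s.1) •
        psi T L q.1 (jetD T r.1 L (jetConst u) r.2 * jetD T s.1 L (jetConst v) s.2) := by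
    intro q hq
    rw [mem_triples] at hq
    rw [phi_eq_sum_jetD T L u _ (fun m h h' => hL m h (by omega)),
      phi_eq_sum_jetD T L v _ (fun m h h' => hL m h (by omega)), Finset.sum_mul_sum, psi_sum]
    refine Finset.sum_congr rfl fun r _ => ?_
    rw [psi_sum]
    refine Finset.sum_congr rfl fun s _ => ?_
    rw [smul_mul_smul_comm, psi_smul]
  rw [Finset.sum_congr rfl h1, Finset.sum_congr rfl h2]
  simp only [Finset.sum_sigma']
  refine Finset.sum_nbij'
    (fun x => ⟨(x.2.1.1, x.1.1 + x.2.2.1, x.1.2.1 + x.2.2.2), ⟨(x.1.1, x.2.2.1),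
      (x.1.2.1, x.2.2.2)⟩⟩)
    (fun x => ⟨(x.2.1.1, x.2.2.1, x.1.1 + (x.2.1.2 + x.2.2.2)), ⟨(x.1.1, x.2.1.2 + x.2.2.2),
      (x.2.1.2, x.2.2.2)⟩⟩) ?_ ?_ ?_ ?_ ?_
  · rintro ⟨⟨a, b, c⟩, ⟨⟨k, m⟩, ⟨i, j⟩⟩⟩ h
    simp only [mem_sigma, HasAntidiagonal.mem_antidiagonal, mem_triples, and_true] at h ⊢
    omega
  · rintro ⟨⟨a, b, c⟩, ⟨⟨k, m⟩, ⟨i, j⟩⟩⟩ h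
    simp only [mem_sigma, HasAntidiagonal.mem_antidiagonal, mem_triples, and_true] at h ⊢
    omega
  · rintro ⟨⟨a, b, c⟩, ⟨⟨k, m⟩, ⟨i, j⟩⟩⟩ h
    simp only [mem_sigma, HasAntidiagonal.mem_antidiagonal, mem_triples] at h ⊢
    obtain ⟨-, rfl, rfl⟩ := h
    rfl
  · rintro ⟨⟨a, b, c⟩, ⟨⟨k, m⟩, ⟨i, j⟩⟩⟩ h
    simp only [mem_sigma, HasAntidiagonal.mem_antidiagonal, mem_triples] at h ⊢
    obtain ⟨-, rfl, rfl⟩ := h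
    rfl
  · rintro ⟨⟨a, b, c⟩, ⟨⟨k, m⟩, ⟨i, j⟩⟩⟩ h
    rfl

theorem sum_jetTriple_eq_juhl (U : ℕ) (L : ℝ) (hL : ∀ m : ℕ, 1 ≤ m → m ≤ U → L ≠ m) (u v : V) :
    ∑ p ∈ triples U, tripleCoeff U L p.1 p.2.1 p.2.2 • jetTriple T L p.1 p.2.1 p.2.2 u v
      = ∑ A ∈ seqTriples U, juhlCoeff U L A.1 A.2.1 A.2.2 •
          compList T A.1 (compList T A.2.1 u * compList T A.2.2 v) := by
  rw [sum_seqTriples U fun A' A₁ A₂ => juhlCoeff U L A' A₁ A₂ •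
    compList T A' (compList T A₁ u * compList T A₂ v)]
  simp only [tripleCoeff, mul_smul ((U.factorial : ℝ) ^ 2 * (∏ m ∈ Icc 1 U, (L - m)))]
  rw [← Finset.smul_sum, sum_jetTriple_eq_psi T U L hL, Finset.smul_sum]
  refine Finset.sum_congr rfl fun p _ => ?_
  rw [psi, Finset.smul_sum]
  refine Finset.sum_congr rfl fun A' _ => ?_
  let C : V →ₗ[ℝ] V := ⟨⟨compList T A', compList_add T A'⟩, compList_smul T A'⟩
  change _ • _ • C _ = ∑ A₁ ∈ seqs p.2.1, ∑ A₂ ∈ seqs p.2.2, _ • C _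
  rw [phi, phi, Finset.sum_mul_sum, map_sum, Finset.smul_sum, Finset.smul_sum]
  refine Finset.sum_congr rfl fun A₁ _ => ?_
  rw [map_sum, Finset.smul_sum, Finset.smul_sum]
  refine Finset.sum_congr rfl fun A₂ _ => ?_
  rw [smul_mul_smul_comm, map_smul, smul_smul, smul_smul, juhlCoeff]
  congr 1
  ring

end Product

/-! ### Removable singularities -/

/-- Nonintegral parameters accumulate at every `L`; at them the generic formula holds and no Gamma
factor has a pole. -/
theorem eventually_ne_int (L : ℝ) : ∀ᶠ z in 𝓝[≠] L, ∀ k : ℤ, z ≠ (k : ℝ) := by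
  have hc : IsClosed ((fun k : ℤ => (k : ℝ)) '' {k | (k : ℝ) ≠ L}) :=
    Int.isClosedEmbedding_coe_real.isClosedMap _ (isClosed_discrete _)
  have h : ∀ᶠ z in 𝓝 L, z ∉ ((fun k : ℤ => (k : ℝ)) '' {k | (k : ℝ) ≠ L}) := by
    refine hc.isOpen_compl.mem_nhds ?_
    rintro ⟨k, hk, rfl⟩
    exact hk rfl
  filter_upwards [nhdsWithin_le_nhds h, self_mem_nhdsWithin] with z hz hz' k hk
  subst hk
  exact hz ⟨k, hz', rfl⟩

/-- The product of the numbers `z - m`, `m ∈ S`. -/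
def shiftProd (S : Multiset ℕ) (z : ℝ) : ℝ := (S.map fun m : ℕ => z - (m : ℝ)).prod

theorem shiftProd_add (S S' : Multiset ℕ) (z : ℝ) :
    shiftProd (S + S') z = shiftProd S z * shiftProd S' z := by
  simp [shiftProd]

theorem shiftProd_cons (m : ℕ) (S : Multiset ℕ) (z : ℝ) :
    shiftProd (m ::ₘ S) z = (z - m) * shiftProd S z := by
  simp [shiftProd]

theorem continuous_shiftProd (S : Multiset ℕ) : Continuous (shiftProd S) := by
  induction S using Multiset.induction with
  | empty => exact (continuous_const (y := (1 : ℝ))).congr fun z => by simp [shiftProd]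
  | cons a S ih =>
    have : shiftProd (a ::ₘ S) = fun z => (z - a) * shiftProd S z := by
      funext z; exact shiftProd_cons a S z
    rw [this]
    fun_prop

theorem shiftProd_ne_zero {S : Multiset ℕ} {z : ℝ} (h : ∀ m ∈ S, z ≠ m) : shiftProd S z ≠ 0 := by
  rw [shiftProd]
  intro h0
  rw [Multiset.prod_eq_zero_iff] at h0
  obtain ⟨m, hm, e⟩ := Multiset.mem_map.1 h0
  exact h m hm (sub_eq_zero.1 e)

/-- The hypothesis says that the denominator vanishes at `L` to order at most one, and only if the
numerator vanishes there too. Cancelling the common factor leaves a continuous quotient. -/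
theorem exists_tendsto_shiftProd_div (N S : Multiset ℕ) (L : ℝ)
    (h : ∀ m : ℕ, L = m → S.count m ≤ 1 ∧ (m ∈ S → m ∈ N)) :
    ∃ l, Tendsto (fun z => shiftProd N z * (shiftProd S z)⁻¹) (𝓝[≠] L) (𝓝 l) := by
  by_cases hS : ∀ m ∈ S, L ≠ m
  · refine ⟨_, Tendsto.mono_left (ContinuousAt.tendsto ?_) nhdsWithin_le_nhds⟩
    exact (continuous_shiftProd N).continuousAt.mul
      ((continuous_shiftProd S).continuousAt.inv₀ (shiftProd_ne_zero hS))
  · push Not at hS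
    obtain ⟨m, hm, rfl⟩ := hS
    obtain ⟨h1, h2⟩ := h m rfl
    obtain ⟨N', rfl⟩ := Multiset.exists_cons_of_mem (h2 hm)
    obtain ⟨S', rfl⟩ := Multiset.exists_cons_of_mem hm
    have h3 : m ∉ S' := by
      rw [Multiset.count_cons_self] at h1
      exact Multiset.count_eq_zero.1 (by omega)
    have h4 : ∀ k ∈ S', (m : ℝ) ≠ k := by
      intro k hk e
      rw [Nat.cast_inj] at e
      exact h3 (e ▸ hk)
    have h5 : ContinuousAt (fun z => shiftProd N' z * (shiftProd S' z)⁻¹) m :=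
      (continuous_shiftProd N').continuousAt.mul
        ((continuous_shiftProd S').continuousAt.inv₀ (shiftProd_ne_zero h4))
    refine ⟨_, (h5.tendsto.mono_left nhdsWithin_le_nhds).congr' ?_⟩
    filter_upwards [self_mem_nhdsWithin] with z hz
    have hz' : z - m ≠ 0 := sub_ne_zero.2 hz
    rw [shiftProd_cons, shiftProd_cons, mul_inv]
    field_simp

theorem tendsto_regularValue {f : ℝ → ℝ} {a l : ℝ} (h : Tendsto f (𝓝[≠] a) (𝓝 l)) :
    Tendsto f (𝓝[≠] a) (𝓝 (regularValue f a)) := by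
  rwa [regularValue, h.limUnder_eq]

/-- The multiset `{1, …, a}`. -/
def icc (a : ℕ) : Multiset ℕ := (Icc 1 a).val

theorem prod_Icc_eq_shiftProd (a : ℕ) (z : ℝ) :
    ∏ m ∈ Icc 1 a, (z - (m : ℝ)) = shiftProd (icc a) z := rfl

theorem mem_icc {a m : ℕ} : m ∈ icc a ↔ 1 ≤ m ∧ m ≤ a := by
  rw [icc, Finset.mem_val, Finset.mem_Icc]

/-- Multisets of natural numbers without repetitions in `{1, …, a}`. -/
def InIcc (S : Multiset ℕ) (a : ℕ) : Prop := S.Nodup ∧ ∀ m ∈ S, 1 ≤ m ∧ m ≤ a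

/-- A pole at `L = m` occurs only for `2m > U`. Since `a + b + c = U`, at most one of `a, b, c` is
then at least `m`, so the pole is simple, and `m ≤ U` provides the cancelling zero. This treats the
Gamma coefficients and the coefficients of the formula alike. -/
theorem exists_tendsto_of_inIcc {U a b c : ℕ} (hU : a + b + c = U) {L : ℝ}
    (hL : ∀ m : ℕ, 1 ≤ m → 2 * m ≤ U → L ≠ m) {S₁ S₂ S₃ : Multiset ℕ}
    (h₁ : InIcc S₁ a) (h₂ : InIcc S₂ b) (h₃ : InIcc S₃ c) :
    ∃ l, Tendsto (fun z => shiftProd (icc U) z *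
      (shiftProd S₁ z * shiftProd S₂ z * shiftProd S₃ z)⁻¹) (𝓝[≠] L) (𝓝 l) := by
  simp only [← shiftProd_add]
  refine exists_tendsto_shiftProd_div _ _ _ fun m hm => ?_
  have key : ∀ (S : Multiset ℕ) (k : ℕ), InIcc S k →
      S.count m = 0 ∨ (S.count m = 1 ∧ 1 ≤ m ∧ m ≤ k) := by
    intro S k hS
    have h := Multiset.nodup_iff_count_le_one.1 hS.1 m
    by_cases h0 : m ∈ S
    · have := Multiset.count_pos.2 h0
      exact Or.inr ⟨by omega, hS.2 m h0⟩
    · exact Or.inl (Multiset.count_eq_zero.2 h0)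
  have k1 := key _ _ h₁
  have k2 := key _ _ h₂
  have k3 := key _ _ h₃
  have hlarge : 1 ≤ m → U < 2 * m := by
    intro h1
    by_contra h
    exact hL m h1 (by omega) hm
  constructor
  · rw [Multiset.count_add, Multiset.count_add]
    omega
  · intro hmem
    have := Multiset.count_pos.2 hmem
    rw [Multiset.count_add, Multiset.count_add] at this
    rw [mem_icc]
    omega

theorem inIcc_icc (a : ℕ) : InIcc (icc a) a := ⟨(Icc 1 a).nodup, fun _ h => mem_icc.1 h⟩

theorem exists_tendsto_tripleCoeff {U a b c : ℕ} (hU : a + b + c = U) {L : ℝ}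
    (hL : ∀ m : ℕ, 1 ≤ m → 2 * m ≤ U → L ≠ m) :
    ∃ l, Tendsto (fun z => tripleCoeff U z a b c) (𝓝[≠] L) (𝓝 l) := by
  obtain ⟨l, hl⟩ := exists_tendsto_of_inIcc hU hL (inIcc_icc a) (inIcc_icc b) (inIcc_icc c)
  refine ⟨_, (hl.const_mul
    ((U.factorial : ℝ) ^ 2 / (a.factorial * b.factorial * c.factorial))).congr fun z => ?_⟩
  simp only [tripleCoeff, alpha, prod_Icc_eq_shiftProd]
  simp only [div_eq_mul_inv, mul_inv]
  ring

/-- The multiset of the numbers `∑_{j ≤ i} (A_j + 1)`. -/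
def partialSums (A : List ℕ) : Multiset ℕ :=
  (Multiset.range A.length).map fun i => weightSum (A.take (i + 1))

theorem weightSum_take_lt {A : List ℕ} {i : ℕ} (hi : i < A.length) :
    weightSum (A.take i) < weightSum (A.take (i + 1)) := by
  rw [← List.take_append_getElem hi, weightSum_append, weightSum_singleton]
  omega

theorem weightSum_take_mono (A : List ℕ) : Monotone fun i => weightSum (A.take i) := by
  refine monotone_nat_of_le_succ fun i => ?_
  by_cases hi : i < A.length
  · exact (weightSum_take_lt hi).le
  · rw [List.take_of_length_le (by omega), List.take_of_length_le (by omega)]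

/-- Every entry contributes at least `1`, so the partial sums increase strictly: the denominators of
`partialSumCoeff` have simple zeros, at most at `1, …, weightSum A`. -/
theorem inIcc_partialSums (A : List ℕ) : InIcc (partialSums A) (weightSum A) := by
  constructor
  · refine Multiset.Nodup.map_on ?_ (Multiset.nodup_range _)
    have key : ∀ i j, i < j → j < A.length →
        weightSum (A.take (i + 1)) < weightSum (A.take (j + 1)) := fun i j hij hj =>
      (weightSum_take_mono A (show i + 1 ≤ j by omega)).trans_lt (weightSum_take_lt hj)
    intro i hi j hj e
    rw [Multiset.mem_range] at hi hj
    rcases lt_trichotomy i j with h | h | h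
    · exact absurd e (key i j h hj).ne
    · exact h
    · exact absurd e (key j i h hi).ne'
  · intro m hm
    obtain ⟨i, hi, rfl⟩ := Multiset.mem_map.1 hm
    rw [Multiset.mem_range] at hi
    refine ⟨by have := weightSum_take_lt hi; omega, ?_⟩
    have := weightSum_take_mono A (show i + 1 ≤ A.length by omega)
    simpa using this

theorem partialSumCoeff_eq (L : ℝ) (A : List ℕ) :
    partialSumCoeff L A = (∏ i ∈ range A.length, 1 / (weightSum (A.take (i + 1)) : ℝ)) *
      (shiftProd (partialSums A) L)⁻¹ := by
  rw [partialSumCoeff]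
  congr 1
  simp only [one_div, Finset.prod_inv_distrib]
  rw [shiftProd, partialSums, Multiset.map_map]
  rfl

theorem exists_tendsto_juhlCoeff {U : ℕ} {A' A₁ A₂ : List ℕ}
    (hU : weightSum A' + weightSum A₁ + weightSum A₂ = U) {L : ℝ}
    (hL : ∀ m : ℕ, 1 ≤ m → 2 * m ≤ U → L ≠ m) :
    ∃ l, Tendsto (fun z => juhlCoeff U z A' A₁ A₂) (𝓝[≠] L) (𝓝 l) := by
  have h' := inIcc_partialSums A'.reverse
  rw [weightSum_reverse] at h'
  obtain ⟨l, hl⟩ := exists_tendsto_of_inIcc hU hL h' (inIcc_partialSums A₁) (inIcc_partialSums A₂)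
  refine ⟨_, (hl.const_mul ((U.factorial : ℝ) ^ 2 *
    (factorialCoeff A₁ * factorialCoeff A₂ * factorialCoeff A') *
    ((∏ i ∈ range A₁.length, 1 / (weightSum (A₁.take (i + 1)) : ℝ)) *
    (∏ i ∈ range A₂.length, 1 / (weightSum (A₂.take (i + 1)) : ℝ)) *
    (∏ i ∈ range A'.reverse.length, 1 / (weightSum (A'.reverse.take (i + 1)) : ℝ))))).congr
      fun z => ?_⟩
  simp only [juhlCoeff, prod_Icc_eq_shiftProd, partialSumCoeff_eq, mul_inv]
  ring

theorem regularValue_juhlCoeff {U : ℕ} {A' A₁ A₂ : List ℕ}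
    (hU : weightSum A' + weightSum A₁ + weightSum A₂ = U) {L : ℝ}
    (hL : ∀ m : ℕ, 1 ≤ m → m ≤ U → L ≠ m) :
    regularValue (fun z => juhlCoeff U z A' A₁ A₂) L = juhlCoeff U L A' A₁ A₂ := by
  have key : ∀ A : List ℕ, weightSum A ≤ U →
      Tendsto (fun z => partialSumCoeff z A) (𝓝[≠] L) (𝓝 (partialSumCoeff L A)) := by
    intro A hA
    simp only [partialSumCoeff_eq]
    refine Tendsto.mono_left (ContinuousAt.tendsto ?_) nhdsWithin_le_nhds
    refine continuousAt_const.mul ((continuous_shiftProd _).continuousAt.inv₀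
      (shiftProd_ne_zero fun m hm => ?_))
    have := (inIcc_partialSums A).2 m hm
    exact hL m this.1 (by omega)
  refine Tendsto.limUnder_eq ?_
  simp only [juhlCoeff, prod_Icc_eq_shiftProd]
  exact ((((continuous_shiftProd _).tendsto L).mono_left nhdsWithin_le_nhds).const_mul _
    |>.mul_const _).mul (((key A₁ (by omega)).mul (key A₂ (by omega))).mul
      (key A'.reverse (by rw [weightSum_reverse]; omega)))

/-! ### Quotients of Gamma functions -/

theorem Gamma_sub_nat_mul_shiftProd (z : ℝ) (hz : ∀ k : ℤ, z ≠ k) (a : ℕ) :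
    Real.Gamma (z - a) * shiftProd (icc a) z = Real.Gamma z := by
  rw [← prod_Icc_eq_shiftProd]
  induction a with
  | zero => simp
  | succ a ih =>
    rw [Finset.prod_Icc_succ_top (by omega), ← ih]
    have h : z - ((a + 1 : ℕ) : ℝ) ≠ 0 := by
      have := hz ((a + 1 : ℕ) : ℤ)
      rw [Int.cast_natCast] at this
      exact sub_ne_zero.2 this
    have e : z - (a : ℝ) = z - ((a + 1 : ℕ) : ℝ) + 1 := by push_cast; ring
    rw [e, Real.Gamma_add_one h]
    ring

theorem Gamma_ne_zero_of_ne_int {z : ℝ} (hz : ∀ k : ℤ, z ≠ k) : Real.Gamma z ≠ 0 := by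
  refine Real.Gamma_ne_zero fun m => ?_
  have := hz (-m)
  push_cast at this
  exact this

theorem Gamma_quotient_eq {U a b c : ℕ} (z : ℝ) (hz : ∀ k : ℤ, z ≠ k) :
    Real.Gamma (z - a) * Real.Gamma (z - b) * Real.Gamma (z - c)
      / (Real.Gamma (z - U) * Real.Gamma z ^ 2)
      = shiftProd (icc U) z * (shiftProd (icc a) z * shiftProd (icc b) z * shiftProd (icc c) z)⁻¹ := by
  have hn : ∀ k, shiftProd (icc k) z ≠ 0 := fun k => shiftProd_ne_zero fun m _ => by
    have := hz m
    rwa [Int.cast_natCast] at this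
  have hG : ∀ k : ℕ, Real.Gamma (z - k) = Real.Gamma z / shiftProd (icc k) z := fun k => by
    rw [eq_div_iff (hn k), Gamma_sub_nat_mul_shiftProd z hz]
  have := Gamma_ne_zero_of_ne_int hz
  rw [hG a, hG b, hG c, hG U]
  have h1 := hn a
  have h2 := hn b
  have h3 := hn c
  have h4 := hn U
  field_simp

/-- Moving `L, K₁, K₂` simultaneously by `t` is harmless: the Gamma factors with `K₁` or `K₂` are
continuous near positive integers and tend to factorials, while those with `L` form the rational
function by the functional equation. -/
theorem tendsto_tripleCoeff_gammaCoeff {U a b c : ℕ} (hU : a + b + c = U) {L : ℝ}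
    (hL : ∀ m : ℕ, 1 ≤ m → 2 * m ≤ U → L ≠ m) :
    Tendsto (fun z => tripleCoeff U z a b c) (𝓝[≠] L) (𝓝 (gammaCoeff U 0 L 0 0 a b c)) := by
  obtain ⟨l, hl⟩ := exists_tendsto_tripleCoeff hU hL
  suffices h : gammaCoeff U 0 L 0 0 a b c = l by rwa [h]
  refine Tendsto.limUnder_eq ?_
  have hshift : Tendsto (fun t : ℝ => L + t) (𝓝[≠] 0) (𝓝[≠] L) := by
    refine tendsto_nhdsWithin_iff.2 ⟨?_, ?_⟩
    · have : Tendsto (fun t : ℝ => L + t) (𝓝 0) (𝓝 (L + 0)) := by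
        exact (continuous_const.add continuous_id).tendsto 0
      rw [add_zero] at this
      exact this.mono_left nhdsWithin_le_nhds
    · filter_upwards [self_mem_nhdsWithin] with t ht
      simpa using ht
  have hG : ∀ k : ℕ, Tendsto (fun t : ℝ => Real.Gamma (k + (0 + t) + 1)) (𝓝[≠] 0)
      (𝓝 (k.factorial : ℝ)) := by
    intro k
    have h1 : ContinuousAt Real.Gamma (k + (0 + 0) + 1) := by
      refine (Real.differentiableAt_Gamma fun m => ?_).continuousAt
      have : (0 : ℝ) ≤ m := by positivity
      have : (0 : ℝ) ≤ k := by positivity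
      linarith
    have h2 : ContinuousAt (fun t : ℝ => Real.Gamma (k + (0 + t) + 1)) 0 :=
      ContinuousAt.comp (f := fun t : ℝ => k + (0 + t) + 1) h1 (by fun_prop)
    have h3 := h2.tendsto.mono_left (nhdsWithin_le_nhds (s := {0}ᶜ))
    rwa [add_zero, add_zero, Real.Gamma_nat_eq_factorial] at h3
  have hk : Tendsto (fun t : ℝ => Real.Gamma (U + (0 + t) + 1) * Real.Gamma (U + (0 + t) + 1)
      / (Real.Gamma (a + (0 + t) + 1) * Real.Gamma (b + (0 + t) + 1) * Real.Gamma (c + 1)))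
      (𝓝[≠] 0) (𝓝 ((U.factorial : ℝ) * U.factorial / (a.factorial * b.factorial * c.factorial))) := by
    rw [Real.Gamma_nat_eq_factorial]
    refine ((hG U).mul (hG U)).div (((hG a).mul (hG b)).mul_const _) ?_
    positivity
  -- The quotient of Gamma functions is `tripleCoeff` at `L + t` times the factor of `hk` divided by
  -- its limit, a correction that tends to `1`.
  have hw := (hl.comp hshift).mul (hk.mul_const
    (((U.factorial : ℝ) * U.factorial / (a.factorial * b.factorial * c.factorial))⁻¹))
  rw [mul_inv_cancel₀ (by positivity), mul_one] at hw
  refine hw.congr' ?_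
  filter_upwards [hshift.eventually (eventually_ne_int L)] with t ht
  have e := Gamma_quotient_eq (U := U) (a := a) (b := b) (c := c) (L + t) ht
  simp only [gammaQuotient, Function.comp_apply, Nat.cast_zero, add_zero]
  rw [e]
  simp only [tripleCoeff, alpha, prod_Icc_eq_shiftProd, mul_inv, one_div, inv_div]
  have h1 : (U.factorial : ℝ) ≠ 0 := by positivity
  have h2 : (a.factorial : ℝ) ≠ 0 := by positivity
  have h3 : (b.factorial : ℝ) ≠ 0 := by positivity
  have h4 : (c.factorial : ℝ) ≠ 0 := by positivity
  field_simp

/-! ### Polynomial dependence on the parameter -/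

section Poly

variable {W : Type*} [AddCommGroup W] [Module ℝ W]

/-- Functions of a real variable that are polynomials with coefficients in a vector space. -/
inductive PolyDep : (ℝ → W) → Prop
  | const (w : W) : PolyDep fun _ => w
  | add {f g : ℝ → W} : PolyDep f → PolyDep g → PolyDep fun z => f z + g z
  | var_smul {f : ℝ → W} : PolyDep f → PolyDep fun z => z • f z

theorem PolyDep.map {W' : Type*} [AddCommGroup W'] [Module ℝ W'] {f : ℝ → W} (hf : PolyDep f)
    (A : W →ₗ[ℝ] W') : PolyDep fun z => A (f z) := by
  induction hf with
  | const w => exact .const _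
  | add _ _ h1 h2 => simpa only [map_add] using h1.add h2
  | var_smul _ h => simpa only [map_smul] using h.var_smul

theorem PolyDep.const_smul {f : ℝ → W} (hf : PolyDep f) (c : ℝ) : PolyDep fun z => c • f z :=
  hf.map (c • LinearMap.id)

theorem PolyDep.affine_smul {f : ℝ → W} (hf : PolyDep f) (c d : ℝ) :
    PolyDep fun z => (c + d * z) • f z := by
  have := (hf.const_smul c).add (hf.const_smul d).var_smul
  simpa only [add_smul, smul_smul, mul_comm] using this

theorem PolyDep.sum {ι : Type*} (s : Finset ι) {f : ι → ℝ → W} (hf : ∀ i ∈ s, PolyDep (f i)) :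
    PolyDep fun z => ∑ i ∈ s, f i z := by
  classical
  induction s using Finset.induction_on with
  | empty => simpa using PolyDep.const 0
  | insert a s ha ih =>
    simp only [Finset.sum_insert ha]
    exact (hf a (mem_insert_self _ _)).add (ih fun i hi => hf i (mem_insert_of_mem hi))

/-- `W` carries no topology, so continuity is stated after a linear functional; in the application
this is evaluation at a point of `M`. -/
theorem PolyDep.continuous {f : ℝ → W} (hf : PolyDep f) (ev : W →ₗ[ℝ] ℝ) :
    Continuous fun z => ev (f z) := by
  induction hf with
  | const w => exact continuous_const
  | add _ _ h1 h2 =>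
    simp only [map_add]
    exact h1.add h2
  | var_smul _ h =>
    simp only [map_smul, smul_eq_mul]
    exact continuous_id.mul h

theorem PolyDep.mul {V : Type*} [CommRing V] [Algebra ℝ V] {f g : ℝ → V} (hf : PolyDep f)
    (hg : PolyDep g) : PolyDep fun z => f z * g z := by
  induction hf with
  | const w => exact hg.map (LinearMap.mulLeft ℝ w)
  | add _ _ h1 h2 => simpa only [add_mul] using h1.add h2
  | var_smul _ h => simpa only [smul_mul_assoc] using h.var_smul

theorem PolyDep.jetR (T : ℕ → W →ₗ[ℝ] W) {F : ℝ → ℕ → W} (hF : ∀ k, PolyDep fun z => F z k)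
    (c d : ℝ) (k : ℕ) : PolyDep fun z => jetR T (c + d * z) (F z) k := by
  refine PolyDep.add ?_ (PolyDep.sum _ fun p _ => ((hF p.2).map (T p.1)).const_smul _)
  have := (hF (k + 1)).affine_smul (((k : ℝ) + 1) * (k - c)) (-(((k : ℝ) + 1) * d))
  convert this using 3
  ring

theorem PolyDep.jetD (T : ℕ → W →ₗ[ℝ] W) {F : ℝ → ℕ → W} (hF : ∀ k, PolyDep fun z => F z k)
    (c d : ℝ) (m k : ℕ) : PolyDep fun z => jetD T m (c + d * z) (F z) k := by
  induction m generalizing k with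
  | zero => exact hF k
  | succ m ih =>
    have := PolyDep.jetR T ih (c + 1 - 2 * ((m : ℝ) + 1)) d k
    convert this using 2 with z
    rw [OvsienkoRedou.jetD]
    congr 1
    ring

theorem PolyDep.jetTriple {V : Type*} [CommRing V] [Algebra ℝ V] (T : ℕ → V →ₗ[ℝ] V) (a b c : ℕ)
    (u v : V) : PolyDep fun z => jetTriple T z a b c u v := by
  have h : ∀ (a : ℕ) (u : V) (k : ℕ), PolyDep fun z => OvsienkoRedou.jetD T a z (jetConst u) k := by
    intro a u k
    have := PolyDep.jetD T (F := fun _ => jetConst u) (fun k => .const _) 0 1 a k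
    simpa only [zero_add, one_mul] using this
  have h2 : ∀ k, PolyDep fun z => cauchy (OvsienkoRedou.jetD T a z (jetConst u))
      (OvsienkoRedou.jetD T b z (jetConst v)) k := fun k =>
    PolyDep.sum _ fun p _ => (h a u p.1).mul (h b v p.2)
  have := PolyDep.jetD T h2 (2 * c) (-1) c 0
  convert this using 2 with z
  rw [OvsienkoRedou.jetTriple]
  congr 1
  ring

end Poly

/-- The two sides are limits, as `z → L`, of functions that agree for nonintegral `z`. The operators
on the left also depend on `z`, but polynomially. -/
theorem eval_sum_jetTriple_eq_juhl {V : Type*} [CommRing V] [Algebra ℝ V] (T : ℕ → V →ₗ[ℝ] V)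
    (ev : V →ₗ[ℝ] ℝ) {U : ℕ} {L : ℝ} (hL : ∀ m : ℕ, 1 ≤ m → 2 * m ≤ U → L ≠ m) (u v : V) :
    ∑ p ∈ triples U, gammaCoeff U 0 L 0 0 p.1 p.2.1 p.2.2 *
        ev (jetTriple T L p.1 p.2.1 p.2.2 u v)
      = ∑ A ∈ seqTriples U, regularValue (fun z => juhlCoeff U z A.1 A.2.1 A.2.2) L *
          ev (compList T A.1 (compList T A.2.1 u * compList T A.2.2 v)) := by
  have h1 : Tendsto (fun z => ∑ p ∈ triples U, tripleCoeff U z p.1 p.2.1 p.2.2 *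
        ev (jetTriple T z p.1 p.2.1 p.2.2 u v)) (𝓝[≠] L)
      (𝓝 (∑ p ∈ triples U, gammaCoeff U 0 L 0 0 p.1 p.2.1 p.2.2 *
        ev (jetTriple T L p.1 p.2.1 p.2.2 u v))) := by
    refine tendsto_finsetSum _ fun p hp => ?_
    rw [mem_triples] at hp
    exact (tendsto_tripleCoeff_gammaCoeff hp hL).mul
      ((((PolyDep.jetTriple T p.1 p.2.1 p.2.2 u v).continuous ev).tendsto L).mono_left
        nhdsWithin_le_nhds)
  have h2 : Tendsto (fun z => ∑ A ∈ seqTriples U, juhlCoeff U z A.1 A.2.1 A.2.2 *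
          ev (compList T A.1 (compList T A.2.1 u * compList T A.2.2 v))) (𝓝[≠] L)
      (𝓝 (∑ A ∈ seqTriples U, regularValue (fun z => juhlCoeff U z A.1 A.2.1 A.2.2) L *
          ev (compList T A.1 (compList T A.2.1 u * compList T A.2.2 v)))) := by
    refine tendsto_finsetSum _ fun A hA => ?_
    obtain ⟨l, hl⟩ := exists_tendsto_juhlCoeff (mem_seqTriples.1 hA) hL
    exact (tendsto_regularValue hl).mul_const _
  refine tendsto_nhds_unique h1 (h2.congr' ?_)
  filter_upwards [eventually_ne_int L] with z hz
  have := congrArg ev (sum_jetTriple_eq_juhl T U z (fun m _ _ => by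
    have := hz m
    rwa [Int.cast_natCast] at this) u v)
  simp only [map_sum, map_smul, smul_eq_mul] at this
  exact this.symm

end OvsienkoRedou

namespace OvsienkoRedou

open Filter

/-! ### The ring of smooth functions on an open set -/

section SmoothRing

variable {X : Type*} [NormedAddCommGroup X]

/-- The extension by zero of a function on an open set. -/
def extZero {Ω : TopologicalSpace.Opens X} (f : Ω → ℝ) : X → ℝ := Function.extend Subtype.val f 0

theorem extZero_apply {Ω : TopologicalSpace.Opens X} (f : Ω → ℝ) (p : Ω) :
    extZero f p = f p := Subtype.val_injective.extend_apply f 0 p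

/-- On an open set only germs matter for derivatives, so the extension by zero is as good as any
other. -/
theorem extZero_eventuallyEq {Ω : TopologicalSpace.Opens X} {f : Ω → ℝ} {H : X → ℝ}
    (h : ∀ p : Ω, f p = H p) (p : Ω) : extZero f =ᶠ[𝓝 (p : X)] H := by
  filter_upwards [Ω.isOpen.mem_nhds p.2] with q hq
  rw [← h ⟨q, hq⟩]
  exact extZero_apply f ⟨q, hq⟩

variable [NormedSpace ℝ X]

theorem contDiffOn_extZero_iff {Ω : TopologicalSpace.Opens X} {f : Ω → ℝ} {H : X → ℝ}
    (h : ∀ p : Ω, f p = H p) : ContDiffOn ℝ ∞ (extZero f) Ω ↔ ContDiffOn ℝ ∞ H Ω := by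
  refine contDiffOn_congr fun q hq => ?_
  rw [← h ⟨q, hq⟩]
  exact extZero_apply f ⟨q, hq⟩

/-- The algebra of smooth functions on an open set. -/
def SF (Ω : TopologicalSpace.Opens X) : Subalgebra ℝ (Ω → ℝ) where
  carrier := {f | ContDiffOn ℝ ∞ (extZero f) Ω}
  mul_mem' {f g} hf hg := by
    refine (contDiffOn_extZero_iff (H := fun x => extZero f x * extZero g x) fun p => ?_).2
      (ContDiffOn.mul hf hg)
    rw [extZero_apply, extZero_apply, Pi.mul_apply]
  add_mem' {f g} hf hg := by
    refine (contDiffOn_extZero_iff (H := fun x => extZero f x + extZero g x) fun p => ?_).2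
      (ContDiffOn.add hf hg)
    rw [extZero_apply, extZero_apply, Pi.add_apply]
  algebraMap_mem' r :=
    (contDiffOn_extZero_iff (H := fun _ => r) fun _ => rfl).2 contDiffOn_const

variable {Ω : TopologicalSpace.Opens X}

namespace SF

instance : CoeFun (SF Ω) fun _ => Ω → ℝ := ⟨Subtype.val⟩

@[ext] theorem ext {f g : SF Ω} (h : ∀ p, f p = g p) : f = g := Subtype.ext (funext h)

/-- A smooth function on `Ω` given by a function on the whole space. -/
def mk (H : X → ℝ) (hH : ContDiffOn ℝ ∞ H Ω) : SF Ω :=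
  ⟨fun p => H p, (contDiffOn_extZero_iff fun _ => rfl).2 hH⟩

@[simp] theorem mk_apply (H : X → ℝ) (hH : ContDiffOn ℝ ∞ H Ω) (p : Ω) : mk H hH p = H p := rfl

@[simp] theorem add_apply (f g : SF Ω) (p : Ω) : (f + g) p = f p + g p := rfl
@[simp] theorem sub_apply (f g : SF Ω) (p : Ω) : (f - g) p = f p - g p := rfl
@[simp] theorem neg_apply (f : SF Ω) (p : Ω) : (-f) p = -f p := rfl
@[simp] theorem mul_apply (f g : SF Ω) (p : Ω) : (f * g) p = f p * g p := rfl
@[simp] theorem smul_apply (c : ℝ) (f : SF Ω) (p : Ω) : (c • f) p = c * f p := rfl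
@[simp] theorem zero_apply (p : Ω) : (0 : SF Ω) p = 0 := rfl
@[simp] theorem one_apply (p : Ω) : (1 : SF Ω) p = 1 := rfl

/-- Evaluation at a point. -/
def eval (p : Ω) : SF Ω →+* ℝ where
  toFun f := f p
  map_one' := rfl
  map_mul' _ _ := rfl
  map_zero' := rfl
  map_add' _ _ := rfl

theorem eval_apply (p : Ω) (f : SF Ω) : eval p f = f p := rfl

@[simp] theorem pow_apply (f : SF Ω) (k : ℕ) (p : Ω) : (f ^ k) p = f p ^ k := map_pow (eval p) f k

@[simp] theorem sum_apply {ι : Type*} (s : Finset ι) (f : ι → SF Ω) (p : Ω) :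
    (∑ i ∈ s, f i) p = ∑ i ∈ s, f i p := map_sum (eval p) f s

@[simp] theorem natCast_apply (k : ℕ) (p : Ω) : (k : SF Ω) p = k := map_natCast (eval p) k

@[simp] theorem ofNat_apply (k : ℕ) [k.AtLeastTwo] (p : Ω) :
    (OfNat.ofNat k : SF Ω) p = OfNat.ofNat k := map_ofNat (eval p) k

theorem smoothOn (f : SF Ω) : ContDiffOn ℝ ∞ (extZero f) Ω := f.2

theorem smoothAt (f : SF Ω) (p : Ω) : ContDiffAt ℝ ∞ (extZero f) p :=
  ContDiffOn.contDiffAt f.2 (Ω.isOpen.mem_nhds p.2)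

theorem diffAt (f : SF Ω) (p : Ω) : DifferentiableAt ℝ (extZero f) p :=
  (smoothAt f p).differentiableAt (by simp)

theorem contDiffOn_comp (φ : ℝ → ℝ) (f : SF Ω) (h : ∀ p, ContDiffAt ℝ ∞ φ (f p)) :
    ContDiffOn ℝ ∞ (fun x => φ (extZero f x)) Ω := fun x hx => by
  have h' := h ⟨x, hx⟩
  rw [← extZero_apply f ⟨x, hx⟩] at h'
  exact (h'.comp x (smoothAt f ⟨x, hx⟩)).contDiffWithinAt

/-- The composition of a smooth function on `Ω` with a function that is smooth on its range. -/
def comp (φ : ℝ → ℝ) (f : SF Ω) (h : ∀ p, ContDiffAt ℝ ∞ φ (f p)) : SF Ω :=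
  mk (fun x => φ (extZero f x)) (contDiffOn_comp φ f h)

@[simp] theorem comp_apply (φ : ℝ → ℝ) (f : SF Ω) (h : ∀ p, ContDiffAt ℝ ∞ φ (f p)) (p : Ω) :
    comp φ f h p = φ (f p) := by
  rw [comp, mk_apply, extZero_apply]

theorem isUnit_of_ne_zero {f : SF Ω} (h : ∀ p, f p ≠ 0) : IsUnit f := by
  refine IsUnit.of_mul_eq_one (comp (fun t => t⁻¹) f fun p => contDiffAt_inv ℝ (h p)) ?_
  ext p
  simp [h p]

/-- The derivative of a smooth function in a constant direction. -/
def dirDeriv (v : X) (f : SF Ω) : SF Ω :=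
  mk (fun x => fderiv ℝ (extZero f) x v)
    (((smoothOn f).fderiv_of_isOpen Ω.isOpen (by simp)).clm_apply contDiffOn_const)

theorem dirDeriv_apply (v : X) (f : SF Ω) (p : Ω) :
    dirDeriv v f p = fderiv ℝ (extZero f) p v := rfl

theorem dirDeriv_eq (v : X) (f : SF Ω) {H : X → ℝ} (h : ∀ p : Ω, f p = H p) (p : Ω) :
    dirDeriv v f p = fderiv ℝ H p v := by
  rw [dirDeriv_apply, (extZero_eventuallyEq h p).fderiv_eq]

/-- The derivative in a constant direction as a derivation. -/
def d (v : X) : Derivation ℝ (SF Ω) (SF Ω) :=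
  Derivation.mk'
    { toFun := dirDeriv v
      map_add' := fun f g => by
        ext p
        rw [dirDeriv_eq v (f + g) (H := extZero f + extZero g)
          (fun p => by simp [extZero_apply]), fderiv_add (diffAt f p)
            (diffAt g p)]
        rfl
      map_smul' := fun c f => by
        ext p
        rw [dirDeriv_eq v (c • f) (H := c • extZero f)
          (fun p => by simp [extZero_apply]), fderiv_const_smul (diffAt f p)]
        rfl }
    fun f g => by
      ext p
      simp only [LinearMap.coe_mk, AddHom.coe_mk]
      rw [dirDeriv_eq v (f * g) (H := extZero f * extZero g)
        (fun p => by simp [extZero_apply]), fderiv_mul (diffAt f p)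
          (diffAt g p)]
      simp [dirDeriv_apply, extZero_apply]

theorem d_apply (v : X) (f : SF Ω) (p : Ω) : d v f p = fderiv ℝ (extZero f) p v := rfl

theorem d_eq (v : X) (f : SF Ω) {H : X → ℝ} (h : ∀ p : Ω, f p = H p) (p : Ω) :
    d v f p = fderiv ℝ H p v := dirDeriv_eq v f h p

theorem d_mk (v : X) (H : X → ℝ) (hH : ContDiffOn ℝ ∞ H Ω) (p : Ω) :
    d v (mk H hH) p = fderiv ℝ H p v := d_eq v _ (fun _ => rfl) p

theorem d_zero_dir (f : SF Ω) : d (0 : X) f = 0 := by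
  ext p
  rw [d_apply, map_zero, zero_apply]

theorem two_le_smooth : (2 : WithTop ℕ∞) ≤ ∞ := by
  have h : ((2 : ℕ∞) : WithTop ℕ∞) ≤ ((⊤ : ℕ∞) : WithTop ℕ∞) := WithTop.coe_le_coe.2 le_top
  exact h

theorem d_comm (v w : X) (f : SF Ω) : d v (d w f) = d w (d v f) := by
  ext p
  have key : ∀ v w : X, d v (d w f) p = fderiv ℝ (fderiv ℝ (extZero f)) p v w := by
    intro v w
    rw [d_eq v (d w f) (H := fun x => fderiv ℝ (extZero f) x w) (fun p => d_apply w f p)]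
    rw [fderiv_clm_apply _ (differentiableAt_const w)]
    · simp
    · exact ((smoothAt f p).fderiv_right (m := 1) two_le_smooth).differentiableAt (by simp)
  rw [key, key]
  exact (smoothAt f p).isSymmSndFDerivAt (by
    rw [minSmoothness_of_isRCLikeNormedField]
    exact two_le_smooth) v w

section Pull

variable {X' : Type*} [NormedAddCommGroup X'] [NormedSpace ℝ X'] {Ω' : TopologicalSpace.Opens X'}

theorem contDiffOn_pull (π : X' →L[ℝ] X) (h : ∀ p ∈ Ω', π p ∈ Ω) (f : SF Ω) :
    ContDiffOn ℝ ∞ (fun x => extZero f (π x)) Ω' :=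
  (smoothOn f).comp π.contDiff.contDiffOn fun x hx => h x hx

/-- The pullback of smooth functions along a linear map. -/
def pull (π : X' →L[ℝ] X) (h : ∀ p ∈ Ω', π p ∈ Ω) : SF Ω →ₐ[ℝ] SF Ω' where
  toFun f := mk (fun x => extZero f (π x)) (contDiffOn_pull π h f)
  map_one' := by
    ext p
    exact extZero_apply _ ⟨π p, h p p.2⟩
  map_zero' := by
    ext p
    exact extZero_apply _ ⟨π p, h p p.2⟩
  map_mul' f g := by
    ext p
    simp only [mk_apply, mul_apply]
    rw [extZero_apply _ ⟨π p, h p p.2⟩, extZero_apply _ ⟨π p, h p p.2⟩,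
      extZero_apply _ ⟨π p, h p p.2⟩, mul_apply]
  map_add' f g := by
    ext p
    simp only [mk_apply, add_apply]
    rw [extZero_apply _ ⟨π p, h p p.2⟩, extZero_apply _ ⟨π p, h p p.2⟩,
      extZero_apply _ ⟨π p, h p p.2⟩, add_apply]
  commutes' r := by
    ext p
    exact extZero_apply _ ⟨π p, h p p.2⟩

theorem pull_apply (π : X' →L[ℝ] X) (h : ∀ p ∈ Ω', π p ∈ Ω) (f : SF Ω) (p : Ω') :
    pull π h f p = f ⟨π p, h p p.2⟩ := extZero_apply _ ⟨π p, h p p.2⟩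

theorem d_pull (π : X' →L[ℝ] X) (h : ∀ p ∈ Ω', π p ∈ Ω) (f : SF Ω) (v : X') :
    d v (pull π h f) = pull π h (d (π v) f) := by
  ext p
  rw [pull_apply, d_eq v (pull π h f) (H := fun x => extZero f (π x)) (fun _ => rfl), d_apply]
  have : fderiv ℝ (extZero f ∘ π) p = (fderiv ℝ (extZero f) (π p)).comp (fderiv ℝ π p) :=
    fderiv_comp (p : X') (diffAt f ⟨π p, h p p.2⟩) π.differentiableAt
  change (fderiv ℝ (extZero f ∘ π) p) v = _
  rw [this, π.fderiv]
  rfl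

end Pull

end SF

end SmoothRing

end OvsienkoRedou

/-! ### Changes of coordinates on the manifold -/

namespace OvsienkoRedou

open Filter Set

/-- The coordinate space. -/
abbrev Eu (n : ℕ) : Type := EuclideanSpace ℝ (Fin n)

set_option linter.unusedSectionVars false

section Charts

variable {n : ℕ} {M : Type*} [TopologicalSpace M]
  [ChartedSpace (EuclideanSpace ℝ (Fin n)) M] [IsManifold (𝓡 n) ∞ M]

instance instIsManifoldOne : IsManifold (𝓡 n) 1 M := IsManifold.of_le (n := ∞) (by simp)

theorem mdifferentiable_atlas (e : atlas (Eu n) M) : e.1.MDifferentiable (𝓡 n) 𝓘(ℝ, Eu n) :=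
  mdifferentiable_of_mem_atlas e.2

theorem mfderiv_symm_bijective (e : atlas (Eu n) M) {y : Eu n} (hy : y ∈ e.1.target) :
    Function.Bijective (mfderiv 𝓘(ℝ, Eu n) (𝓡 n) e.1.symm y) :=
  (mdifferentiable_atlas e).symm.mfderiv_bijective hy

/-- The matrix of the derivative of a change of coordinates. -/
def jacobian (e e' : atlas (Eu n) M) (x : M) : Matrix (Fin n) (Fin n) ℝ :=
  Matrix.of fun i a => fderiv ℝ (e'.1 ∘ e.1.symm) (e.1 x) (EuclideanSpace.single a 1) i

theorem differentiableAt_transition (e e' : atlas (Eu n) M) {x : M} (hx : x ∈ e.1.source)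
    (hx' : x ∈ e'.1.source) : DifferentiableAt ℝ (e'.1 ∘ e.1.symm) (e.1 x) := by
  rw [← mdifferentiableAt_iff_differentiableAt]
  refine MDifferentiableAt.comp (I' := 𝓡 n) (e.1 x) ?_
    ((mdifferentiable_atlas e).mdifferentiableAt_symm (e.1.map_source hx))
  rw [e.1.left_inv hx]
  exact (mdifferentiable_atlas e').mdifferentiableAt hx'

theorem symm_eventuallyEq (e e' : atlas (Eu n) M) {x : M} (hx : x ∈ e.1.source)
    (hx' : x ∈ e'.1.source) :
    e.1.symm =ᶠ[𝓝 (e.1 x)] e'.1.symm ∘ (e'.1 ∘ e.1.symm) := by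
  have h1 : ∀ᶠ y in 𝓝 (e.1 x), e.1.symm y ∈ e'.1.source := by
    refine (e.1.continuousAt_symm (e.1.map_source hx)).eventually ?_
    rw [e.1.left_inv hx]
    exact e'.1.open_source.mem_nhds hx'
  filter_upwards [h1] with y hy
  exact (e'.1.left_inv hy).symm

theorem sum_jacobian_smul (e e' : atlas (Eu n) M) (x : M) (a : Fin n) :
    fderiv ℝ (e'.1 ∘ e.1.symm) (e.1 x) (EuclideanSpace.single a 1)
      = ∑ i, jacobian e e' x i a • (EuclideanSpace.single i 1 : Eu n) := by
  ext k
  simp [jacobian, Pi.single_apply]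

theorem mfderiv_symm_eq (e e' : atlas (Eu n) M) {x : M} (hx : x ∈ e.1.source)
    (hx' : x ∈ e'.1.source) (v : Eu n) :
    (mfderiv 𝓘(ℝ, Eu n) (𝓡 n) e.1.symm (e.1 x) v : Eu n)
      = mfderiv 𝓘(ℝ, Eu n) (𝓡 n) e'.1.symm (e'.1 x) (fderiv ℝ (e'.1 ∘ e.1.symm) (e.1 x) v) := by
  have h0 : (e'.1 ∘ e.1.symm) (e.1 x) = e'.1 x := by
    rw [Function.comp_apply, e.1.left_inv hx]
  have h1 : HasMFDerivAt 𝓘(ℝ, Eu n) 𝓘(ℝ, Eu n) (e'.1 ∘ e.1.symm) (e.1 x)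
      (fderiv ℝ (e'.1 ∘ e.1.symm) (e.1 x)) :=
    (differentiableAt_transition e e' hx hx').hasFDerivAt.hasMFDerivAt
  have h2 : HasMFDerivAt 𝓘(ℝ, Eu n) (𝓡 n) e'.1.symm ((e'.1 ∘ e.1.symm) (e.1 x))
      (mfderiv 𝓘(ℝ, Eu n) (𝓡 n) e'.1.symm ((e'.1 ∘ e.1.symm) (e.1 x))) := by
    refine ((mdifferentiable_atlas e').mdifferentiableAt_symm ?_).hasMFDerivAt
    rw [h0]
    exact e'.1.map_source hx'
  have h3 := (h2.comp (e.1 x) h1).congr_of_eventuallyEq (symm_eventuallyEq e e' hx hx')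
  have h4 : ∀ y, y = e'.1 x → ∀ w : Eu n, (mfderiv 𝓘(ℝ, Eu n) (𝓡 n) e'.1.symm y w : Eu n)
      = mfderiv 𝓘(ℝ, Eu n) (𝓡 n) e'.1.symm (e'.1 x) w := by
    rintro y rfl w
    rfl
  rw [← h4 _ h0, h3.mfderiv]
  rfl

theorem bilin_congr (g : ∀ x : M, LinearMap.BilinForm ℝ (TangentSpace (𝓡 n) x)) {x y : M}
    (h : x = y) : (g x : LinearMap.BilinForm ℝ (Eu n)) = (g y : LinearMap.BilinForm ℝ (Eu n)) := by
  subst h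
  rfl

theorem components_change (g : ∀ x : M, LinearMap.BilinForm ℝ (TangentSpace (𝓡 n) x))
    (e e' : atlas (Eu n) M) {x : M} (hx : x ∈ e.1.source) (hx' : x ∈ e'.1.source) :
    components g e.1 (e.1 x)
      = (jacobian e e' x).transpose * components g e'.1 (e'.1 x) * jacobian e e' x := by
  ext a b
  have hpt : e.1.symm (e.1 x) = e'.1.symm (e'.1 x) := by
    rw [e.1.left_inv hx, e'.1.left_inv hx']
  have h1 : components g e.1 (e.1 x) a b
      = (g (e'.1.symm (e'.1 x)) : LinearMap.BilinForm ℝ (Eu n))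
        (mfderiv 𝓘(ℝ, Eu n) (𝓡 n) e'.1.symm (e'.1 x)
          (fderiv ℝ (e'.1 ∘ e.1.symm) (e.1 x) (EuclideanSpace.single a 1)))
        (mfderiv 𝓘(ℝ, Eu n) (𝓡 n) e'.1.symm (e'.1 x)
          (fderiv ℝ (e'.1 ∘ e.1.symm) (e.1 x) (EuclideanSpace.single b 1))) :=
    congr (congr (congrArg (fun B : LinearMap.BilinForm ℝ (Eu n) => fun v w : Eu n => B v w)
      (bilin_congr g hpt)) (mfderiv_symm_eq e e' hx hx' _)) (mfderiv_symm_eq e e' hx hx' _)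
  rw [h1, sum_jacobian_smul, sum_jacobian_smul]
  let A : Eu n →L[ℝ] Eu n := mfderiv 𝓘(ℝ, Eu n) (𝓡 n) e'.1.symm (e'.1 x)
  let B : LinearMap.BilinForm ℝ (Eu n) := g (e'.1.symm (e'.1 x))
  change B (A _) (A _) = _
  rw [map_sum, map_sum, map_sum, LinearMap.sum_apply]
  simp only [map_sum, map_smul, LinearMap.smul_apply, smul_eq_mul, Matrix.mul_apply,
    Matrix.transpose_apply, Finset.sum_mul]
  rw [Finset.sum_comm]
  refine Finset.sum_congr rfl fun i _ => Finset.sum_congr rfl fun j _ => ?_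
  change _ = _ * B (A _) (A _) * _
  ring

/-- A kernel vector of the matrix is carried by the derivative of the inverse chart to a tangent
vector orthogonal to everything. That derivative is bijective, so the vector is zero by
nondegeneracy. -/
theorem components_det_ne_zero {g : ∀ x : M, LinearMap.BilinForm ℝ (TangentSpace (𝓡 n) x)}
    (hs : ∀ x v w, g x v w = g x w v) (hn : ∀ x v, (∀ w, g x v w = 0) → v = 0)
    (e : atlas (Eu n) M) {y : Eu n} (hy : y ∈ e.1.target) : (components g e.1 y).det ≠ 0 := by
  intro h0
  obtain ⟨v, hv, h⟩ := Matrix.exists_mulVec_eq_zero_iff.2 h0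
  let A : Eu n →L[ℝ] Eu n := mfderiv 𝓘(ℝ, Eu n) (𝓡 n) e.1.symm y
  let B : LinearMap.BilinForm ℝ (Eu n) := g (e.1.symm y)
  have hA : Function.Bijective A := mfderiv_symm_bijective e hy
  have hdec : ∀ w : Eu n, w = ∑ i, w i • (EuclideanSpace.single i 1 : Eu n) := by
    intro w
    ext k
    simp [Pi.single_apply]
  let V : Eu n := WithLp.toLp 2 v
  have h1 : ∀ a, B (A (EuclideanSpace.single a 1)) (A V) = 0 := by
    intro a
    have := congrFun h a
    rw [hdec V]
    simp only [map_sum, map_smul, smul_eq_mul]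
    rw [Matrix.mulVec, dotProduct] at this
    refine Eq.trans (Finset.sum_congr rfl fun i _ => ?_) this
    rw [mul_comm]
    rfl
  have h2 : A V = 0 := by
    refine hn (e.1.symm y) (A V) fun w => ?_
    obtain ⟨w', rfl⟩ := hA.2 w
    refine (hs _ _ _).trans ?_
    change B (A w') (A V) = 0
    rw [hdec w']
    simp [h1]
  have h3 : V = 0 := hA.1 (by rw [h2, map_zero])
  refine hv (funext fun i => ?_)
  exact congrArg (fun W : Eu n => W i) h3

theorem fderiv_chart_change (e e' : atlas (Eu n) M) {x : M} (hx : x ∈ e.1.source)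
    (hx' : x ∈ e'.1.source) {f : M → ℝ} (hf : DifferentiableAt ℝ (f ∘ e'.1.symm) (e'.1 x))
    (a : Fin n) :
    fderiv ℝ (f ∘ e.1.symm) (e.1 x) (EuclideanSpace.single a 1)
      = ∑ i, jacobian e e' x i a *
        fderiv ℝ (f ∘ e'.1.symm) (e'.1 x) (EuclideanSpace.single i 1) := by
  have h0 : (e'.1 ∘ e.1.symm) (e.1 x) = e'.1 x := by
    rw [Function.comp_apply, e.1.left_inv hx]
  have h1 : f ∘ e.1.symm =ᶠ[𝓝 (e.1 x)] (f ∘ e'.1.symm) ∘ (e'.1 ∘ e.1.symm) := by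
    filter_upwards [symm_eventuallyEq e e' hx hx'] with y hy
    rw [Function.comp_apply, hy]
    rfl
  have h2 : fderiv ℝ ((f ∘ e'.1.symm) ∘ (e'.1 ∘ e.1.symm)) (e.1 x)
      = (fderiv ℝ (f ∘ e'.1.symm) (e'.1 x)).comp (fderiv ℝ (e'.1 ∘ e.1.symm) (e.1 x)) := by
    rw [fderiv_comp _ (by rwa [h0]) (differentiableAt_transition e e' hx hx'), h0]
  rw [h1.fderiv_eq, h2, ContinuousLinearMap.comp_apply, sum_jacobian_smul, map_sum]
  simp only [map_smul, smul_eq_mul]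

end Charts

end OvsienkoRedou

/-! ### Metric, volume density and weight in a chart -/

namespace OvsienkoRedou

open Filter Set

set_option linter.unusedSectionVars false

section MetricData

variable {n : ℕ} {M : Type*} [TopologicalSpace M]
  [ChartedSpace (EuclideanSpace ℝ (Fin n)) M] [IsManifold (𝓡 n) ∞ M]
  (g : MetricFamily n M) (e e' : atlas (Eu n) M)

/-- The open set `(-ε, ε) × e.target`. -/
def chartDom : TopologicalSpace.Opens (ℝ × Eu n) :=
  ⟨Ioo (-g.ε) g.ε ×ˢ e.1.target, isOpen_Ioo.prod e.1.open_target⟩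

/-- The point of the domain that corresponds to `ρ` and `x`. -/
def chartPt {ρ : ℝ} (hρ : ρ ∈ Ioo (-g.ε) g.ε) {x : M} (hx : x ∈ e.1.source) : chartDom g e :=
  ⟨(ρ, e.1 x), hρ, e.1.map_source hx⟩

theorem exists_eq_chartPt (p : chartDom g e) :
    ∃ (ρ : ℝ) (hρ : ρ ∈ Ioo (-g.ε) g.ε) (x : M) (hx : x ∈ e.1.source), p = chartPt g e hρ hx := by
  refine ⟨p.1.1, p.2.1, e.1.symm p.1.2, e.1.map_target p.2.2, ?_⟩
  refine Subtype.ext (Prod.ext rfl ?_)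
  exact (e.1.right_inv p.2.2).symm

theorem zero_mem_Ioo : (0 : ℝ) ∈ Ioo (-g.ε) g.ε := ⟨neg_lt_zero.2 g.ε_pos, g.ε_pos⟩

/-- Families of functions on `M` that are smooth in the parameter and the coordinates. -/
def JSmooth (F : ℝ → M → ℝ) : Prop :=
  ∀ e : atlas (Eu n) M, ContDiffOn ℝ ∞ (fun p : ℝ × Eu n => F p.1 (e.1.symm p.2)) (chartDom g e)

variable {g}

/-- The expression of a smooth family of functions in a chart. -/
def hat {F : ℝ → M → ℝ} (hF : JSmooth g F) : SF (chartDom g e) := SF.mk _ (hF e)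

theorem hat_apply {F : ℝ → M → ℝ} (hF : JSmooth g F) (p : chartDom g e) :
    hat e hF p = F p.1.1 (e.1.symm p.1.2) := rfl

theorem hat_chartPt {F : ℝ → M → ℝ} (hF : JSmooth g F) {ρ : ℝ} (hρ : ρ ∈ Ioo (-g.ε) g.ε) {x : M}
    (hx : x ∈ e.1.source) : hat e hF (chartPt g e hρ hx) = F ρ x := by
  rw [hat_apply]
  change F ρ (e.1.symm (e.1 x)) = _
  rw [e.1.left_inv hx]

variable (g)

/-- The components of the metrics `g_ρ`. -/
def metricMat : Matrix (Fin n) (Fin n) (SF (chartDom g e)) :=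
  Matrix.of fun i j => SF.mk _ (g.smooth e.1 e.2 i j)

theorem metricMat_eval (p : chartDom g e) :
    (SF.eval p).mapMatrix (metricMat g e) = components (g.toFun p.1.1) e.1 p.1.2 := rfl

theorem det_metricMat_apply (p : chartDom g e) :
    (metricMat g e).det p = (components (g.toFun p.1.1) e.1 p.1.2).det := by
  rw [← SF.eval_apply, RingHom.map_det, metricMat_eval]

theorem det_metricMat_ne_zero (p : chartDom g e) : (metricMat g e).det p ≠ 0 := by
  rw [det_metricMat_apply]
  exact components_det_ne_zero (g.symm _ p.2.1) (g.nondegenerate _ p.2.1) e p.2.2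

theorem isUnit_det_metricMat : IsUnit (metricMat g e).det :=
  SF.isUnit_of_ne_zero (det_metricMat_ne_zero g e)

theorem metricMat_symm : (metricMat g e).transpose = metricMat g e := by
  ext i j p
  exact g.symm _ p.2.1 _ _ _

/-- The components of the inverse metrics. -/
def cometric : Matrix (Fin n) (Fin n) (SF (chartDom g e)) := (metricMat g e)⁻¹

theorem cometric_symm (i j : Fin n) : cometric g e i j = cometric g e j i := by
  have : (cometric g e).transpose = cometric g e := by
    rw [cometric, Matrix.transpose_nonsing_inv, metricMat_symm]
  exact congrFun (congrFun this j) i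

theorem cometric_eval (p : chartDom g e) :
    (SF.eval p).mapMatrix (cometric g e) = (components (g.toFun p.1.1) e.1 p.1.2)⁻¹ := by
  symm
  refine Matrix.inv_eq_left_inv ?_
  rw [← metricMat_eval, ← map_mul, cometric, Matrix.nonsing_inv_mul _ (isUnit_det_metricMat g e),
    map_one]

/-- The map `(ρ, y) ↦ (0, y)`. -/
def zeroProj : ℝ × Eu n →L[ℝ] ℝ × Eu n :=
  (0 : ℝ × Eu n →L[ℝ] ℝ).prod (ContinuousLinearMap.snd ℝ ℝ (Eu n))

theorem zeroProj_mem : ∀ p ∈ chartDom g e, zeroProj p ∈ chartDom g e := fun _ hp =>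
  ⟨zero_mem_Ioo g, hp.2⟩

/-- Restriction to `ρ = 0`. -/
def atZero : SF (chartDom g e) →ₐ[ℝ] SF (chartDom g e) := SF.pull zeroProj (zeroProj_mem g e)

theorem atZero_apply (f : SF (chartDom g e)) (p : chartDom g e) :
    atZero g e f p = f ⟨(0, p.1.2), zero_mem_Ioo g, p.2.2⟩ := SF.pull_apply _ _ _ _

/-- The direction of the parameter. -/
def dirρ : ℝ × Eu n := (1, 0)

/-- The direction of a coordinate. -/
def dirc (a : Fin n) : ℝ × Eu n := (0, EuclideanSpace.single a 1)

theorem d_atZero (f : SF (chartDom g e)) : SF.d dirρ (atZero g e f) = 0 := by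
  rw [atZero, SF.d_pull]
  have : zeroProj (dirρ : ℝ × Eu n) = 0 := by
    simp [zeroProj, dirρ]
  rw [this, SF.d_zero_dir, map_zero]

theorem contDiffAt_sqrt_abs {x : ℝ} (hx : x ≠ 0) :
    ContDiffAt ℝ ∞ (fun t : ℝ => Real.sqrt |t|) x :=
  (Real.contDiffAt_sqrt (abs_ne_zero.2 hx)).comp x (contDiffAt_abs hx)

/-- The volume density `√|det g_ρ|`. -/
def vol : SF (chartDom g e) :=
  SF.comp (fun t => Real.sqrt |t|) (metricMat g e).det fun p =>
    contDiffAt_sqrt_abs (det_metricMat_ne_zero g e p)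

theorem vol_apply (p : chartDom g e) :
    vol g e p = Real.sqrt |(components (g.toFun p.1.1) e.1 p.1.2).det| := by
  rw [vol, SF.comp_apply, det_metricMat_apply]

theorem vol_pos (p : chartDom g e) : 0 < vol g e p := by
  rw [vol_apply, ← det_metricMat_apply]
  exact Real.sqrt_pos.2 (abs_pos.2 (det_metricMat_ne_zero g e p))

/-- The volume density `√|det g₀|`. -/
def vol0 : SF (chartDom g e) := atZero g e (vol g e)

theorem vol0_apply (p : chartDom g e) :
    vol0 g e p = Real.sqrt |(components (g.toFun 0) e.1 p.1.2).det| := by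
  rw [vol0, atZero_apply, vol_apply]

theorem vol0_pos (p : chartDom g e) : 0 < vol0 g e p := by
  rw [vol0, atZero_apply]
  exact vol_pos g e _

theorem d_vol0 : SF.d dirρ (vol0 g e) = 0 := d_atZero g e _

/-- The quotient `det g_ρ / det g₀`. -/
def detQuot (ρ : ℝ) (y : Eu n) : ℝ :=
  (components (g.toFun ρ) e.1 y).det / (components (g.toFun 0) e.1 y).det

/-- For fixed `y` the determinant is continuous and nowhere zero on the interval of parameters, so
its sign is constant. This is what makes the real power `1/4` in the weight smooth and positive,
also for indefinite metrics. -/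
theorem detQuot_pos (p : chartDom g e) : 0 < detQuot g e p.1.1 p.1.2 := by
  obtain ⟨⟨ρ, y⟩, hρ, hy⟩ := p
  dsimp only at hρ hy ⊢
  have hne : ∀ s ∈ Ioo (-g.ε) g.ε, (components (g.toFun s) e.1 y).det ≠ 0 := fun s hs =>
    components_det_ne_zero (g.symm _ hs) (g.nondegenerate _ hs) e hy
  have hcont : ContinuousOn (fun s => detQuot g e s y) (Ioo (-g.ε) g.ε) := by
    refine ContinuousOn.div_const ?_ _
    have h1 : ContinuousOn (extZero (metricMat g e).det) (chartDom g e) :=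
      (SF.smoothOn _).continuousOn
    have h2 : ContinuousOn (fun s : ℝ => (s, y)) (Ioo (-g.ε) g.ε) := by fun_prop
    refine (h1.comp h2 fun s hs => ⟨hs, hy⟩).congr fun s hs => ?_
    have := extZero_apply (metricMat g e).det (⟨(s, y), hs, hy⟩ : chartDom g e)
    exact (this.trans (det_metricMat_apply g e _)).symm
  have h0 : detQuot g e 0 y = 1 := div_self (hne 0 (zero_mem_Ioo g))
  by_contra hneg
  have hmem : (0 : ℝ) ∈ Icc (detQuot g e ρ y) (detQuot g e 0 y) := by
    rw [h0]
    exact ⟨not_lt.1 hneg, zero_le_one⟩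
  -- The quotient is `1` at parameter `0`; a nonpositive value at `ρ` would force a zero in between.
  obtain ⟨s, hs, hs0⟩ := isPreconnected_Ioo.intermediate_value hρ (zero_mem_Ioo g) hcont hmem
  rcases div_eq_zero_iff.1 hs0 with h | h
  · exact hne s hs h
  · exact hne 0 (zero_mem_Ioo g) h

theorem det_atZero_ne_zero (p : chartDom g e) : atZero g e (metricMat g e).det p ≠ 0 := by
  rw [atZero_apply]
  exact det_metricMat_ne_zero g e _

/-- The weight `w` in a chart. -/
def weightSF : SF (chartDom g e) :=
  SF.comp (fun t => t ^ (1 / 4 : ℝ)) ((metricMat g e).det *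
      SF.comp (fun t => t⁻¹) (atZero g e (metricMat g e).det) fun p =>
        contDiffAt_inv ℝ (det_atZero_ne_zero g e p)) fun p =>
    Real.contDiffAt_rpow_const_of_ne (by
      rw [SF.mul_apply, SF.comp_apply]
      exact mul_ne_zero (det_metricMat_ne_zero g e p) (inv_ne_zero (det_atZero_ne_zero g e p)))

theorem weightSF_apply (p : chartDom g e) :
    weightSF g e p = detQuot g e p.1.1 p.1.2 ^ (1 / 4 : ℝ) := by
  rw [weightSF, SF.comp_apply, SF.mul_apply, SF.comp_apply, atZero_apply, det_metricMat_apply,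
    det_metricMat_apply, detQuot, div_eq_mul_inv (Matrix.det _)]

theorem weightSF_pos (p : chartDom g e) : 0 < weightSF g e p := by
  rw [weightSF_apply]
  exact Real.rpow_pos_of_pos (detQuot_pos g e p) _

/-- The reason for the exponent `1/4`: `w²` is the ratio of the volume densities of `g_ρ` and `g₀`.
-/
theorem vol_eq : vol g e = vol0 g e * weightSF g e ^ 2 := by
  ext p
  have h := detQuot_pos g e p
  have h0 : (components (g.toFun 0) e.1 p.1.2).det ≠ 0 :=
    components_det_ne_zero (g.symm _ (zero_mem_Ioo g)) (g.nondegenerate _ (zero_mem_Ioo g)) e p.2.2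
  have hq : |(components (g.toFun p.1.1) e.1 p.1.2).det|
      = |(components (g.toFun 0) e.1 p.1.2).det| * detQuot g e p.1.1 p.1.2 := by
    calc |(components (g.toFun p.1.1) e.1 p.1.2).det|
        = |(components (g.toFun 0) e.1 p.1.2).det * detQuot g e p.1.1 p.1.2| := by
          rw [detQuot, mul_div_cancel₀ _ h0]
      _ = _ := by rw [abs_mul, abs_of_pos h]
  rw [SF.mul_apply, SF.pow_apply, vol_apply, vol0_apply, weightSF_apply, ← Real.rpow_natCast,
    ← Real.rpow_mul h.le, hq, Real.sqrt_mul (abs_nonneg _), Real.sqrt_eq_rpow (detQuot _ _ _ _)]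
  norm_num

theorem jacobian_det_ne_zero (g : MetricFamily n M) (e e' : atlas (Eu n) M) {x : M}
    (hx : x ∈ e.1.source) (hx' : x ∈ e'.1.source) :
    (jacobian e e' x).det ≠ 0 := by
  intro h
  have h1 := congrArg Matrix.det (components_change (g.toFun 0) e e' hx hx')
  rw [Matrix.det_mul, h, mul_zero] at h1
  exact components_det_ne_zero (g.symm _ (zero_mem_Ioo g)) (g.nondegenerate _ (zero_mem_Ioo g)) e
    (e.1.map_source hx) h1

/-- Both determinants change by the same factor, the squared Jacobian determinant. Hence the weight,
although defined through the chart at each point, is smooth in every chart. -/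
theorem detQuot_change (ρ : ℝ) {x : M} (hx : x ∈ e.1.source) (hx' : x ∈ e'.1.source) :
    detQuot g e ρ (e.1 x) = detQuot g e' ρ (e'.1 x) := by
  have hJ := jacobian_det_ne_zero g e e' hx hx'
  rw [detQuot, detQuot, components_change _ e e' hx hx', components_change _ e e' hx hx']
  simp only [Matrix.det_mul, Matrix.det_transpose]
  rw [mul_comm _ (jacobian e e' x).det, mul_comm _ (jacobian e e' x).det,
    mul_div_mul_left _ _ hJ, mul_div_mul_left _ _ hJ]

/-- The chart at a point as an element of the atlas. -/
def chartA (x : M) : atlas (Eu n) M := ⟨chartAt (Eu n) x, chart_mem_atlas _ x⟩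

theorem mem_chartA (x : M) : x ∈ (chartA (n := n) x).1.source := mem_chart_source _ x

theorem weight_eq {ρ : ℝ} {x : M} (hx : x ∈ e.1.source) :
    weight g ρ x = detQuot g e ρ (e.1 x) ^ (1 / 4 : ℝ) := by
  rw [detQuot_change g e (chartA x) ρ hx (mem_chartA x)]
  rfl

theorem weight_eq_weightSF (p : chartDom g e) :
    weight g p.1.1 (e.1.symm p.1.2) = weightSF g e p := by
  rw [weight_eq g e (e.1.map_target p.2.2), e.1.right_inv p.2.2, weightSF_apply]

theorem jSmooth_weight : JSmooth g (weight g) := fun e =>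
  (contDiffOn_extZero_iff fun p => (weight_eq_weightSF g e p).symm).1 (SF.smoothOn (weightSF g e))

theorem hat_weight : hat e (jSmooth_weight g) = weightSF g e := by
  ext p
  exact weight_eq_weightSF g e p

/-- The inverse of the weight in a chart. -/
def weightInv : SF (chartDom g e) :=
  SF.comp (fun t => t⁻¹) (weightSF g e) fun p => contDiffAt_inv ℝ (weightSF_pos g e p).ne'

theorem weightInv_apply (p : chartDom g e) : weightInv g e p = (weightSF g e p)⁻¹ := by
  rw [weightInv, SF.comp_apply]

theorem weightSF_mul_inv : weightSF g e * weightInv g e = 1 := by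
  ext p
  rw [SF.mul_apply, weightInv_apply, mul_inv_cancel₀ (weightSF_pos g e p).ne', SF.one_apply]

/-- The inverse of `√|det g₀|`. -/
def vol0Inv : SF (chartDom g e) :=
  SF.comp (fun t => t⁻¹) (vol0 g e) fun p => contDiffAt_inv ℝ (vol0_pos g e p).ne'

theorem vol0Inv_apply (p : chartDom g e) : vol0Inv g e p = (vol0 g e p)⁻¹ := by
  rw [vol0Inv, SF.comp_apply]

theorem vol0_mul_inv : vol0 g e * vol0Inv g e = 1 := by
  ext p
  rw [SF.mul_apply, vol0Inv_apply, mul_inv_cancel₀ (vol0_pos g e p).ne', SF.one_apply]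

end MetricData

end OvsienkoRedou

/-! ### The ambient Laplacian in coordinates -/

namespace OvsienkoRedou

open Filter Set

set_option linter.unusedSectionVars false

/-- This transfers the Laplacian to a commutative ring with derivations, where the later
computations become polynomial identities. The coordinate expressions need to match the ring
elements only on the open set `Ω`. -/
theorem coordLaplacian_eq {ι : Type*} [Fintype ι] [DecidableEq ι]
    {Ω : TopologicalSpace.Opens (ι → ℝ)} {G : (ι → ℝ) → Matrix ι ι ℝ} {f : (ι → ℝ) → ℝ}
    {A : SF Ω} {P : Matrix ι ι (SF Ω)} {F : SF Ω}
    (hA : ∀ p : Ω, A p = Real.sqrt |(G p).det|) (hP : ∀ (p : Ω) i j, P i j p = (G p)⁻¹ i j)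
    (hF : ∀ p : Ω, F p = f p) (p : Ω) :
    coordLaplacian G f p = (A p)⁻¹ *
      (∑ a, ∑ b, SF.d (Pi.single a 1) (A * P a b * SF.d (Pi.single b 1) F)) p := by
  rw [coordLaplacian, hA, SF.sum_apply]
  congr 1
  refine Finset.sum_congr rfl fun a _ => ?_
  rw [SF.sum_apply]
  refine Finset.sum_congr rfl fun b _ => ?_
  rw [SF.d_eq _ _ (H := fun y => Real.sqrt |(G y).det| * (G y)⁻¹ a b *
    fderiv ℝ f y (Pi.single b 1))]
  intro q
  rw [SF.mul_apply, SF.mul_apply, hA, hP, SF.d_eq _ _ hF]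

section Ambient

variable {n : ℕ} {M : Type*} [TopologicalSpace M]
  [ChartedSpace (EuclideanSpace ℝ (Fin n)) M] [IsManifold (𝓡 n) ∞ M]
  (g : MetricFamily n M) (e e' : atlas (Eu n) M)

/-- The projection `(y, τ, ρ) ↦ (ρ, y)`. -/
def ambProj : (Fin n ⊕ Fin 2 → ℝ) →L[ℝ] ℝ × Eu n :=
  (ContinuousLinearMap.proj (Sum.inr 1)).prod
    ((EuclideanSpace.equiv (Fin n) ℝ).symm.toContinuousLinearMap.comp
      (ContinuousLinearMap.pi fun i => ContinuousLinearMap.proj (Sum.inl i)))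

theorem ambProj_apply (z : Fin n ⊕ Fin 2 → ℝ) : ambProj z = (z (Sum.inr 1), baseCoords z) := rfl

/-- The domain of the ambient coordinates. -/
def ambDom : TopologicalSpace.Opens (Fin n ⊕ Fin 2 → ℝ) :=
  ⟨{z | 0 < z (Sum.inr 0)} ∩ ambProj ⁻¹' (chartDom g e),
    (isOpen_lt continuous_const (continuous_apply _)).inter
      ((chartDom g e).isOpen.preimage ambProj.continuous)⟩

theorem ambProj_mem : ∀ z ∈ ambDom g e, ambProj z ∈ chartDom g e := fun _ h => h.2

/-- The pullback to the ambient space. -/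
def ambPull : SF (chartDom g e) →ₐ[ℝ] SF (ambDom g e) := SF.pull ambProj (ambProj_mem g e)

/-- The coordinate `τ`. -/
def tau : SF (ambDom g e) := SF.mk (fun z => z (Sum.inr 0)) (by fun_prop)

theorem tau_pos (z : ambDom g e) : 0 < tau g e z := z.2.1

/-- The function `1 / τ`. -/
def tauInv : SF (ambDom g e) :=
  SF.comp (fun t => t⁻¹) (tau g e) fun p => contDiffAt_inv ℝ (tau_pos g e p).ne'

theorem tau_mul_inv : tau g e * tauInv g e = 1 := by
  ext p
  rw [SF.mul_apply, tauInv, SF.comp_apply, mul_inv_cancel₀ (tau_pos g e p).ne', SF.one_apply]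

/-- The coordinate `ρ`. -/
def rho : SF (chartDom g e) := SF.mk (fun p => p.1) (by fun_prop)

theorem d_tau (v : Fin n ⊕ Fin 2 → ℝ) : SF.d v (tau g e) = algebraMap ℝ _ (v (Sum.inr 0)) := by
  ext p
  rw [tau, SF.d_mk]
  have h : HasFDerivAt (fun z : Fin n ⊕ Fin 2 → ℝ => z (Sum.inr 0))
      (ContinuousLinearMap.proj (R := ℝ) (φ := fun _ : Fin n ⊕ Fin 2 => ℝ) (Sum.inr 0)) p :=
    (ContinuousLinearMap.proj (R := ℝ) (φ := fun _ : Fin n ⊕ Fin 2 => ℝ)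
      (Sum.inr 0)).hasFDerivAt
  rw [h.fderiv]
  rfl

theorem d_ambPull (v : Fin n ⊕ Fin 2 → ℝ) (f : SF (chartDom g e)) :
    SF.d v (ambPull g e f) = ambPull g e (SF.d (ambProj v) f) := SF.d_pull _ _ _ _

theorem ambProj_inl (a : Fin n) :
    ambProj (Pi.single (Sum.inl a) 1 : Fin n ⊕ Fin 2 → ℝ) = dirc a := by
  rw [ambProj_apply, dirc]
  refine Prod.ext (by simp) ?_
  ext i
  simp [baseCoords, Pi.single_apply]

theorem ambProj_inr_zero :
    ambProj (Pi.single (Sum.inr 0) 1 : Fin n ⊕ Fin 2 → ℝ) = 0 := by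
  rw [ambProj_apply]
  refine Prod.ext (by simp) ?_
  ext i
  simp [baseCoords]

theorem ambProj_inr_one :
    ambProj (Pi.single (Sum.inr 1) 1 : Fin n ⊕ Fin 2 → ℝ) = dirρ := by
  rw [ambProj_apply, dirρ]
  refine Prod.ext (by simp) ?_
  ext i
  simp [baseCoords]

/-- The volume density of the ambient metric. -/
def ambVol : SF (ambDom g e) := tau g e ^ (n + 1) * ambPull g e (vol g e)

theorem ambVol_apply (z : ambDom g e) :
    ambVol g e z = Real.sqrt |(ambientMetric g e.1 z).det| := by
  have hτ : 0 < z.1 (Sum.inr 0) := z.2.1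
  rw [ambientMetric]
  rw [Matrix.det_fromBlocks_zero₂₁, Matrix.det_smul, Matrix.det_fin_two_of, ambVol, SF.mul_apply,
    SF.pow_apply, ambPull, SF.pull_apply, vol_apply, Fintype.card_fin]
  -- The `(τ, ρ)`-block has determinant `-τ²` and the block of `M` contributes `τ^(2n) det g_ρ`.
  have h : ∀ (t D : ℝ) (r : ℝ), 0 < t → t ^ (n + 1) * Real.sqrt |D|
      = Real.sqrt |(t ^ 2) ^ n * D * (2 * r * 0 - t * t)| := by
    intro t D r ht
    have e1 : (t ^ 2) ^ n * D * (2 * r * 0 - t * t) = -((t ^ (n + 1)) ^ 2 * D) := by ring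
    rw [e1, abs_neg, abs_mul, abs_of_nonneg (sq_nonneg (t ^ (n + 1))), Real.sqrt_mul (sq_nonneg _),
      Real.sqrt_sq (by positivity)]
  exact h _ _ _ hτ

/-- The inverse of the ambient metric. -/
def ambInv : Matrix (Fin n ⊕ Fin 2) (Fin n ⊕ Fin 2) (SF (ambDom g e)) :=
  Matrix.fromBlocks (tauInv g e ^ 2 • (ambPull g e).mapMatrix (cometric g e)) 0 0
    !![0, tauInv g e; tauInv g e, -2 * ambPull g e (rho g e) * tauInv g e ^ 2]

theorem ambInv_apply (z : ambDom g e) (i j : Fin n ⊕ Fin 2) :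
    ambInv g e i j z = (ambientMetric g e.1 z)⁻¹ i j := by
  have hτ : z.1 (Sum.inr 0) ≠ 0 := (z.2.1 : 0 < z.1 (Sum.inr 0)).ne'
  have hG : IsUnit (components (g.toFun (z.1 (Sum.inr 1))) e.1 (baseCoords z.1)).det := by
    refine isUnit_iff_ne_zero.2 (components_det_ne_zero (g.symm _ ?_) (g.nondegenerate _ ?_) e ?_)
    · exact (ambProj_mem g e z.1 z.2).1
    · exact (ambProj_mem g e z.1 z.2).1
    · exact (ambProj_mem g e z.1 z.2).2
  have key : (SF.eval z).mapMatrix (ambInv g e) = (ambientMetric g e.1 z)⁻¹ := by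
    symm
    refine Matrix.inv_eq_left_inv ?_
    have h1 : (SF.eval z).mapMatrix (ambInv g e)
        = Matrix.fromBlocks (((z.1 (Sum.inr 0))⁻¹ ^ 2) •
          (components (g.toFun (z.1 (Sum.inr 1))) e.1 (baseCoords z.1))⁻¹) 0 0
          !![0, (z.1 (Sum.inr 0))⁻¹; (z.1 (Sum.inr 0))⁻¹,
            -2 * z.1 (Sum.inr 1) * (z.1 (Sum.inr 0))⁻¹ ^ 2] := by
      have hc := cometric_eval g e ⟨ambProj z.1, ambProj_mem g e z.1 z.2⟩
      have ht : tauInv g e z = (z.1 (Sum.inr 0))⁻¹ := by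
        rw [tauInv, SF.comp_apply]; rfl
      rw [ambInv, RingHom.mapMatrix_apply, Matrix.fromBlocks_map]
      refine congr (congr (congr (congrArg _ ?_) ?_) ?_) ?_
      · ext a b
        have := congrFun (congrFun hc a) b
        rw [RingHom.mapMatrix_apply, Matrix.map_apply, SF.eval_apply] at this
        simp only [Matrix.map_apply, Matrix.smul_apply, smul_eq_mul, AlgHom.mapMatrix_apply,
          SF.eval_apply, SF.mul_apply, SF.pow_apply, ht]
        rw [ambPull, SF.pull_apply, this]
        rfl
      · ext a b; rfl
      · ext a b; rfl
      · ext a b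
        fin_cases a <;> fin_cases b
        · rfl
        · exact ht
        · exact ht
        · change (-2 * ambPull g e (rho g e) * tauInv g e ^ 2 : SF (ambDom g e)) z = _
          rw [SF.mul_apply, SF.mul_apply, SF.pow_apply, ht, SF.neg_apply, SF.ofNat_apply, ambPull,
            SF.pull_apply]
          rfl
    rw [h1, ambientMetric]
    rw [Matrix.fromBlocks_multiply, ← Matrix.fromBlocks_one]
    congr 1
    · rw [Matrix.zero_mul, add_zero, Matrix.smul_mul, Matrix.mul_smul, Matrix.nonsing_inv_mul _ hG,
        smul_smul]
      have : (z.1 (Sum.inr 0))⁻¹ ^ 2 * z.1 (Sum.inr 0) ^ 2 = 1 := by field_simp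
      rw [this, one_smul]
    · simp
    · simp
    · ext a b
      fin_cases a <;> fin_cases b <;> simp <;> field_simp
      ring
  rw [← key]
  rfl

/-- The second order part of the ambient Laplacian in a chart, applied to functions that do not
depend on `τ`, at `τ = 1` and up to the volume density. -/
def ambForm (W : SF (chartDom g e)) : SF (chartDom g e) :=
  (∑ a, ∑ b, SF.d (dirc a) (vol g e * cometric g e a b * SF.d (dirc b) W))
    + n * vol g e * SF.d dirρ W - 2 * SF.d dirρ (vol g e * rho g e * SF.d dirρ W)

theorem d_mul_of_d_eq_zero {X : Type*} [NormedAddCommGroup X] [NormedSpace ℝ X]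
    {Ω : TopologicalSpace.Opens X} {v : X} {c : SF Ω} (hc : SF.d v c = 0) (f : SF Ω) :
    SF.d v (c * f) = c * SF.d v f := by
  rw [Derivation.leibniz, hc, smul_zero, add_zero, smul_eq_mul]

theorem d_pow_eq_zero {X : Type*} [NormedAddCommGroup X] [NormedSpace ℝ X]
    {Ω : TopologicalSpace.Opens X} {v : X} {c : SF Ω} (hc : SF.d v c = 0) (k : ℕ) :
    SF.d v (c ^ k) = 0 := by
  rw [Derivation.leibniz_pow, hc, smul_zero, smul_zero]

theorem d_eq_zero_of_mul_eq_one {X : Type*} [NormedAddCommGroup X] [NormedSpace ℝ X]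
    {Ω : TopologicalSpace.Opens X} {v : X} {c c' : SF Ω} (h : c * c' = 1) (hc : SF.d v c = 0) :
    SF.d v c' = 0 := by
  have h1 := congrArg (SF.d v) h
  rw [d_mul_of_d_eq_zero hc, Derivation.map_one_eq_zero] at h1
  calc SF.d v c' = (c * c') * SF.d v c' := by rw [h, one_mul]
    _ = c' * (c * SF.d v c') := by ring
    _ = 0 := by rw [h1, mul_zero]

theorem d_tau_inl (a : Fin n) : SF.d (Pi.single (Sum.inl a) 1) (tau g e) = 0 := by
  rw [d_tau]; simp

theorem d_tau_one : SF.d (Pi.single (Sum.inr 1) 1) (tau g e) = 0 := by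
  rw [d_tau]; simp

theorem d_tau_zero : SF.d (Pi.single (Sum.inr 0) 1) (tau g e) = 1 := by
  rw [d_tau]; simp

theorem d_tau_factor {v : Fin n ⊕ Fin 2 → ℝ} (h : SF.d v (tau g e) = 0) :
    SF.d v (tau g e ^ (n + 1) * tauInv g e ^ 2) = 0 := by
  rw [d_mul_of_d_eq_zero (d_pow_eq_zero h _),
    d_pow_eq_zero (d_eq_zero_of_mul_eq_one (tau_mul_inv g e) h), mul_zero]

theorem ambient_term_inl (W : SF (chartDom g e)) (a b : Fin n) :
    SF.d (Pi.single (Sum.inl a) 1) (ambVol g e *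
      ambInv g e (Sum.inl a) (Sum.inl b) * SF.d (Pi.single (Sum.inl b) 1) (ambPull g e W))
      = tau g e ^ (n + 1) * tauInv g e ^ 2 *
        ambPull g e (SF.d (dirc a) (vol g e * cometric g e a b * SF.d (dirc b) W)) := by
  have e1 : ambVol g e * ambInv g e (Sum.inl a) (Sum.inl b) *
      SF.d (Pi.single (Sum.inl b) 1) (ambPull g e W)
      = (tau g e ^ (n + 1) * tauInv g e ^ 2) *
        ambPull g e (vol g e * cometric g e a b * SF.d (dirc b) W) := by
    rw [d_ambPull, ambProj_inl, map_mul, map_mul]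
    have h : ambInv g e (Sum.inl a) (Sum.inl b)
      = tauInv g e ^ 2 * ambPull g e (cometric g e a b) := rfl
    rw [h, ambVol]
    ring
  rw [e1, d_mul_of_d_eq_zero (d_tau_factor g e (d_tau_inl g e a)), d_ambPull, ambProj_inl]

/-- The only place where the dependence on `τ` counts: the derivative falls on `τ^n` and produces
the first-order term with coefficient `n`. For `n = 0` the exponent `n - 1` is irrelevant because of
the factor `n`. -/
theorem ambient_term_zero_one (W : SF (chartDom g e)) :
    SF.d (Pi.single (Sum.inr 0) 1) (ambVol g e *
      ambInv g e (Sum.inr 0) (Sum.inr 1) * SF.d (Pi.single (Sum.inr 1) 1) (ambPull g e W))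
      = (n * tau g e ^ (n - 1)) * ambPull g e (vol g e * SF.d dirρ W) := by
  have ring_aux : ∀ {A : Type _} [CommRing A] (t t' a c : A), t * t' = 1 →
      t ^ (n + 1) * a * t' * c = t ^ n * (a * c) := by
    intro A _ t t' a c h
    linear_combination (t ^ n * a * c) * h
  have e1 : ambVol g e * ambInv g e (Sum.inr 0) (Sum.inr 1) *
      SF.d (Pi.single (Sum.inr 1) 1) (ambPull g e W)
      = tau g e ^ n * ambPull g e (vol g e * SF.d dirρ W) := by
    rw [d_ambPull, ambProj_inr_one, map_mul]
    have h : ambInv g e (Sum.inr 0) (Sum.inr 1) = tauInv g e := rfl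
    rw [h, ambVol]
    exact ring_aux _ _ _ _ (tau_mul_inv g e)
  rw [e1, Derivation.leibniz, d_ambPull, ambProj_inr_zero, SF.d_zero_dir, map_zero, smul_zero,
    zero_add, Derivation.leibniz_pow, d_tau_zero, nsmul_eq_mul, smul_eq_mul, smul_eq_mul, mul_one,
    mul_comm]

theorem ambient_term_one_one (W : SF (chartDom g e)) :
    SF.d (Pi.single (Sum.inr 1) 1) (ambVol g e *
      ambInv g e (Sum.inr 1) (Sum.inr 1) * SF.d (Pi.single (Sum.inr 1) 1) (ambPull g e W))
      = (tau g e ^ (n + 1) * tauInv g e ^ 2) *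
        ambPull g e (-2 * SF.d dirρ (vol g e * rho g e * SF.d dirρ W)) := by
  have e1 : ambVol g e * ambInv g e (Sum.inr 1) (Sum.inr 1) *
      SF.d (Pi.single (Sum.inr 1) 1) (ambPull g e W)
      = (tau g e ^ (n + 1) * tauInv g e ^ 2) *
        ambPull g e (-2 * (vol g e * rho g e * SF.d dirρ W)) := by
    rw [d_ambPull, ambProj_inr_one, map_mul, map_mul, map_mul, map_neg, map_ofNat]
    have h : ambInv g e (Sum.inr 1) (Sum.inr 1)
      = -2 * ambPull g e (rho g e) * tauInv g e ^ 2 := rfl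
    rw [h, ambVol]
    ring
  have h2 : SF.d dirρ (-2 : SF (chartDom g e)) = 0 := by
    have : (-2 : SF (chartDom g e)) = ((-2 : ℤ) : SF (chartDom g e)) := by norm_num
    rw [this, Derivation.map_intCast]
  rw [e1, d_mul_of_d_eq_zero (d_tau_factor g e (d_tau_one g e)), d_ambPull, ambProj_inr_one,
    d_mul_of_d_eq_zero h2]

/-- Since `W` does not depend on `τ`, the entry with row `ρ` and column `τ` contributes nothing. At
`τ = 1` all powers of `τ` disappear. -/
theorem sum_ambVol_apply (W : SF (chartDom g e)) (z : ambDom g e) (hz : tau g e z = 1) :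
    (∑ a, ∑ b, SF.d (Pi.single a 1) (ambVol g e * ambInv g e a b *
      SF.d (Pi.single b 1) (ambPull g e W))) z = ambPull g e (ambForm g e W) z := by
  have ht : tauInv g e z = 1 := by
    rw [tauInv, SF.comp_apply, hz, inv_one]
  have t4 : SF.d (Pi.single (Sum.inr 0) 1) (ambPull g e W) = 0 := by
    rw [d_ambPull, ambProj_inr_zero, SF.d_zero_dir, map_zero]
  have z1 : ∀ (a : Fin n) (b : Fin 2), ambInv g e (Sum.inl a) (Sum.inr b) = 0 := fun _ _ => rfl
  have z2 : ∀ (a : Fin n) (b : Fin 2), ambInv g e (Sum.inr b) (Sum.inl a) = 0 := fun _ _ => rfl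
  have hsum : (∑ a, ∑ b, SF.d (Pi.single a 1) (ambVol g e * ambInv g e a b *
      SF.d (Pi.single b 1) (ambPull g e W)))
      = (tau g e ^ (n + 1) * tauInv g e ^ 2) *
          ambPull g e (∑ a, ∑ b, SF.d (dirc a) (vol g e * cometric g e a b * SF.d (dirc b) W))
        + ((n * tau g e ^ (n - 1)) * ambPull g e (vol g e * SF.d dirρ W)
        + (tau g e ^ (n + 1) * tauInv g e ^ 2) *
        ambPull g e (-2 * SF.d dirρ (vol g e * rho g e * SF.d dirρ W))) := by
    simp only [Fintype.sum_sum_type, Fin.sum_univ_two, z1, z2, ambient_term_inl,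
      ambient_term_zero_one, ambient_term_one_one, t4, mul_zero, zero_mul,
      map_zero, Finset.sum_const_zero, add_zero, zero_add]
    simp only [map_sum, Finset.mul_sum]
  rw [hsum, ambForm, map_sub, map_add]
  simp only [SF.add_apply, SF.sub_apply, SF.mul_apply, SF.pow_apply, hz, ht, SF.natCast_apply,
    map_mul, map_neg, map_natCast, map_ofNat, SF.neg_apply, one_pow, mul_one,
    one_mul]
  ring

end Ambient

end OvsienkoRedou

/-! ### Divergence form of the conjugated Laplacian -/

namespace OvsienkoRedou

open Filter Set

set_option linter.unusedSectionVars false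

section LocalForm

variable {n : ℕ} {M : Type*} [TopologicalSpace M]
  [ChartedSpace (EuclideanSpace ℝ (Fin n)) M] [IsManifold (𝓡 n) ∞ M]
  (g : MetricFamily n M) (e e' : atlas (Eu n) M)

/-- The divergence form operator `|det g₀|^(-1/2) ∑ ∂ₐ (|det g₀|^(1/2) Pᵃᵇ ∂_b F)` in a chart. -/
def divForm (P : Matrix (Fin n) (Fin n) (SF (chartDom g e))) (F : SF (chartDom g e)) :
    SF (chartDom g e) :=
  vol0Inv g e * ∑ a, ∑ b, SF.d (dirc a) (vol0 g e * P a b * SF.d (dirc b) F)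

/-- The part of the potential that comes from `ρ`-derivatives of the weight. -/
def pot : SF (chartDom g e) :=
  weightInv g e * ((n : SF (chartDom g e)) * weightSF g e ^ 2 * SF.d dirρ (weightInv g e)
    - 2 * SF.d dirρ (weightSF g e ^ 2 * rho g e * SF.d dirρ (weightInv g e)))

theorem d_weightInv (v : ℝ × Eu n) :
    SF.d v (weightInv g e) = -(weightInv g e ^ 2 * SF.d v (weightSF g e)) := by
  have h := weightSF_mul_inv g e
  have h1 := congrArg (SF.d v) h
  rw [Derivation.leibniz, Derivation.map_one_eq_zero, smul_eq_mul, smul_eq_mul] at h1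
  linear_combination (weightInv g e) * h1 - (SF.d v (weightInv g e)) * h

/-- By `vol_eq` and `w² ∂(u/w) = w ∂u - u ∂w`, conjugation replaces the moving density by the fixed
one. The products of first derivatives of `w` and `u` cancel by the symmetry of `P`, so `w` survives
only as a factor and in a potential. -/
theorem sum_d_vol_eq (P : Matrix (Fin n) (Fin n) (SF (chartDom g e))) (hP : ∀ a b, P a b = P b a)
    (u : SF (chartDom g e)) :
    ∑ a, ∑ b, SF.d (dirc a) (vol g e * P a b * SF.d (dirc b) (weightInv g e * u))
      = weightSF g e * ∑ a, ∑ b, SF.d (dirc a) (vol0 g e * P a b * SF.d (dirc b) u)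
        - u * ∑ a, ∑ b, SF.d (dirc a) (vol0 g e * P a b * SF.d (dirc b) (weightSF g e)) := by
  have h := weightSF_mul_inv g e
  have e1 : ∀ a b, vol g e * P a b * SF.d (dirc b) (weightInv g e * u)
      = weightSF g e * (vol0 g e * P a b * SF.d (dirc b) u)
        - u * (vol0 g e * P a b * SF.d (dirc b) (weightSF g e)) := by
    intro a b
    rw [Derivation.leibniz, d_weightInv, vol_eq, smul_eq_mul, smul_eq_mul]
    linear_combination (vol0 g e * P a b * weightSF g e * SF.d (dirc b) u
      - vol0 g e * P a b * u * SF.d (dirc b) (weightSF g e)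
        * (weightSF g e * weightInv g e + 1)) * h
  have e2 : ∀ a b, SF.d (dirc a) (vol g e * P a b * SF.d (dirc b) (weightInv g e * u))
      = weightSF g e * SF.d (dirc a) (vol0 g e * P a b * SF.d (dirc b) u)
        - u * SF.d (dirc a) (vol0 g e * P a b * SF.d (dirc b) (weightSF g e))
        + (vol0 g e * P a b * (SF.d (dirc a) (weightSF g e) * SF.d (dirc b) u)
          - vol0 g e * P a b * (SF.d (dirc b) (weightSF g e) * SF.d (dirc a) u)) := by
    intro a b
    rw [e1, map_sub, Derivation.leibniz _ (weightSF g e), Derivation.leibniz _ u]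
    simp only [smul_eq_mul]
    ring
  have e3 : ∑ a, ∑ b, vol0 g e * P a b * (SF.d (dirc a) (weightSF g e) * SF.d (dirc b) u)
      = ∑ a, ∑ b, vol0 g e * P a b * (SF.d (dirc b) (weightSF g e) * SF.d (dirc a) u) := by
    rw [Finset.sum_comm]
    refine Finset.sum_congr rfl fun a _ => Finset.sum_congr rfl fun b _ => ?_
    rw [hP]
  simp only [e2, Finset.sum_add_distrib, Finset.sum_sub_distrib, ← Finset.mul_sum]
  rw [e3, sub_self, add_zero]

/-- The potential of `ℳ̃(ρ)` in a chart. -/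
def fullPot : SF (chartDom g e) :=
  pot g e - weightInv g e * divForm g e (cometric g e) (weightSF g e)

/-- As `u` is independent of `ρ`, every `ρ`-derivative falls on the weight and contributes to the
potential only. The outcome is a symmetric operator with respect to the density of `g₀` for each
`ρ`. -/
theorem ambForm_eq (u : SF (chartDom g e)) (hu : SF.d dirρ u = 0) :
    vol0Inv g e * weightInv g e * ambForm g e (weightInv g e * u)
      = divForm g e (cometric g e) u + fullPot g e * u := by
  have h := weightSF_mul_inv g e
  have h0 := vol0_mul_inv g e
  have hd : SF.d dirρ (weightInv g e * u) = u * SF.d dirρ (weightInv g e) := by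
    rw [Derivation.leibniz, hu, smul_zero, zero_add, smul_eq_mul]
  have hd2 : SF.d dirρ (vol g e * rho g e * SF.d dirρ (weightInv g e * u))
      = (vol0 g e * u) * SF.d dirρ (weightSF g e ^ 2 * rho g e * SF.d dirρ (weightInv g e)) := by
    have hvu : SF.d dirρ (vol0 g e * u) = 0 := by
      rw [d_mul_of_d_eq_zero (d_vol0 g e), hu, mul_zero]
    rw [← d_mul_of_d_eq_zero hvu, hd, vol_eq]
    congr 1
    ring
  rw [ambForm, sum_d_vol_eq g e _ (cometric_symm g e), hd2, hd, fullPot, pot, divForm, divForm,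
    vol_eq]
  generalize ∑ a, ∑ b, SF.d (dirc a) (vol0 g e * cometric g e a b * SF.d (dirc b) u) = S
  generalize ∑ a, ∑ b, SF.d (dirc a) (vol0 g e * cometric g e a b *
    SF.d (dirc b) (weightSF g e)) = S'
  generalize SF.d dirρ (weightSF g e ^ 2 * rho g e * SF.d dirρ (weightInv g e)) = Y
  generalize SF.d dirρ (weightInv g e) = Z at *
  linear_combination (vol0Inv g e * S) * h + (weightInv g e * u *
    (n * weightSF g e ^ 2 * Z - 2 * Y)) * h0

variable {g}

theorem jSmooth_const {u : M → ℝ} (hu : ContMDiff (𝓡 n) 𝓘(ℝ, ℝ) ∞ u) :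
    JSmooth g fun _ => u := fun e => by
  have h1 : ContMDiffOn 𝓘(ℝ, Eu n) 𝓘(ℝ, ℝ) ∞ (u ∘ e.1.symm) e.1.target :=
    hu.comp_contMDiffOn (contMDiffOn_symm_of_mem_maximalAtlas
      (IsManifold.subset_maximalAtlas e.2))
  exact (contMDiffOn_iff_contDiffOn.1 h1).comp contDiffOn_snd fun p hp => hp.2

theorem d_hat_const {u : M → ℝ} (hu : JSmooth g fun _ => u) : SF.d dirρ (hat e hu) = 0 := by
  ext p
  have h1 : (hat e hu : chartDom g e → ℝ) = fun p => atZero g e (hat e hu) p := by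
    funext p
    rw [atZero_apply]
    rfl
  have h2 : hat e hu = atZero g e (hat e hu) := SF.ext (congrFun h1)
  rw [h2, d_atZero]

theorem jSmooth_atParam {F : ℝ → M → ℝ} (hF : JSmooth g F) {ρ : ℝ} (hρ : ρ ∈ Ioo (-g.ε) g.ε) :
    JSmooth g fun _ => F ρ := fun e =>
  (hF e).comp (f := fun p : ℝ × Eu n => (ρ, p.2)) (by fun_prop) fun p hp => ⟨hρ, hp.2⟩

variable (g)

theorem ambientCoords_mem {ρ : ℝ} (hρ : ρ ∈ Ioo (-g.ε) g.ε) {x : M} (hx : x ∈ e.1.source) :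
    ambientCoords 1 (e.1 x) ρ ∈ ambDom g e :=
  ⟨(zero_lt_one : (0 : ℝ) < 1), hρ, e.1.map_source hx⟩

/-- The ambient Laplacian at `x` is defined in the preferred chart of `x`, so the chart is
restricted to this one here. Other charts have to wait for `divForm_change`. -/
theorem genM_chartA {u : M → ℝ} (hu : JSmooth g fun _ => u) {ρ : ℝ} (hρ : ρ ∈ Ioo (-g.ε) g.ε)
    {x : M} (he : chartA x = e) (hx : x ∈ e.1.source) :
    genM g ρ u x = (divForm g e (cometric g e) (hat e hu)
      + fullPot g e * hat e hu) (chartPt g e hρ hx) := by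
  let z : ambDom g e := ⟨ambientCoords 1 (e.1 x) ρ, ambientCoords_mem g e hρ hx⟩
  let W : SF (chartDom g e) := weightInv g e * hat e hu
  have hW : ∀ z : ambDom g e, ambPull g e W z
      = (weight g (z.1 (Sum.inr 1)) (e.1.symm (baseCoords z.1)))⁻¹
        * u (e.1.symm (baseCoords z.1)) := by
    intro z
    rw [ambPull, SF.pull_apply, SF.mul_apply, weightInv_apply, ← weight_eq_weightSF]
    rfl
  have h1 : ambientLaplacian g (fun _ x' ρ' => (weight g ρ' x')⁻¹ * u x') 1 x ρ
      = (ambVol g e z)⁻¹ * ambPull g e (ambForm g e W) z := by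
    rw [← sum_ambVol_apply g e W z rfl]
    subst he
    exact coordLaplacian_eq (ambVol_apply g _) (ambInv_apply g _) hW z
  have hz : (⟨ambProj z.1, ambProj_mem g e z.1 z.2⟩ : chartDom g e) = chartPt g e hρ hx := rfl
  have h2 : ambVol g e z = vol g e (chartPt g e hρ hx) := by
    rw [ambVol, SF.mul_apply, SF.pow_apply, ambPull, SF.pull_apply, hz]
    have : tau g e z = 1 := rfl
    rw [this, one_pow, one_mul]
  have h3 : weight g ρ x = weightSF g e (chartPt g e hρ hx) := by
    rw [← weight_eq_weightSF]
    exact congrArg (weight g ρ) (e.1.left_inv hx).symm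
  rw [genM, conjLaplacian, h1, h2, h3, ← ambForm_eq g e _ (d_hat_const e hu), ambPull,
    SF.pull_apply, hz, vol_eq, SF.mul_apply, SF.mul_apply, SF.mul_apply, SF.pow_apply,
    vol0Inv_apply, weightInv_apply]
  have h4 := (weightSF_pos g e (chartPt g e hρ hx)).ne'
  have h5 := (vol0_pos g e (chartPt g e hρ hx)).ne'
  field_simp
  rfl

end LocalForm

end OvsienkoRedou

/-! ### Integration in charts and the divergence theorem -/

namespace OvsienkoRedou

open Filter Set MeasureTheory

set_option linter.unusedSectionVars false

section Integration

variable {n : ℕ} {M : Type*} [TopologicalSpace M]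
  [ChartedSpace (EuclideanSpace ℝ (Fin n)) M] [IsManifold (𝓡 n) ∞ M]
  (g : MetricFamily n M) (e e' : atlas (Eu n) M)

/-- The density `√|det g₀|` in a chart, on the whole coordinate space. -/
def density (y : Eu n) : ℝ := Real.sqrt |(components (g.toFun 0) e.1 y).det|

theorem density_eq {ρ : ℝ} (hρ : ρ ∈ Ioo (-g.ε) g.ε) {y : Eu n} (hy : y ∈ e.1.target) :
    density g e y = vol0 g e ⟨(ρ, y), hρ, hy⟩ := (vol0_apply g e ⟨(ρ, y), hρ, hy⟩).symm

theorem density_pos {y : Eu n} (hy : y ∈ e.1.target) : 0 < density g e y := by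
  rw [density_eq g e (zero_mem_Ioo g) hy]
  exact vol0_pos g e _

theorem continuousOn_slice (f : SF (chartDom g e)) {ρ : ℝ} (hρ : ρ ∈ Ioo (-g.ε) g.ε) :
    ContinuousOn (fun y => extZero f (ρ, y)) e.1.target :=
  (SF.smoothOn f).continuousOn.comp (by fun_prop) fun _ hy => ⟨hρ, hy⟩

theorem continuousOn_density : ContinuousOn (density g e) e.1.target :=
  (continuousOn_slice g e (vol0 g e) (zero_mem_Ioo g)).congr fun y hy => by
    rw [density_eq g e (zero_mem_Ioo g) hy]
    exact (extZero_apply (vol0 g e) ⟨(0, y), zero_mem_Ioo g, hy⟩).symm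

/-- The function on `M` that is given by `f(ρ, ·)` in a chart and vanishes outside the chart. -/
def toM (f : SF (chartDom g e)) (ρ : ℝ) : M → ℝ :=
  e.1.source.indicator fun x => extZero f (ρ, e.1 x)

theorem toM_apply (f : SF (chartDom g e)) {ρ : ℝ} (hρ : ρ ∈ Ioo (-g.ε) g.ε) {x : M}
    (hx : x ∈ e.1.source) : toM g e f ρ x = f (chartPt g e hρ hx) := by
  rw [toM, indicator_of_mem hx]
  exact extZero_apply f (chartPt g e hρ hx)

theorem toM_of_notMem (f : SF (chartDom g e)) (ρ : ℝ) {x : M} (hx : x ∉ e.1.source) :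
    toM g e f ρ x = 0 := indicator_of_notMem hx _

theorem continuousOn_toM (f : SF (chartDom g e)) {ρ : ℝ} (hρ : ρ ∈ Ioo (-g.ε) g.ε) :
    ContinuousOn (toM g e f ρ) e.1.source := by
  refine ((continuousOn_slice g e f hρ).comp e.1.continuousOn e.1.mapsTo).congr fun x hx => ?_
  rw [toM, indicator_of_mem hx]
  rfl

/-- The function `f(ρ, ·)` vanishes outside the compact subset `K` of the domain of the chart. -/
def VanishesOff (f : SF (chartDom g e)) (ρ : ℝ) (K : Set M) : Prop := ∀ x ∉ K, toM g e f ρ x = 0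

variable {g e} in
theorem VanishesOff.continuous [T2Space M] {f : SF (chartDom g e)} {ρ : ℝ}
    (hρ : ρ ∈ Ioo (-g.ε) g.ε) {K : Set M} (hK : IsCompact K) (hKe : K ⊆ e.1.source)
    (hf : VanishesOff g e f ρ K) : Continuous (toM g e f ρ) := by
  rw [continuous_iff_continuousAt]
  intro x
  by_cases hx : x ∈ e.1.source
  · exact (continuousOn_toM g e f hρ).continuousAt (e.1.open_source.mem_nhds hx)
  · have h1 : toM g e f ρ =ᶠ[𝓝 x] fun _ => 0 := by
      filter_upwards [hK.isClosed.isOpen_compl.mem_nhds fun h => hx (hKe h)] with y hy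
      exact hf y hy
    exact continuousAt_const.congr h1.symm

variable [T2Space M] [MeasurableSpace M] [BorelSpace M]

theorem measure_eq_lintegral {μ : Measure M} (hμ : IsVolumeMeasure (g.toFun 0) μ)
    {s : Set M} (hs : MeasurableSet s) (hse : s ⊆ e.1.source) :
    μ s = ∫⁻ y in e.1 '' s, ENNReal.ofReal (density g e y) := hμ e.1 e.2 s hs hse

theorem isLocallyFiniteMeasure {μ : Measure M} (hμ : IsVolumeMeasure (g.toFun 0) μ) :
    IsLocallyFiniteMeasure μ := by
  refine ⟨fun x => ?_⟩
  let e : atlas (Eu n) M := chartA x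
  have hx : x ∈ e.1.source := mem_chartA x
  obtain ⟨r, hr, hball⟩ := Metric.isOpen_iff.1 e.1.open_target _ (e.1.map_source hx)
  have hr2 : 0 < r / 2 := by positivity
  have hc : Metric.closedBall (e.1 x) (r / 2) ⊆ e.1.target :=
    (Metric.closedBall_subset_ball (by linarith)).trans hball
  let s := e.1.source ∩ e.1 ⁻¹' Metric.ball (e.1 x) (r / 2)
  have hs : IsOpen s := e.1.isOpen_inter_preimage Metric.isOpen_ball
  refine ⟨s, hs.mem_nhds ⟨hx, Metric.mem_ball_self hr2⟩, ?_⟩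
  obtain ⟨C, hC⟩ := (isCompact_closedBall (e.1 x) (r / 2)).exists_bound_of_continuousOn
    ((continuousOn_density g e).mono hc)
  have himg : e.1 '' s ⊆ Metric.ball (e.1 x) (r / 2) := by
    rintro _ ⟨y, hy, rfl⟩
    exact hy.2
  rw [measure_eq_lintegral g e hμ hs.measurableSet inter_subset_left]
  calc ∫⁻ y in e.1 '' s, ENNReal.ofReal (density g e y)
      ≤ ∫⁻ y in Metric.ball (e.1 x) (r / 2), ENNReal.ofReal (density g e y) :=
        lintegral_mono_set himg
    _ ≤ ∫⁻ y in Metric.ball (e.1 x) (r / 2), ENNReal.ofReal C := by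
        refine setLIntegral_mono measurable_const fun y hy => ENNReal.ofReal_le_ofReal ?_
        exact (le_abs_self _).trans (hC y (Metric.ball_subset_closedBall hy))
    _ < ⊤ := by
        rw [setLIntegral_const]
        exact ENNReal.mul_lt_top ENNReal.ofReal_lt_top measure_ball_lt_top

theorem isOpenPosMeasure {μ : Measure M} (hμ : IsVolumeMeasure (g.toFun 0) μ) :
    μ.IsOpenPosMeasure := by
  refine ⟨fun U hU ⟨x, hx⟩ h0 => ?_⟩
  let e : atlas (Eu n) M := chartA x
  have hxe : x ∈ e.1.source := mem_chartA x
  have hs : IsOpen (U ∩ e.1.source) := hU.inter e.1.open_source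
  have h1 : μ (U ∩ e.1.source) = 0 := measure_mono_null inter_subset_left h0
  have himg : IsOpen (e.1 '' (U ∩ e.1.source)) :=
    e.1.isOpen_image_of_subset_source hs inter_subset_right
  have hsub : e.1 '' (U ∩ e.1.source) ⊆ e.1.target := by
    rintro _ ⟨y, hy, rfl⟩
    exact e.1.map_source hy.2
  rw [measure_eq_lintegral g e hμ hs.measurableSet inter_subset_right,
    lintegral_eq_zero_iff' ((continuousOn_density g e).mono hsub
      |>.aemeasurable himg.measurableSet).ennreal_ofReal] at h1
  rw [EventuallyEq, ae_restrict_iff' himg.measurableSet] at h1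
  have h2 : volume (e.1 '' (U ∩ e.1.source)) = 0 := by
    refine measure_mono_null (fun y hy => ?_) h1
    intro h
    have h3 := h hy
    rw [Pi.zero_apply, ENNReal.ofReal_eq_zero] at h3
    exact absurd (density_pos g e (hsub hy)) (not_lt.2 h3)
  exact (himg.measure_pos volume ⟨_, mem_image_of_mem _ ⟨hx, hxe⟩⟩).ne' h2

/-- The defining property of the volume measure, rephrased as a pushforward, so that integrals over
a chart become Lebesgue integrals. -/
theorem restrict_eq_map {μ : Measure M} (hμ : IsVolumeMeasure (g.toFun 0) μ)
    : μ.restrict e.1.source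
    = ((volume.restrict e.1.target).withDensity fun y => ENNReal.ofReal (density g e y)).map
        e.1.symm := by
  have hm : AEMeasurable e.1.symm
      ((volume.restrict e.1.target).withDensity fun y => ENNReal.ofReal (density g e y)) :=
    (e.1.continuousOn_symm.aemeasurable e.1.open_target.measurableSet).mono_ac
      (withDensity_absolutelyContinuous _ _)
  ext s hs
  rw [Measure.restrict_apply hs, Measure.map_apply_of_aemeasurable hm hs, withDensity_apply',
    Measure.restrict_restrict' e.1.open_target.measurableSet,
    measure_eq_lintegral g e hμ (hs.inter e.1.open_source.measurableSet) inter_subset_right,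
    e.1.image_eq_target_inter_inv_preimage inter_subset_right]
  congr 2
  ext y
  constructor
  · exact fun h => ⟨h.2.1, h.1⟩
  · exact fun h => ⟨h.2, h.1, e.1.map_target h.2⟩

theorem integral_toM {μ : Measure M} (hμ : IsVolumeMeasure (g.toFun 0) μ)
    (f : SF (chartDom g e)) {ρ : ℝ} (hρ : ρ ∈ Ioo (-g.ε) g.ε) :
    ∫ x, toM g e f ρ x ∂μ = ∫ y in e.1.target, extZero (vol0 g e * f : SF (chartDom g e)) (ρ, y) := by
  have hm : AEMeasurable e.1.symm
      ((volume.restrict e.1.target).withDensity fun y => ENNReal.ofReal (density g e y)) :=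
    (e.1.continuousOn_symm.aemeasurable e.1.open_target.measurableSet).mono_ac
      (withDensity_absolutelyContinuous _ _)
  rw [← setIntegral_eq_integral_of_forall_compl_eq_zero (s := e.1.source)
    fun x hx => toM_of_notMem g e f ρ hx]
  have h1 : AEStronglyMeasurable (toM g e f ρ) (μ.restrict e.1.source) :=
    (continuousOn_toM g e f hρ).aestronglyMeasurable e.1.open_source.measurableSet
  rw [restrict_eq_map g e hμ] at h1 ⊢
  rw [integral_map hm h1, integral_withDensity_eq_integral_toReal_smul₀
    (((continuousOn_density g e).aemeasurable e.1.open_target.measurableSet).ennreal_ofReal)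
    (Eventually.of_forall fun _ => ENNReal.ofReal_lt_top)]
  refine setIntegral_congr_fun e.1.open_target.measurableSet fun y hy => ?_
  rw [ENNReal.toReal_ofReal (density_pos g e hy).le, toM_apply g e f hρ (e.1.map_target hy),
    density_eq g e hρ hy, smul_eq_mul]
  have hp : chartPt g e hρ (e.1.map_target hy) = ⟨(ρ, y), hρ, hy⟩ :=
    Subtype.ext (Prod.ext rfl (e.1.right_inv hy))
  rw [hp]
  exact (extZero_apply (vol0 g e * f : SF (chartDom g e)) ⟨(ρ, y), hρ, hy⟩).symm

/-- Because `X(ρ, ·)` vanishes off a compact set inside the chart, its extension by zero is smooth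
with compact support on the whole coordinate space. -/
theorem integral_d_eq_zero (X : SF (chartDom g e)) {ρ : ℝ} (hρ : ρ ∈ Ioo (-g.ε) g.ε) {K : Set M}
    (hK : IsCompact K) (hKe : K ⊆ e.1.source) (hX : VanishesOff g e X ρ K) (a : Fin n) :
    IntegrableOn (fun y => extZero (SF.d (dirc a) X) (ρ, y)) e.1.target ∧
      ∫ y in e.1.target, extZero (SF.d (dirc a) X) (ρ, y) = 0 := by
  let f : Eu n → ℝ := e.1.target.indicator fun y => extZero X (ρ, y)
  let K' : Set (Eu n) := e.1 '' K
  have hK' : IsCompact K' := hK.image_of_continuousOn (e.1.continuousOn.mono hKe)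
  have hK't : K' ⊆ e.1.target := by
    rintro _ ⟨x, hx, rfl⟩
    exact e.1.map_source (hKe hx)
  have hf0 : ∀ y ∉ K', f y = 0 := by
    intro y hy
    by_cases hyt : y ∈ e.1.target
    · have h1 : e.1.symm y ∉ K := fun h => hy ⟨_, h, e.1.right_inv hyt⟩
      have h2 := hX _ h1
      rw [toM, indicator_of_mem (e.1.map_target hyt), e.1.right_inv hyt] at h2
      exact (indicator_of_mem hyt _).trans h2
    · exact indicator_of_notMem hyt _
  have hslice : ∀ y, HasFDerivAt (fun y : Eu n => (ρ, y)) (ContinuousLinearMap.inr ℝ ℝ (Eu n)) y :=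
    fun y => hasFDerivAt_prodMk_right ρ y
  have hfy : ∀ y ∈ e.1.target, f =ᶠ[𝓝 y] fun y => extZero X (ρ, y) := fun y hy => by
    filter_upwards [e.1.open_target.mem_nhds hy] with z hz
    exact indicator_of_mem hz _
  have hfn : ∀ y ∉ e.1.target, f =ᶠ[𝓝 y] fun _ => 0 := fun y hy => by
    filter_upwards [hK'.isClosed.isOpen_compl.mem_nhds fun h => hy (hK't h)] with z hz
    exact hf0 z hz
  have hsmooth : ContDiff ℝ ∞ f := by
    rw [contDiff_iff_contDiffAt]
    intro y
    by_cases hy : y ∈ e.1.target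
    · refine ContDiffAt.congr_of_eventuallyEq ?_ (hfy y hy)
      exact (SF.smoothAt X ⟨(ρ, y), hρ, hy⟩).comp y (by fun_prop)
    · exact contDiffAt_const.congr_of_eventuallyEq (hfn y hy)
  have hsupp : HasCompactSupport f := HasCompactSupport.intro hK' hf0
  have hder : ∀ y ∈ e.1.target, fderiv ℝ f y (EuclideanSpace.single a 1)
      = extZero (SF.d (dirc a) X) (ρ, y) := by
    intro y hy
    have h1 : HasFDerivAt (extZero X) (fderiv ℝ (extZero X) (ρ, y)) (ρ, y) :=
      (SF.diffAt X ⟨(ρ, y), hρ, hy⟩).hasFDerivAt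
    have h2 := (h1.comp y (hslice y)).congr_of_eventuallyEq (hfy y hy)
    rw [h2.fderiv]
    exact (extZero_apply (SF.d (dirc a) X) ⟨(ρ, y), hρ, hy⟩).symm
  have hder0 : ∀ y ∉ e.1.target, fderiv ℝ f y (EuclideanSpace.single a 1) = 0 := by
    intro y hy
    rw [(hfn y hy).fderiv_eq]
    simp
  have hint : Integrable fun y => fderiv ℝ f y (EuclideanSpace.single a 1) := by
    refine Continuous.integrable_of_hasCompactSupport ?_ ?_
    · exact (hsmooth.continuous_fderiv (by simp)).clm_apply continuous_const
    · exact hsupp.fderiv_apply (𝕜 := ℝ) _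
  have h0 : ∫ y, fderiv ℝ f y (EuclideanSpace.single a 1) = 0 := by
    -- Integration by parts against the constant `1`.
    have := integral_mul_fderiv_eq_neg_fderiv_mul_of_integrable (μ := volume)
      (f := fun _ : Eu n => (1 : ℝ)) (g := f) (v := EuclideanSpace.single a 1) (by simp)
      (by simpa using hint)
      (by simpa using hsmooth.continuous.integrable_of_hasCompactSupport hsupp)
      (fun x _ => differentiableAt_const _)
      (fun x _ => (hsmooth.differentiable (by simp)).differentiableAt)
    simpa using this
  constructor
  · refine (hint.integrableOn (s := e.1.target)).congr_fun (fun y hy => hder y hy)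
      e.1.open_target.measurableSet
  · rw [← setIntegral_eq_integral_of_forall_compl_eq_zero (s := e.1.target) hder0] at h0
    rw [← h0]
    exact setIntegral_congr_fun e.1.open_target.measurableSet fun y hy => (hder y hy).symm

/-- The divergence theorem for vector fields with compact support in a chart. -/
theorem integral_divergence {μ : Measure M} (hμ : IsVolumeMeasure (g.toFun 0) μ)
    (X : Fin n → SF (chartDom g e)) {ρ : ℝ} (hρ : ρ ∈ Ioo (-g.ε) g.ε)
    {K : Set M} (hK : IsCompact K) (hKe : K ⊆ e.1.source)
    (hX : ∀ a, VanishesOff g e (X a) ρ K) :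
    ∫ x, toM g e (vol0Inv g e * ∑ a, SF.d (dirc a) (X a)) ρ x ∂μ = 0 := by
  rw [integral_toM g e hμ _ hρ, ← mul_assoc, vol0_mul_inv, one_mul]
  have h1 : ∀ y ∈ e.1.target, extZero (∑ a, SF.d (dirc a) (X a) : SF (chartDom g e)) (ρ, y)
      = ∑ a, extZero (SF.d (dirc a) (X a)) (ρ, y) := by
    intro y hy
    have h2 : ∀ f : SF (chartDom g e), extZero f (ρ, y) = f ⟨(ρ, y), hρ, hy⟩ := fun f =>
      extZero_apply f ⟨(ρ, y), hρ, hy⟩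
    simp only [h2, SF.sum_apply]
  rw [setIntegral_congr_fun e.1.open_target.measurableSet h1, integral_finsetSum]
  · exact Finset.sum_eq_zero fun a _ => (integral_d_eq_zero g e (X a) hρ hK hKe (hX a) a).2
  · exact fun a _ => (integral_d_eq_zero g e (X a) hρ hK hKe (hX a) a).1

end Integration

end OvsienkoRedou

/-! ### Independence of the chart -/

namespace OvsienkoRedou

open Filter Set MeasureTheory

set_option linter.unusedSectionVars false

section ChartIndependence

variable {n : ℕ} {M : Type*} [TopologicalSpace M]
  [ChartedSpace (EuclideanSpace ℝ (Fin n)) M] [IsManifold (𝓡 n) ∞ M]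
  (g : MetricFamily n M) (e e' : atlas (Eu n) M)

/-- The pairing `∑ Pᵃᵇ ∂ₐf ∂_b h` of gradients. -/
def gradPair (P : Matrix (Fin n) (Fin n) (SF (chartDom g e))) (f h : SF (chartDom g e)) :
    SF (chartDom g e) := ∑ a, ∑ b, P a b * SF.d (dirc a) f * SF.d (dirc b) h

/-- The product rule. After integration with `η` compactly supported in the chart it becomes the
weak form: `η divForm F` and `-gradPair η F` have the same integral. -/
theorem divergence_mul (P : Matrix (Fin n) (Fin n) (SF (chartDom g e)))
    (η F : SF (chartDom g e)) :
    vol0Inv g e * ∑ a, SF.d (dirc a) (η * ∑ b, vol0 g e * P a b * SF.d (dirc b) F)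
      = η * divForm g e P F + gradPair g e P η F := by
  have h0 := vol0_mul_inv g e
  have h1 : ∀ a, SF.d (dirc a) (η * ∑ b, vol0 g e * P a b * SF.d (dirc b) F)
      = η * ∑ b, SF.d (dirc a) (vol0 g e * P a b * SF.d (dirc b) F)
        + vol0 g e * ∑ b, P a b * SF.d (dirc a) η * SF.d (dirc b) F := by
    intro a
    rw [Derivation.leibniz, smul_eq_mul, smul_eq_mul, map_sum, Finset.sum_mul, Finset.mul_sum]
    congr 1
    rw [Finset.mul_sum]
    refine Finset.sum_congr rfl fun b _ => ?_
    ring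
  rw [divForm, gradPair, Finset.sum_congr rfl fun a _ => h1 a, Finset.sum_add_distrib,
    ← Finset.mul_sum, ← Finset.mul_sum]
  generalize ∑ a, ∑ b, P a b * SF.d (dirc a) η * SF.d (dirc b) F = S
  linear_combination S * h0

variable {g}

theorem d_hat_chartPt {F : ℝ → M → ℝ} (hF : JSmooth g F) {ρ : ℝ} (hρ : ρ ∈ Ioo (-g.ε) g.ε) {x : M}
    (hx : x ∈ e.1.source) (a : Fin n) :
    SF.d (dirc a) (hat e hF) (chartPt g e hρ hx)
      = fderiv ℝ (F ρ ∘ e.1.symm) (e.1 x) (EuclideanSpace.single a 1) := by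
  have h1 : HasFDerivAt (extZero (hat e hF)) (fderiv ℝ (extZero (hat e hF)) (ρ, e.1 x))
      (ρ, e.1 x) := (SF.diffAt (hat e hF) (chartPt g e hρ hx)).hasFDerivAt
  have h2 : F ρ ∘ e.1.symm =ᶠ[𝓝 (e.1 x)] extZero (hat e hF) ∘ fun y => (ρ, y) := by
    filter_upwards [e.1.open_target.mem_nhds (e.1.map_source hx)] with y hy
    exact (extZero_apply (hat e hF) ⟨(ρ, y), hρ, hy⟩).symm
  have h3 := (h1.comp (e.1 x) (hasFDerivAt_prodMk_right ρ (e.1 x))).congr_of_eventuallyEq h2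
  rw [h3.fderiv]
  rfl

theorem differentiableAt_chart {F : ℝ → M → ℝ} (hF : JSmooth g F) {ρ : ℝ}
    (hρ : ρ ∈ Ioo (-g.ε) g.ε) {x : M} (hx : x ∈ e.1.source) :
    DifferentiableAt ℝ (F ρ ∘ e.1.symm) (e.1 x) := by
  have h1 := (hF e).contDiffAt ((chartDom g e).isOpen.mem_nhds (chartPt g e hρ hx).2)
  have h2 : ContDiffAt ℝ ∞ (F ρ ∘ e.1.symm) (e.1 x) :=
    ContDiffAt.comp (f := fun y => (ρ, y)) (e.1 x) h1 (by fun_prop)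
  exact h2.differentiableAt (by simp)

theorem d_hat_change {F : ℝ → M → ℝ} (hF : JSmooth g F) {ρ : ℝ} (hρ : ρ ∈ Ioo (-g.ε) g.ε) {x : M}
    (hx : x ∈ e.1.source) (hx' : x ∈ e'.1.source) :
    (fun a => SF.d (dirc a) (hat e hF) (chartPt g e hρ hx))
      = (jacobian e e' x).transpose.mulVec
        fun a => SF.d (dirc a) (hat e' hF) (chartPt g e' hρ hx') := by
  funext a
  rw [d_hat_chartPt, fderiv_chart_change e e' hx hx' (differentiableAt_chart e' hF hρ hx')]
  simp only [d_hat_chartPt]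
  rfl

variable (g)

theorem gradPair_apply (P : Matrix (Fin n) (Fin n) (SF (chartDom g e))) (f h : SF (chartDom g e))
    (p : chartDom g e) : gradPair g e P f h p
      = (fun a => SF.d (dirc a) f p) ⬝ᵥ
        ((SF.eval p).mapMatrix P).mulVec fun a => SF.d (dirc a) h p := by
  simp only [gradPair, SF.sum_apply, SF.mul_apply, dotProduct, Matrix.mulVec, Finset.mul_sum]
  refine Finset.sum_congr rfl fun a _ => Finset.sum_congr rfl fun b _ => ?_
  rw [RingHom.mapMatrix_apply, Matrix.map_apply, SF.eval_apply]
  ring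

/-- Gradients transform with the transposed Jacobian and the inverse metric with the inverse
Jacobians, which cancel. Only first derivatives occur. -/
theorem gradPair_change {F H : ℝ → M → ℝ} (hF : JSmooth g F) (hH : JSmooth g H) {ρ : ℝ}
    (hρ : ρ ∈ Ioo (-g.ε) g.ε) {x : M} (hx : x ∈ e.1.source) (hx' : x ∈ e'.1.source) :
    gradPair g e (cometric g e) (hat e hF) (hat e hH) (chartPt g e hρ hx)
      = gradPair g e' (cometric g e') (hat e' hF) (hat e' hH) (chartPt g e' hρ hx') := by
  rw [gradPair_apply, gradPair_apply, d_hat_change e e' hF hρ hx hx',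
    d_hat_change e e' hH hρ hx hx', cometric_eval, cometric_eval]
  have hJ : IsUnit (jacobian e e' x).det := isUnit_iff_ne_zero.2 (jacobian_det_ne_zero g e e' hx hx')
  have hJt : IsUnit (jacobian e e' x).transpose.det := by rwa [Matrix.det_transpose]
  change _ ⬝ᵥ (components (g.toFun ρ) e.1 (e.1 x))⁻¹.mulVec _
    = _ ⬝ᵥ (components (g.toFun ρ) e'.1 (e'.1 x))⁻¹.mulVec _
  rw [components_change _ e e' hx hx', Matrix.mulVec_mulVec, Matrix.mul_inv_rev,
    Matrix.mul_inv_rev, mul_assoc, mul_assoc, Matrix.nonsing_inv_mul _ hJt, mul_one,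
    Matrix.mulVec_transpose, ← Matrix.dotProduct_mulVec, Matrix.mulVec_mulVec, ← mul_assoc,
    Matrix.mul_nonsing_inv _ hJ, one_mul]

theorem d_param_chartPt (f : SF (chartDom g e)) {ρ : ℝ} (hρ : ρ ∈ Ioo (-g.ε) g.ε) {x : M}
    (hx : x ∈ e.1.source) {φ : ℝ → ℝ}
    (h : ∀ s (hs : s ∈ Ioo (-g.ε) g.ε), f (chartPt g e hs hx) = φ s) :
    HasDerivAt φ (SF.d dirρ f (chartPt g e hρ hx)) ρ := by
  have h1 : HasFDerivAt (extZero f) (fderiv ℝ (extZero f) (ρ, e.1 x)) (ρ, e.1 x) :=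
    (SF.diffAt f (chartPt g e hρ hx)).hasFDerivAt
  have h2 : φ =ᶠ[𝓝 ρ] extZero f ∘ fun s => (s, e.1 x) := by
    filter_upwards [isOpen_Ioo.mem_nhds hρ] with s hs
    rw [← h s hs]
    exact (extZero_apply f (chartPt g e hs hx)).symm
  have h3 : HasDerivAt (fun s : ℝ => (s, e.1 x)) ((1 : ℝ), (0 : Eu n)) ρ :=
    (hasDerivAt_id ρ).prodMk (hasDerivAt_const ρ (e.1 x))
  exact (h1.comp_hasDerivAt ρ h3).congr_of_eventuallyEq h2

/-- The direction of the parameter is the same in all charts, so both sides are the derivative of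
one function of `s` at fixed `x`. -/
theorem d_param_change {f : SF (chartDom g e)} {f' : SF (chartDom g e')} {x : M}
    (hx : x ∈ e.1.source) (hx' : x ∈ e'.1.source)
    (h : ∀ s (hs : s ∈ Ioo (-g.ε) g.ε), f (chartPt g e hs hx) = f' (chartPt g e' hs hx'))
    {ρ : ℝ} (hρ : ρ ∈ Ioo (-g.ε) g.ε) :
    SF.d dirρ f (chartPt g e hρ hx) = SF.d dirρ f' (chartPt g e' hρ hx') := by
  let φ : ℝ → ℝ := fun s => extZero f (s, e.1 x)
  have h1 : ∀ s (hs : s ∈ Ioo (-g.ε) g.ε), f (chartPt g e hs hx) = φ s := fun s hs =>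
    (extZero_apply f (chartPt g e hs hx)).symm
  have h2 : ∀ s (hs : s ∈ Ioo (-g.ε) g.ε), f' (chartPt g e' hs hx') = φ s := fun s hs =>
    (h s hs).symm.trans (h1 s hs)
  exact (d_param_chartPt g e f hρ hx h1).unique (d_param_chartPt g e' f' hρ hx' h2)

theorem weightSF_chartPt {ρ : ℝ} (hρ : ρ ∈ Ioo (-g.ε) g.ε) {x : M} (hx : x ∈ e.1.source) :
    weightSF g e (chartPt g e hρ hx) = weight g ρ x := by
  rw [← hat_weight, hat_chartPt]

theorem weightInv_chartPt {ρ : ℝ} (hρ : ρ ∈ Ioo (-g.ε) g.ε) {x : M} (hx : x ∈ e.1.source) :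
    weightInv g e (chartPt g e hρ hx) = (weight g ρ x)⁻¹ := by
  rw [weightInv_apply, weightSF_chartPt]

theorem rho_chartPt {ρ : ℝ} (hρ : ρ ∈ Ioo (-g.ε) g.ε) {x : M} (hx : x ∈ e.1.source) :
    rho g e (chartPt g e hρ hx) = ρ := rfl

theorem pot_change {ρ : ℝ} (hρ : ρ ∈ Ioo (-g.ε) g.ε) {x : M} (hx : x ∈ e.1.source)
    (hx' : x ∈ e'.1.source) :
    pot g e (chartPt g e hρ hx) = pot g e' (chartPt g e' hρ hx') := by
  have h1 : ∀ s (hs : s ∈ Ioo (-g.ε) g.ε), SF.d dirρ (weightInv g e) (chartPt g e hs hx)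
      = SF.d dirρ (weightInv g e') (chartPt g e' hs hx') := fun s hs =>
    d_param_change g e e' hx hx' (fun s hs => by simp only [weightInv_chartPt]) hs
  have h2 : SF.d dirρ (weightSF g e ^ 2 * rho g e * SF.d dirρ (weightInv g e)) (chartPt g e hρ hx)
      = SF.d dirρ (weightSF g e' ^ 2 * rho g e' * SF.d dirρ (weightInv g e'))
        (chartPt g e' hρ hx') :=
    d_param_change g e e' hx hx' (fun s hs => by
      simp only [SF.mul_apply, SF.pow_apply, weightSF_chartPt, rho_chartPt, h1 s hs]) hρ
  simp only [pot, SF.mul_apply, SF.sub_apply, SF.pow_apply, weightSF_chartPt, weightInv_chartPt,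
    h1 ρ hρ, h2, SF.natCast_apply]
  rfl

/-- The operators `ℳ̃(ρ)` in a chart. -/
def chartOp (F : SF (chartDom g e)) : SF (chartDom g e) :=
  divForm g e (cometric g e) F + fullPot g e * F

/-- The operator differentiates only along `M`, so freezing the parameter of `F` at `ρ` does not
change its value at `ρ`. -/
theorem divForm_atParam (P : Matrix (Fin n) (Fin n) (SF (chartDom g e))) {F : ℝ → M → ℝ}
    (hF : JSmooth g F) {ρ : ℝ} (hρ : ρ ∈ Ioo (-g.ε) g.ε) {x : M} (hx : x ∈ e.1.source) :
    divForm g e P (hat e (jSmooth_atParam hF hρ)) (chartPt g e hρ hx)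
      = divForm g e P (hat e hF) (chartPt g e hρ hx) := by
  have key : ∀ (f h : SF (chartDom g e)), (∀ (y : M) (hy : y ∈ e.1.source),
      f (chartPt g e hρ hy) = h (chartPt g e hρ hy)) → ∀ (a : Fin n) (y : M) (hy : y ∈ e.1.source),
      SF.d (dirc a) f (chartPt g e hρ hy) = SF.d (dirc a) h (chartPt g e hρ hy) := by
    intro f h hfh a y hy
    have hd : ∀ f : SF (chartDom g e), SF.d (dirc a) f (chartPt g e hρ hy)
        = fderiv ℝ (fun z => extZero f (ρ, z)) (e.1 y) (EuclideanSpace.single a 1) := by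
      intro f
      have h1 : HasFDerivAt (extZero f) (fderiv ℝ (extZero f) (ρ, e.1 y)) (ρ, e.1 y) :=
        (SF.diffAt f (chartPt g e hρ hy)).hasFDerivAt
      have h3 := h1.comp (e.1 y) (hasFDerivAt_prodMk_right ρ (e.1 y))
      have h4 : fderiv ℝ (fun z => extZero f (ρ, z)) (e.1 y) = _ := h3.fderiv
      rw [h4]
      rfl
    rw [hd f, hd h]
    congr 1
    refine EventuallyEq.fderiv_eq ?_
    filter_upwards [e.1.open_target.mem_nhds (e.1.map_source hy)] with z hz
    have h5 : chartPt g e hρ (e.1.map_target hz) = ⟨(ρ, z), hρ, hz⟩ :=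
      Subtype.ext (Prod.ext rfl (e.1.right_inv hz))
    have h6 := hfh _ (e.1.map_target hz)
    rw [h5] at h6
    exact (extZero_apply f ⟨(ρ, z), hρ, hz⟩).trans (h6.trans
      (extZero_apply h ⟨(ρ, z), hρ, hz⟩).symm)
  have h0 : ∀ (y : M) (hy : y ∈ e.1.source), hat e (jSmooth_atParam hF hρ) (chartPt g e hρ hy)
      = hat e hF (chartPt g e hρ hy) := fun y hy => by rw [hat_chartPt, hat_chartPt]
  simp only [divForm, SF.mul_apply, SF.sum_apply]
  congr 1
  refine Finset.sum_congr rfl fun a _ => Finset.sum_congr rfl fun b _ => ?_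
  refine key _ _ (fun y hy => ?_) a x hx
  rw [SF.mul_apply, SF.mul_apply, key _ _ h0]
  rfl

variable [T2Space M]

theorem toM_hat_mul_vanishesOff {η : M → ℝ} (hη : JSmooth g fun _ => η) (f : SF (chartDom g e))
    {ρ : ℝ} (hρ : ρ ∈ Ioo (-g.ε) g.ε) : VanishesOff g e (hat e hη * f) ρ (tsupport η) := by
  intro x hx
  by_cases hxe : x ∈ e.1.source
  · rw [toM_apply g e _ hρ hxe, SF.mul_apply, hat_chartPt, image_eq_zero_of_notMem_tsupport hx,
      zero_mul]
  · exact toM_of_notMem g e _ ρ hxe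

theorem d_hat_eq_zero {η : M → ℝ} (hη : JSmooth g fun _ => η) {ρ : ℝ} (hρ : ρ ∈ Ioo (-g.ε) g.ε)
    {x : M} (hx : x ∈ e.1.source) (hx0 : x ∉ tsupport η) (a : Fin n) :
    SF.d (dirc a) (hat e hη) (chartPt g e hρ hx) = 0 := by
  rw [d_hat_chartPt]
  have h1 : η ∘ e.1.symm =ᶠ[𝓝 (e.1 x)] fun _ => 0 := by
    have h2 : ∀ᶠ y in 𝓝 x, η y = 0 := by
      filter_upwards [(isClosed_tsupport η).isOpen_compl.mem_nhds hx0] with y hy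
      exact image_eq_zero_of_notMem_tsupport hy
    have h3 : Tendsto e.1.symm (𝓝 (e.1 x)) (𝓝 x) := by
      have := e.1.continuousAt_symm (e.1.map_source hx)
      rwa [ContinuousAt, e.1.left_inv hx] at this
    exact h3.eventually h2
  rw [h1.fderiv_eq]
  simp

theorem gradPair_vanishesOff (P : Matrix (Fin n) (Fin n) (SF (chartDom g e))) {η : M → ℝ}
    (hη : JSmooth g fun _ => η) (F : SF (chartDom g e)) {ρ : ℝ} (hρ : ρ ∈ Ioo (-g.ε) g.ε) :
    VanishesOff g e (gradPair g e P (hat e hη) F) ρ (tsupport η) := by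
  intro x hx
  by_cases hxe : x ∈ e.1.source
  · rw [toM_apply g e _ hρ hxe, gradPair_apply]
    have : (fun a => SF.d (dirc a) (hat e hη) (chartPt g e hρ hxe)) = 0 := by
      funext a
      exact d_hat_eq_zero g e hη hρ hxe hx a
    rw [this, zero_dotProduct]
  · exact toM_of_notMem g e _ ρ hxe

theorem toM_add (f h : SF (chartDom g e)) (ρ : ℝ) (hρ : ρ ∈ Ioo (-g.ε) g.ε) (x : M) :
    toM g e (f + h) ρ x = toM g e f ρ x + toM g e h ρ x := by
  by_cases hxe : x ∈ e.1.source
  · simp only [toM_apply g e _ hρ hxe, SF.add_apply]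
  · simp only [toM_of_notMem g e _ ρ hxe, add_zero]

theorem VanishesOff.add {f h : SF (chartDom g e)} {ρ : ℝ} (hρ : ρ ∈ Ioo (-g.ε) g.ε) {K : Set M}
    (hf : VanishesOff g e f ρ K) (hh : VanishesOff g e h ρ K) : VanishesOff g e (f + h) ρ K := by
  intro x hx
  rw [toM_add g e f h ρ hρ, hf x hx, hh x hx, add_zero]

variable [SecondCountableTopology M] [MeasurableSpace M] [BorelSpace M]

/-- The weak form avoids the transformation of second derivatives. Tested against `η` supported in
both charts, each side integrates to minus the integral of `gradPair`, which is independent of the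
chart, as is `μ`. Hence the two expressions agree almost everywhere, and by continuity everywhere,
since `μ` is positive on nonempty open sets. -/
theorem divForm_change {μ : Measure M} (hμ : IsVolumeMeasure (g.toFun 0) μ) {F : ℝ → M → ℝ}
    (hF : JSmooth g F) {ρ : ℝ} (hρ : ρ ∈ Ioo (-g.ε) g.ε) {x : M} (hx : x ∈ e.1.source)
    (hx' : x ∈ e'.1.source) :
    divForm g e (cometric g e) (hat e hF) (chartPt g e hρ hx)
      = divForm g e' (cometric g e') (hat e' hF) (chartPt g e' hρ hx') := by
  have := isLocallyFiniteMeasure g hμ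
  have := isOpenPosMeasure g hμ
  have : LocallyCompactSpace M := ChartedSpace.locallyCompactSpace (Eu n) M
  have hW : IsOpen (e.1.source ∩ e'.1.source) := e.1.open_source.inter e'.1.open_source
  let D : atlas (Eu n) M → M → ℝ := fun e => toM g e (divForm g e (cometric g e) (hat e hF)) ρ
  have hD : ∀ e, ContinuousOn (D e) e.1.source := fun e => continuousOn_toM g e _ hρ
  have hcont : ContinuousOn (fun y => D e y - D e' y) (e.1.source ∩ e'.1.source) :=
    ((hD e).mono inter_subset_left).sub ((hD e').mono inter_subset_right)
  have hae : ∀ᵐ y ∂μ, y ∈ e.1.source ∩ e'.1.source → D e y - D e' y = 0 := by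
    refine hW.ae_eq_zero_of_integral_contMDiff_smul_eq_zero (𝓡 n)
      (hcont.locallyIntegrableOn hW.measurableSet) fun η hη hηc hηs => ?_
    have hη' : JSmooth g fun _ => η := jSmooth_const hη
    -- A divergence by `divergence_mul`, hence of integral zero in either chart; the difference of
    -- the two is `η` times the discrepancy to be tested.
    let Q : ∀ e : atlas (Eu n) M, SF (chartDom g e) := fun e =>
      hat e hη' * divForm g e (cometric g e) (hat e hF)
        + gradPair g e (cometric g e) (hat e hη') (hat e hF)
    have hQv : ∀ e, VanishesOff g e (Q e) ρ (tsupport η) := fun e =>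
      VanishesOff.add g e hρ (toM_hat_mul_vanishesOff g e hη' _ hρ)
        (gradPair_vanishesOff g e _ hη' _ hρ)
    have hQ0 : ∀ e : atlas (Eu n) M, tsupport η ⊆ e.1.source →
        Integrable (toM g e (Q e) ρ) μ ∧ ∫ y, toM g e (Q e) ρ y ∂μ = 0 := by
      intro e hs
      refine ⟨(VanishesOff.continuous hρ hηc hs (hQv e)).integrable_of_hasCompactSupport
        (HasCompactSupport.intro hηc (hQv e)), ?_⟩
      change ∫ y, toM g e (hat e hη' * divForm g e (cometric g e) (hat e hF)
        + gradPair g e (cometric g e) (hat e hη') (hat e hF)) ρ y ∂μ = 0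
      rw [← divergence_mul]
      exact integral_divergence g e hμ _ hρ hηc hs fun a => toM_hat_mul_vanishesOff g e hη' _ hρ
    have h1 := hQ0 e (hηs.trans inter_subset_left)
    have h2 := hQ0 e' (hηs.trans inter_subset_right)
    have h3 : ∀ y, η y • (D e y - D e' y) = toM g e (Q e) ρ y - toM g e' (Q e') ρ y := by
      intro y
      by_cases hy : y ∈ tsupport η
      · have hye := (hηs hy).1
        have hye' := (hηs hy).2
        change η y • (toM g e _ ρ y - toM g e' _ ρ y) = _
        rw [toM_apply g e _ hρ hye, toM_apply g e' _ hρ hye', toM_apply g e _ hρ hye,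
          toM_apply g e' _ hρ hye', SF.add_apply, SF.add_apply, SF.mul_apply, SF.mul_apply,
          hat_chartPt, hat_chartPt, gradPair_change g e e' hη' hF hρ hye hye', smul_eq_mul]
        ring
      · rw [hQv e y hy, hQv e' y hy, image_eq_zero_of_notMem_tsupport hy, zero_smul, sub_zero]
    simp only [h3]
    rw [integral_sub h1.1 h2.1, h1.2, h2.2, sub_zero]
  have h0 : EqOn (fun y => D e y - D e' y) (fun _ => 0) (e.1.source ∩ e'.1.source) :=
    Measure.eqOn_open_of_ae_eq ((ae_restrict_iff' hW.measurableSet).2 hae) hW hcont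
      continuousOn_const
  have h1 := sub_eq_zero.1 (h0 ⟨hx, hx'⟩)
  change toM g e _ ρ x = toM g e' _ ρ x at h1
  rwa [toM_apply g e _ hρ hx, toM_apply g e' _ hρ hx'] at h1

theorem fullPot_change {μ : Measure M} (hμ : IsVolumeMeasure (g.toFun 0) μ) {ρ : ℝ}
    (hρ : ρ ∈ Ioo (-g.ε) g.ε) {x : M} (hx : x ∈ e.1.source) (hx' : x ∈ e'.1.source) :
    fullPot g e (chartPt g e hρ hx) = fullPot g e' (chartPt g e' hρ hx') := by
  simp only [fullPot, SF.sub_apply, SF.mul_apply, weightInv_chartPt, pot_change g e e' hρ hx hx']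
  rw [← hat_weight, ← hat_weight, divForm_change g e e' hμ (jSmooth_weight g) hρ hx hx']

/-- The preferred chart of `x` can now be replaced by a fixed chart, which makes `ℳ̃(ρ)` a
differential operator with coefficients smooth in `ρ` and `x` jointly. -/
theorem genM_eq_chartOp {μ : Measure M} (hμ : IsVolumeMeasure (g.toFun 0) μ) {F : ℝ → M → ℝ}
    (hF : JSmooth g F) {ρ : ℝ} (hρ : ρ ∈ Ioo (-g.ε) g.ε) {x : M} (hx : x ∈ e.1.source) :
    genM g ρ (F ρ) x = chartOp g e (hat e hF) (chartPt g e hρ hx) := by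
  rw [genM_chartA g (chartA x) (jSmooth_atParam hF hρ) hρ rfl (mem_chartA x), chartOp,
    SF.add_apply, SF.add_apply, SF.mul_apply, SF.mul_apply,
    divForm_change g (chartA x) e hμ _ hρ (mem_chartA x) hx, divForm_atParam,
    fullPot_change g (chartA x) e hμ hρ (mem_chartA x) hx, hat_chartPt, hat_chartPt]

end ChartIndependence

end OvsienkoRedou

/-! ### Taylor coefficients at `ρ = 0` -/

namespace OvsienkoRedou

open Finset

set_option linter.unusedSectionVars false

/-- The Leibniz rule in abstract form. It serves both for products of functions and for an operator
with variable coefficients applied to a function. -/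
theorem iterate_eq_sum_choose {S Φ : Type*} [AddCommMonoid S] [FunLike Φ S S]
    [AddMonoidHomClass Φ S S] (D : Φ) (f : ℕ → ℕ → S)
    (hf : ∀ a b, D (f a b) = f (a + 1) b + f a (b + 1)) (k : ℕ) :
    D^[k] (f 0 0) = ∑ p ∈ antidiagonal k, k.choose p.1 • f p.1 p.2 := by
  induction k with
  | zero => simp
  | succ k ih =>
    rw [Function.iterate_succ_apply', ih, map_sum, Finset.sum_antidiagonal_choose_succ_nsmul]
    simp only [map_nsmul, hf, smul_add, Finset.sum_add_distrib]
    rw [add_comm]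
    congr 1
    refine Finset.sum_congr rfl fun p hp => ?_
    rw [← mem_antidiagonal.1 hp, Nat.choose_symm_add]

section Jets

variable {n : ℕ} {M : Type*} [TopologicalSpace M]
  [ChartedSpace (EuclideanSpace ℝ (Fin n)) M] [IsManifold (𝓡 n) ∞ M]
  (g : MetricFamily n M) (e : atlas (Eu n) M)

theorem d_vol0Inv : SF.d dirρ (vol0Inv g e) = 0 :=
  d_eq_zero_of_mul_eq_one (vol0_mul_inv g e) (d_vol0 g e)

/-- The `ρ`-derivative commutes with the coordinate derivatives and does not see the density of
`g₀`. It thus acts on the coefficients and on `F` only, and the divergence form persists. -/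
theorem d_divForm (P : Matrix (Fin n) (Fin n) (SF (chartDom g e))) (F : SF (chartDom g e)) :
    SF.d dirρ (divForm g e P F)
      = divForm g e (P.map (SF.d dirρ)) F + divForm g e P (SF.d dirρ F) := by
  rw [divForm, divForm, divForm, d_mul_of_d_eq_zero (d_vol0Inv g e), ← mul_add,
    ← Finset.sum_add_distrib, map_sum]
  congr 1
  refine Finset.sum_congr rfl fun a _ => ?_
  rw [← Finset.sum_add_distrib, map_sum]
  refine Finset.sum_congr rfl fun b _ => ?_
  rw [SF.d_comm, mul_assoc, d_mul_of_d_eq_zero (d_vol0 g e), Derivation.leibniz (SF.d dirρ),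
    SF.d_comm dirρ, ← map_add]
  congr 1
  rw [Matrix.map_apply, smul_eq_mul, smul_eq_mul]
  ring

theorem divForm_add (P : Matrix (Fin n) (Fin n) (SF (chartDom g e))) (F H : SF (chartDom g e)) :
    divForm g e P (F + H) = divForm g e P F + divForm g e P H := by
  simp only [divForm, map_add, mul_add, Finset.sum_add_distrib]

theorem divForm_smul (P : Matrix (Fin n) (Fin n) (SF (chartDom g e))) (c : ℝ)
    (F : SF (chartDom g e)) : divForm g e P (c • F) = c • divForm g e P F := by
  simp only [divForm, Derivation.map_smul, mul_smul_comm]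
  simp only [← Finset.smul_sum, mul_smul_comm]

/-- The matrix of the `k`-th derivatives of the inverse metrics. -/
def cometricDeriv (k : ℕ) : Matrix (Fin n) (Fin n) (SF (chartDom g e)) :=
  (cometric g e).map (SF.d dirρ)^[k]

/-- The `k`-th derivative of the operators `ℳ̃(ρ)` with respect to `ρ` in a chart. -/
def chartOpDeriv (k : ℕ) (F : SF (chartDom g e)) : SF (chartDom g e) :=
  divForm g e (cometricDeriv g e k) F + (SF.d dirρ)^[k] (fullPot g e) * F

theorem d_chartOpDeriv (k : ℕ) (F : SF (chartDom g e)) :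
    SF.d dirρ (chartOpDeriv g e k F)
      = chartOpDeriv g e (k + 1) F + chartOpDeriv g e k (SF.d dirρ F) := by
  have h : cometricDeriv g e (k + 1) = (cometricDeriv g e k).map (SF.d dirρ) := by
    ext1 i j
    simp only [cometricDeriv, Matrix.map_apply, Function.iterate_succ_apply']
  simp only [chartOpDeriv, map_add, d_divForm, h, Derivation.leibniz, smul_eq_mul,
    Function.iterate_succ_apply']
  ring

theorem chartOpDeriv_add (k : ℕ) (F H : SF (chartDom g e)) :
    chartOpDeriv g e k (F + H) = chartOpDeriv g e k F + chartOpDeriv g e k H := by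
  simp only [chartOpDeriv, divForm_add]
  ring

theorem chartOpDeriv_smul (k : ℕ) (c : ℝ) (F : SF (chartDom g e)) :
    chartOpDeriv g e k (c • F) = c • chartOpDeriv g e k F := by
  simp only [chartOpDeriv, divForm_smul, smul_add, mul_smul_comm]

theorem iterate_d_chartOp (k : ℕ) (F : SF (chartDom g e)) :
    (SF.d dirρ)^[k] (chartOp g e F)
      = ∑ p ∈ antidiagonal k, k.choose p.1 • chartOpDeriv g e p.1 ((SF.d dirρ)^[p.2] F) := by
  refine iterate_eq_sum_choose (SF.d dirρ) (fun a b => chartOpDeriv g e a ((SF.d dirρ)^[b] F))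
    (fun a b => ?_) k
  rw [d_chartOpDeriv, Function.iterate_succ_apply']

theorem iterate_d_chartOp_of_d_eq_zero (k : ℕ) {F : SF (chartDom g e)} (hF : SF.d dirρ F = 0) :
    (SF.d dirρ)^[k] (chartOp g e F) = chartOpDeriv g e k F := by
  rw [iterate_d_chartOp, Finset.sum_eq_single (k, 0)]
  · simp
  · intro p hp hne
    obtain ⟨b, hb⟩ : ∃ b, p.2 = b + 1 := by
      refine Nat.exists_eq_succ_of_ne_zero fun h0 => hne ?_
      have := mem_antidiagonal.1 hp
      exact Prod.ext (by dsimp only; omega) h0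
    have h1 : chartOpDeriv g e p.1 (0 : SF (chartDom g e)) = 0 := by
      have := chartOpDeriv_smul g e p.1 0 (0 : SF (chartDom g e))
      rwa [zero_smul, zero_smul] at this
    rw [hb, Function.iterate_succ_apply, hF, iterate_map_zero, h1, smul_zero]
  · intro h
    exact absurd (mem_antidiagonal.2 (add_zero k)) h

theorem d_rho : SF.d dirρ (rho g e) = 1 := by
  ext p
  rw [rho, SF.d_mk]
  change fderiv ℝ Prod.fst _ _ = _
  rw [fderiv_fst]
  rfl

theorem iterate_d_smul (k : ℕ) (c : ℝ) (F : SF (chartDom g e)) :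
    (SF.d dirρ)^[k] (c • F) = c • (SF.d dirρ)^[k] F := by
  induction k generalizing F with
  | zero => rfl
  | succ k ih =>
    rw [Function.iterate_succ_apply, Derivation.map_smul, ih, Function.iterate_succ_apply]

theorem iterate_d_rho_mul (k : ℕ) (F : SF (chartDom g e)) :
    (SF.d dirρ)^[k + 1] (rho g e * F)
      = rho g e * (SF.d dirρ)^[k + 1] F + ((k : ℝ) + 1) • (SF.d dirρ)^[k] F := by
  induction k generalizing F with
  | zero =>
    simp [Derivation.leibniz, d_rho]
  | succ k ih =>
    rw [Function.iterate_succ_apply', ih, map_add, Derivation.leibniz, d_rho, Derivation.map_smul,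
      ← Function.iterate_succ_apply' (SF.d dirρ) k, ← Function.iterate_succ_apply' (SF.d dirρ),
      smul_eq_mul, smul_eq_mul, mul_one]
    push_cast
    module

variable {g}

theorem jSmooth_of_chart {F : ℝ → M → ℝ} (f : ∀ e : atlas (Eu n) M, SF (chartDom g e))
    (h : ∀ (e : atlas (Eu n) M) (ρ : ℝ) (hρ : ρ ∈ Set.Ioo (-g.ε) g.ε) (x : M)
      (hx : x ∈ e.1.source), F ρ x = f e (chartPt g e hρ hx)) : JSmooth g F := fun e => by
  refine (contDiffOn_extZero_iff fun p => ?_).1 (SF.smoothOn (f e))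
  obtain ⟨ρ, hρ, x, hx, rfl⟩ := exists_eq_chartPt g e p
  rw [← h e ρ hρ x hx]
  exact congrArg (F ρ) (e.1.left_inv hx).symm

theorem hat_eq {F : ℝ → M → ℝ} (hF : JSmooth g F) {f : SF (chartDom g e)}
    (h : ∀ (ρ : ℝ) (hρ : ρ ∈ Set.Ioo (-g.ε) g.ε) (x : M) (hx : x ∈ e.1.source),
      F ρ x = f (chartPt g e hρ hx)) : hat e hF = f := by
  ext p
  obtain ⟨ρ, hρ, x, hx, rfl⟩ := exists_eq_chartPt g e p
  rw [hat_chartPt, h ρ hρ x hx]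

theorem deriv_param_chartPt {F : ℝ → M → ℝ} (hF : JSmooth g F) {ρ : ℝ}
    (hρ : ρ ∈ Set.Ioo (-g.ε) g.ε) {x : M} (hx : x ∈ e.1.source) :
    deriv (fun s => F s x) ρ = SF.d dirρ (hat e hF) (chartPt g e hρ hx) :=
  (d_param_chartPt g e (hat e hF) hρ hx fun _ hs => hat_chartPt e hF hs hx).deriv

theorem jSmooth_deriv {F : ℝ → M → ℝ} (hF : JSmooth g F) :
    JSmooth g fun ρ x => deriv (fun s => F s x) ρ :=
  jSmooth_of_chart (fun e => SF.d dirρ (hat e hF)) fun e _ hρ _ hx =>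
    deriv_param_chartPt e hF hρ hx

theorem hat_deriv {F : ℝ → M → ℝ} (hF : JSmooth g F) :
    hat e (jSmooth_deriv hF) = SF.d dirρ (hat e hF) :=
  hat_eq e _ fun _ hρ _ hx => deriv_param_chartPt e hF hρ hx

theorem iteratedDeriv_param_chartPt {F : ℝ → M → ℝ} (hF : JSmooth g F) (k : ℕ) {ρ : ℝ}
    (hρ : ρ ∈ Set.Ioo (-g.ε) g.ε) {x : M} (hx : x ∈ e.1.source) :
    iteratedDeriv k (fun s => F s x) ρ = (SF.d dirρ)^[k] (hat e hF) (chartPt g e hρ hx) := by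
  induction k generalizing F with
  | zero => rw [iteratedDeriv_zero, Function.iterate_zero, id, hat_chartPt]
  | succ k ih => rw [iteratedDeriv_succ', ih (jSmooth_deriv hF), hat_deriv,
      Function.iterate_succ_apply]

theorem jSmooth_iteratedDeriv {F : ℝ → M → ℝ} (hF : JSmooth g F) (k : ℕ) :
    JSmooth g fun ρ x => iteratedDeriv k (fun s => F s x) ρ :=
  jSmooth_of_chart (fun e => (SF.d dirρ)^[k] (hat e hF)) fun e _ hρ _ hx =>
    iteratedDeriv_param_chartPt e hF k hρ hx

theorem hat_iteratedDeriv {F : ℝ → M → ℝ} (hF : JSmooth g F) (k : ℕ) :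
    hat e (jSmooth_iteratedDeriv hF k) = (SF.d dirρ)^[k] (hat e hF) :=
  hat_eq e _ fun _ hρ _ hx => iteratedDeriv_param_chartPt e hF k hρ hx

theorem jSmooth_mul {F H : ℝ → M → ℝ} (hF : JSmooth g F) (hH : JSmooth g H) :
    JSmooth g fun ρ x => F ρ x * H ρ x := fun e => ContDiffOn.mul (hF e) (hH e)

theorem jSmooth_add {F H : ℝ → M → ℝ} (hF : JSmooth g F) (hH : JSmooth g H) :
    JSmooth g fun ρ x => F ρ x + H ρ x := fun e => ContDiffOn.add (hF e) (hH e)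

variable (g) in
/-- The algebra of functions on `M` that are smooth in the charts. -/
def smoothAlg : Subalgebra ℝ (M → ℝ) where
  carrier := {u | JSmooth g fun _ => u}
  mul_mem' {u v} (hu : JSmooth g fun _ => u) (hv : JSmooth g fun _ => v) := jSmooth_mul hu hv
  add_mem' {u v} (hu : JSmooth g fun _ => u) (hv : JSmooth g fun _ => v) := jSmooth_add hu hv
  algebraMap_mem' _ _ := contDiffOn_const

theorem jSmooth_coe (u : smoothAlg g) : JSmooth g fun _ => (u : M → ℝ) := u.2

/-- The Taylor coefficients at `ρ = 0` in powers of `-ρ / 2`. -/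
def jet {F : ℝ → M → ℝ} (hF : JSmooth g F) (k : ℕ) : smoothAlg g :=
  ((-2) ^ k / (k.factorial : ℝ)) • ⟨fun x => iteratedDeriv k (fun s => F s x) 0,
    jSmooth_atParam (jSmooth_iteratedDeriv hF k) (zero_mem_Ioo g)⟩

theorem jet_apply {F : ℝ → M → ℝ} (hF : JSmooth g F) (k : ℕ) {x : M} (hx : x ∈ e.1.source) :
    (jet hF k : M → ℝ) x = (-2) ^ k / (k.factorial : ℝ) *
      (SF.d dirρ)^[k] (hat e hF) (chartPt g e (zero_mem_Ioo g) hx) := by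
  rw [← iteratedDeriv_param_chartPt]
  rfl

theorem jet_zero_apply {F : ℝ → M → ℝ} (hF : JSmooth g F) (x : M) :
    (jet hF 0 : M → ℝ) x = F 0 x := by
  rw [jet_apply (chartA x) hF 0 (mem_chartA x), Function.iterate_zero, id, hat_chartPt]
  simp

theorem jet_const {u : M → ℝ} (hu : JSmooth g fun _ => u) :
    jet hu = jetConst (⟨u, hu⟩ : smoothAlg g) := by
  funext k
  refine Subtype.ext (funext fun x => ?_)
  cases k with
  | zero => exact jet_zero_apply hu x
  | succ k =>
    rw [jet_apply (chartA x) hu _ (mem_chartA x), Function.iterate_succ_apply, d_hat_const,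
      iterate_map_zero, SF.zero_apply, mul_zero]
    rfl

/-- Division by `k!` turns the binomial coefficients of the Leibniz rule into the Cauchy product;
the powers of `-2` are multiplicative. -/
theorem jet_mul {F H : ℝ → M → ℝ} (hF : JSmooth g F) (hH : JSmooth g H) :
    jet (jSmooth_mul hF hH) = cauchy (jet hF) (jet hH) := by
  funext k
  refine Subtype.ext (funext fun x => ?_)
  let e : atlas (Eu n) M := chartA x
  have hx : x ∈ e.1.source := mem_chartA x
  have h1 : hat e (jSmooth_mul hF hH) = hat e hF * hat e hH := rfl
  have h2 := iterate_eq_sum_choose (SF.d dirρ)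
    (fun a b => (SF.d dirρ)^[a] (hat e hF) * (SF.d dirρ)^[b] (hat e hH)) (fun a b => by
      rw [Derivation.leibniz, Function.iterate_succ_apply', Function.iterate_succ_apply',
        smul_eq_mul, smul_eq_mul]
      ring) k
  simp only [Function.iterate_zero, id] at h2
  rw [jet_apply e _ _ hx, h1, h2, cauchy, SF.sum_apply, AddSubmonoidClass.coe_finsetSum,
    Finset.sum_apply, Finset.mul_sum]
  refine Finset.sum_congr rfl fun p hp => ?_
  have hk : p.1 + p.2 = k := mem_antidiagonal.1 hp
  have h3 : ((jet hF p.1 * jet hH p.2 : smoothAlg g) : M → ℝ) x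
      = (jet hF p.1 : M → ℝ) x * (jet hH p.2 : M → ℝ) x := rfl
  rw [h3, jet_apply e _ _ hx, jet_apply e _ _ hx, ← Nat.cast_smul_eq_nsmul ℝ, SF.smul_apply,
    SF.mul_apply, ← hk, Nat.cast_add_choose, pow_add]
  field_simp

variable [T2Space M] [SecondCountableTopology M] [MeasurableSpace M] [BorelSpace M]
  {μ : MeasureTheory.Measure M} (hμ : IsVolumeMeasure (g.toFun 0) μ)

theorem jSmooth_genM (hμ : IsVolumeMeasure (g.toFun 0) μ) {F : ℝ → M → ℝ} (hF : JSmooth g F) :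
    JSmooth g fun ρ => genM g ρ (F ρ) :=
  jSmooth_of_chart (fun e => chartOp g e (hat e hF)) fun e _ hρ _ hx =>
    genM_eq_chartOp g e hμ hF hρ hx

theorem hat_genM (hμ : IsVolumeMeasure (g.toFun 0) μ) {F : ℝ → M → ℝ} (hF : JSmooth g F) :
    hat e (jSmooth_genM hμ hF) = chartOp g e (hat e hF) :=
  hat_eq e _ fun _ hρ _ hx => genM_eq_chartOp g e hμ hF hρ hx

theorem opM_eq_chartOpDeriv (hμ : IsVolumeMeasure (g.toFun 0) μ) (N : ℕ) {u : M → ℝ}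
    (hu : JSmooth g fun _ => u) {x : M} (hx : x ∈ e.1.source) :
    opM g N u x = (N.factorial : ℝ) * (-2) ^ N *
      chartOpDeriv g e N (hat e hu) (chartPt g e (zero_mem_Ioo g) hx) := by
  rw [opM, iteratedDeriv_param_chartPt e (jSmooth_genM hμ hu) N (zero_mem_Ioo g) hx,
    hat_genM e hμ hu,    iterate_d_chartOp_of_d_eq_zero g e N (d_hat_const e hu)]

theorem jSmooth_opM (hμ : IsVolumeMeasure (g.toFun 0) μ) (N : ℕ) {u : M → ℝ}
    (hu : JSmooth g fun _ => u) : JSmooth g fun _ => opM g N u :=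
  jSmooth_of_chart (fun e => ((N.factorial : ℝ) * (-2) ^ N) •
    atZero g e (chartOpDeriv g e N (hat e hu))) fun e _ hρ _ hx => by
      rw [opM_eq_chartOpDeriv e hμ N hu hx, SF.smul_apply, atZero_apply]
      rfl

/-- The operators `ℳ_{2(N+1)}` as linear maps. -/
def opMLin (hμ : IsVolumeMeasure (g.toFun 0) μ) (N : ℕ) : smoothAlg g →ₗ[ℝ] smoothAlg g where
  toFun u := ⟨opM g N u, jSmooth_opM hμ N (jSmooth_coe u)⟩
  map_add' u v := Subtype.ext <| funext fun x => by
    have h : hat (chartA x) (jSmooth_coe (u + v)) =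
        hat (chartA x) (jSmooth_coe u) + hat (chartA x) (jSmooth_coe v) := rfl
    change opM g N _ x = opM g N _ x + opM g N _ x
    rw [opM_eq_chartOpDeriv (chartA x) hμ N (jSmooth_coe (u + v)) (mem_chartA x),
      opM_eq_chartOpDeriv (chartA x) hμ N (jSmooth_coe u) (mem_chartA x),
      opM_eq_chartOpDeriv (chartA x) hμ N (jSmooth_coe v) (mem_chartA x), h, chartOpDeriv_add,
      SF.add_apply,
      mul_add]
  map_smul' c u := Subtype.ext <| funext fun x => by
    have h : hat (chartA x) (jSmooth_coe (c • u)) = c • hat (chartA x) (jSmooth_coe u) := rfl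
    change opM g N _ x = c * opM g N _ x
    rw [opM_eq_chartOpDeriv (chartA x) hμ N (jSmooth_coe (c • u)) (mem_chartA x),
      opM_eq_chartOpDeriv (chartA x) hμ N (jSmooth_coe u) (mem_chartA x), h, chartOpDeriv_smul,
      SF.smul_apply]
    ring

theorem coe_compList_opMLin (A : List ℕ) (u : smoothAlg g) :
    ((compList (opMLin hμ) A u : smoothAlg g) : M → ℝ) = opMList g A u := by
  induction A generalizing u with
  | nil => rfl
  | cons a A ih => rw [compList_cons, ih]; rfl

theorem opMLin_jet (a b : ℕ) {F : ℝ → M → ℝ} (hF : JSmooth g F) {x : M} (hx : x ∈ e.1.source) :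
    (opMLin hμ a (jet hF b) : M → ℝ) x = (a.factorial : ℝ) * (-2) ^ (a + b) / (b.factorial : ℝ) *
      chartOpDeriv g e a ((SF.d dirρ)^[b] (hat e hF)) (chartPt g e (zero_mem_Ioo g) hx) := by
  have h0 := jSmooth_atParam (jSmooth_iteratedDeriv hF b) (zero_mem_Ioo g)
  have h2 : divForm g e (cometricDeriv g e a) (hat e h0) (chartPt g e (zero_mem_Ioo g) hx) = _ :=
    divForm_atParam g e (cometricDeriv g e a) (jSmooth_iteratedDeriv hF b) (zero_mem_Ioo g) hx
  have h1 : (opMLin hμ a (jet hF b) : M → ℝ) x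
      = ((-2) ^ b / (b.factorial : ℝ)) * opM g a (fun x => iteratedDeriv b (fun s => F s x) 0) x := by
    rw [jet, map_smul]
    rfl
  rw [h1, opM_eq_chartOpDeriv e hμ a h0 hx, chartOpDeriv, chartOpDeriv, SF.add_apply, SF.add_apply,
    SF.mul_apply, SF.mul_apply, h2, ← hat_iteratedDeriv, hat_chartPt, hat_chartPt,
    pow_add]
  ring

theorem jSmooth_opR (hμ : IsVolumeMeasure (g.toFun 0) μ) (j : ℝ) {F : ℝ → M → ℝ}
    (hF : JSmooth g F) : JSmooth g (opR g j F) :=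
  jSmooth_of_chart (fun e => (-2 : ℝ) • (rho g e * (SF.d dirρ)^[2] (hat e hF))
    + (2 * j) • SF.d dirρ (hat e hF) + chartOp g e (hat e hF)) fun e ρ hρ x hx => by
      rw [opR, iteratedDeriv_param_chartPt e hF 2 hρ hx, deriv_param_chartPt e hF hρ hx,
        genM_eq_chartOp g e hμ hF hρ hx]
      simp only [SF.add_apply, SF.smul_apply, SF.mul_apply, rho_chartPt, mul_assoc]

theorem hat_opR (j : ℝ) {F : ℝ → M → ℝ} (hF : JSmooth g F) :
    hat e (jSmooth_opR hμ j hF) = (-2 : ℝ) • (rho g e * (SF.d dirρ)^[2] (hat e hF))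
      + (2 * j) • SF.d dirρ (hat e hF) + chartOp g e (hat e hF) :=
  hat_eq e _ fun ρ hρ x hx => by
    rw [opR, iteratedDeriv_param_chartPt e hF 2 hρ hx, deriv_param_chartPt e hF hρ hx,
      genM_eq_chartOp g e hμ hF hρ hx]
    simp only [SF.add_apply, SF.smul_apply, SF.mul_apply, rho_chartPt, mul_assoc]

theorem iterate_d_rho_mul_chartPt (k : ℕ) (F : SF (chartDom g e)) {x : M} (hx : x ∈ e.1.source) :
    (SF.d dirρ)^[k] (rho g e * SF.d dirρ F) (chartPt g e (zero_mem_Ioo g) hx)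
      = k * (SF.d dirρ)^[k] F (chartPt g e (zero_mem_Ioo g) hx) := by
  cases k with
  | zero =>
    rw [Function.iterate_zero, id, SF.mul_apply, rho_chartPt, Nat.cast_zero, zero_mul, zero_mul]
  | succ k =>
    rw [iterate_d_rho_mul, SF.add_apply, SF.mul_apply, rho_chartPt, SF.smul_apply,
      zero_mul, zero_add, Nat.cast_succ]
    rfl

/-- The passage to formal power series: with `s = -ρ/2` one has `-2ρ ∂_ρ² = s ∂_s²` and `2j ∂_ρ = -j
∂_s`. The normalization of `ℳ_{2(N+1)}` yields the factor `1/N!²` in the remaining terms. -/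
theorem jet_opR (j : ℝ) {F : ℝ → M → ℝ} (hF : JSmooth g F) :
    jet (jSmooth_opR hμ j hF) = jetR (opMLin hμ) j (jet hF) := by
  funext k
  refine Subtype.ext (funext fun x => ?_)
  let e : atlas (Eu n) M := chartA x
  have hx : x ∈ e.1.source := mem_chartA x
  have h1 : ((jetR (opMLin hμ) j (jet hF) k : smoothAlg g) : M → ℝ) x
      = ((k : ℝ) + 1) * (k - j) * (jet hF (k + 1) : M → ℝ) x
        + ∑ p ∈ antidiagonal k, 1 / (p.1.factorial : ℝ) ^ 2 *
          (opMLin hμ p.1 (jet hF p.2) : M → ℝ) x := by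
    rw [jetR, AddMemClass.coe_add, AddSubmonoidClass.coe_finsetSum, Pi.add_apply,
      Finset.sum_apply]
    rfl
  rw [h1, jet_apply e _ _ hx, jet_apply e _ _ hx, hat_opR e hμ j hF, iterate_map_add,
    iterate_map_add,
    iterate_d_smul, iterate_d_smul, Function.iterate_succ_apply (SF.d dirρ) 1, iterate_d_chartOp,
    SF.add_apply, SF.add_apply,
    SF.smul_apply, SF.smul_apply, SF.sum_apply, mul_add, Function.iterate_one,
    iterate_d_rho_mul_chartPt, ← Function.iterate_succ_apply]
  congr 1
  · rw [Nat.factorial_succ]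
    push_cast
    field_simp
    ring
  · rw [Finset.mul_sum]
    refine Finset.sum_congr rfl fun p hp => ?_
    have hk : p.1 + p.2 = k := mem_antidiagonal.1 hp
    rw [opMLin_jet e hμ _ _ hF hx, ← Nat.cast_smul_eq_nsmul ℝ, SF.smul_apply, ← hk,
      Nat.cast_add_choose]
    field_simp

theorem jSmooth_opDTilde (hμ : IsVolumeMeasure (g.toFun 0) μ) (m : ℕ) (L : ℝ) {F : ℝ → M → ℝ}
    (hF : JSmooth g F) : JSmooth g (opDTilde g m L F) := by
  induction m with
  | zero => exact hF
  | succ m ih => exact jSmooth_opR hμ _ ih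

theorem jet_opDTilde (m : ℕ) (L : ℝ) {F : ℝ → M → ℝ} (hF : JSmooth g F) :
    jet (jSmooth_opDTilde hμ m L hF) = jetD (opMLin hμ) m L (jet hF) := by
  induction m with
  | zero => rfl
  | succ m ih => exact (jet_opR hμ _ _).trans (congrArg _ ih)

theorem opDTriple_eq_jetTriple (L : ℝ) (a b c : ℕ) (u v : smoothAlg g) (x : M) :
    opDTriple g c (-L + 2 * c) a L b L u v x
      = ((jetTriple (opMLin hμ) L a b c u v : smoothAlg g) : M → ℝ) x := by
  have hu := jSmooth_opDTilde hμ a L (jSmooth_coe u)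
  have hv := jSmooth_opDTilde hμ b L (jSmooth_coe v)
  rw [opDTriple, ← jet_zero_apply (jSmooth_opDTilde hμ c (-L + 2 * c) (jSmooth_mul hu hv)),
    jet_opDTilde hμ c _ (jSmooth_mul hu hv), jet_mul hu hv, jet_opDTilde hμ a L (jSmooth_coe u),
    jet_opDTilde hμ b L (jSmooth_coe v), jet_const, jet_const]
  rfl

theorem opD_eq_coe {U : ℕ} {L : ℝ} (hL : ∀ m : ℕ, 1 ≤ m → 2 * m ≤ U → L ≠ m)
    (u v : smoothAlg g) :
    opD g U 0 L 0 0 u v = ((∑ A ∈ seqTriples U,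
      regularValue (fun z => juhlCoeff U z A.1 A.2.1 A.2.2) L •
        compList (opMLin hμ) A.1 (compList (opMLin hμ) A.2.1 u * compList (opMLin hμ) A.2.2 v) :
      smoothAlg g) : M → ℝ) := by
  funext x
  have h := eval_sum_jetTriple_eq_juhl (opMLin hμ)
    ((LinearMap.proj x).comp (smoothAlg g).val.toLinearMap) hL u v
  rw [AddSubmonoidClass.coe_finsetSum, Finset.sum_apply]
  refine Eq.trans (Finset.sum_congr rfl fun p _ => ?_) h
  rw [Nat.cast_zero, sub_zero, sub_zero]
  exact congrArg _ (opDTriple_eq_jetTriple hμ L p.1 p.2.1 p.2.2 u v x)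

theorem opD_eq_sum_opMList (hμ : IsVolumeMeasure (g.toFun 0) μ) {U : ℕ} {L : ℝ}
    (hL : ∀ m : ℕ, 1 ≤ m → 2 * m ≤ U → L ≠ m) {u v : M → ℝ} (hu : JSmooth g fun _ => u)
    (hv : JSmooth g fun _ => v) (x : M) :
    opD g U 0 L 0 0 u v x =
      ∑ A ∈ seqTriples U, regularValue (fun z => juhlCoeff U z A.1 A.2.1 A.2.2) L *
        opMList g A.1 (fun y => opMList g A.2.1 u y * opMList g A.2.2 v y) x := by
  rw [opD_eq_coe hμ hL ⟨u, hu⟩ ⟨v, hv⟩, AddSubmonoidClass.coe_finsetSum, Finset.sum_apply]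
  refine Finset.sum_congr rfl fun A _ => ?_
  have h : ∀ (c : ℝ) (w : smoothAlg g), ((c • w : smoothAlg g) : M → ℝ) x = c * (w : M → ℝ) x :=
    fun _ _ => rfl
  rw [h, coe_compList_opMLin, Subalgebra.coe_mul, coe_compList_opMLin, coe_compList_opMLin]
  rfl

end Jets

end OvsienkoRedou

/-! ### Formal self-adjointness -/

namespace OvsienkoRedou

open Set MeasureTheory

set_option linter.unusedSectionVars false

section SelfAdjoint

variable {n : ℕ} {M : Type*} [TopologicalSpace M]
  [ChartedSpace (EuclideanSpace ℝ (Fin n)) M] [IsManifold (𝓡 n) ∞ M]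
  (g : MetricFamily n M) (e : atlas (Eu n) M)

/-- The function vanishes at all points of the chart outside `K`. -/
def ZeroOff (K : Set M) (f : SF (chartDom g e)) : Prop :=
  ∀ p : chartDom g e, e.1.symm p.1.2 ∉ K → f p = 0

variable {g e}

theorem ZeroOff.mul_left {K : Set M} {f : SF (chartDom g e)} (hf : ZeroOff g e K f)
    (h : SF (chartDom g e)) : ZeroOff g e K (h * f) := fun p hp => by
  rw [SF.mul_apply, hf p hp, mul_zero]

theorem ZeroOff.mul_right {K : Set M} {f : SF (chartDom g e)} (hf : ZeroOff g e K f)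
    (h : SF (chartDom g e)) : ZeroOff g e K (f * h) := fun p hp => by
  rw [SF.mul_apply, hf p hp, zero_mul]

theorem ZeroOff.add {K : Set M} {f h : SF (chartDom g e)} (hf : ZeroOff g e K f)
    (hh : ZeroOff g e K h) : ZeroOff g e K (f + h) := fun p hp => by
  rw [SF.add_apply, hf p hp, hh p hp, add_zero]

theorem ZeroOff.sub {K : Set M} {f h : SF (chartDom g e)} (hf : ZeroOff g e K f)
    (hh : ZeroOff g e K h) : ZeroOff g e K (f - h) := fun p hp => by
  rw [SF.sub_apply, hf p hp, hh p hp, sub_zero]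

theorem ZeroOff.sum {ι : Type*} {K : Set M} {s : Finset ι} {f : ι → SF (chartDom g e)}
    (hf : ∀ i ∈ s, ZeroOff g e K (f i)) : ZeroOff g e K (∑ i ∈ s, f i) := fun p hp => by
  rw [SF.sum_apply]
  exact Finset.sum_eq_zero fun i hi => hf i hi p hp

theorem ZeroOff.d {K : Set M} (hK : IsClosed K) {f : SF (chartDom g e)} (hf : ZeroOff g e K f)
    (v : ℝ × Eu n) : ZeroOff g e K (SF.d v f) := by
  intro p hp
  have h : extZero f =ᶠ[𝓝 (p : ℝ × Eu n)] fun _ => 0 := by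
    filter_upwards [(isOpen_Ioo.prod (e.1.isOpen_inter_preimage_symm hK.isOpen_compl)).mem_nhds
      (show (p : ℝ × Eu n) ∈ Ioo (-g.ε) g.ε ×ˢ _ from ⟨p.2.1, p.2.2, hp⟩)] with q hq
    exact (extZero_apply f ⟨q, hq.1, hq.2.1⟩).trans (hf _ hq.2.2)
  rw [SF.d_apply, h.fderiv_eq]
  simp

theorem zeroOff_hat {u : M → ℝ} (hu : JSmooth g fun _ => u) :
    ZeroOff g e (tsupport u) (hat e hu) := fun p hp => by
  rw [hat_apply, image_eq_zero_of_notMem_tsupport hp]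

theorem ZeroOff.chartOpDeriv {K : Set M} (hK : IsClosed K) {f : SF (chartDom g e)}
    (hf : ZeroOff g e K f) (N : ℕ) : ZeroOff g e K (chartOpDeriv g e N f) :=
  ((ZeroOff.sum fun a _ => ZeroOff.sum fun b _ =>
    ((hf.d hK (dirc b)).mul_left _).d hK (dirc a)).mul_left _).add (hf.mul_left _)

theorem ZeroOff.vanishesOff {K : Set M} {f : SF (chartDom g e)} (hf : ZeroOff g e K f) {ρ : ℝ}
    (hρ : ρ ∈ Ioo (-g.ε) g.ε) : VanishesOff g e f ρ K := by
  intro x hx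
  by_cases hxe : x ∈ e.1.source
  · rw [toM_apply g e _ hρ hxe]
    refine hf _ ?_
    change e.1.symm (e.1 x) ∉ K
    rwa [e.1.left_inv hxe]
  · exact toM_of_notMem g e _ ρ hxe

theorem gradPair_comm {P : Matrix (Fin n) (Fin n) (SF (chartDom g e))}
    (hP : ∀ a b, P a b = P b a) (f h : SF (chartDom g e)) :
    gradPair g e P f h = gradPair g e P h f := by
  rw [gradPair, gradPair, Finset.sum_comm]
  refine Finset.sum_congr rfl fun a _ => Finset.sum_congr rfl fun b _ => ?_
  rw [hP]
  ring

theorem cometricDeriv_symm (N : ℕ) (a b : Fin n) :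
    cometricDeriv g e N a b = cometricDeriv g e N b a := by
  rw [cometricDeriv, Matrix.map_apply, Matrix.map_apply, cometric_symm]

/-- In the difference the potentials cancel, and so do the gradient terms because the derivatives of
the inverse metric are symmetric. A divergence with respect to the density of `g₀` is left. -/
theorem green_identity (N : ℕ) (η F : SF (chartDom g e)) :
    η * chartOpDeriv g e N F - F * chartOpDeriv g e N η
      = vol0Inv g e * ∑ a, SF.d (dirc a)
        (η * ∑ b, vol0 g e * cometricDeriv g e N a b * SF.d (dirc b) F
          - F * ∑ b, vol0 g e * cometricDeriv g e N a b * SF.d (dirc b) η) := by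
  have h1 := divergence_mul g e (cometricDeriv g e N) η F
  have h2 := divergence_mul g e (cometricDeriv g e N) F η
  rw [gradPair_comm (cometricDeriv_symm N)] at h2
  simp only [map_sub, Finset.sum_sub_distrib, mul_sub, h1, h2, chartOpDeriv]
  ring

theorem continuous_of_jSmooth {u : M → ℝ} (hu : JSmooth g fun _ => u) : Continuous u := by
  refine continuous_iff_continuousAt.2 fun x => ?_
  have h := continuousOn_toM g (chartA x) (hat (chartA x) hu) (zero_mem_Ioo g)
  refine ContinuousOn.continuousAt (h.congr fun y hy => ?_)
    ((chartA x).1.open_source.mem_nhds (mem_chartA x))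
  rw [toM_apply g _ _ (zero_mem_Ioo g) hy, hat_chartPt]

variable [T2Space M] [SecondCountableTopology M] [MeasurableSpace M] [BorelSpace M]
  {μ : Measure M}

theorem opM_eq_zero (hμ : IsVolumeMeasure (g.toFun 0) μ) (N : ℕ) {u : M → ℝ}
    (hu : JSmooth g fun _ => u) {x : M} (hx : x ∉ tsupport u) : opM g N u x = 0 := by
  have h := ((zeroOff_hat (e := chartA x) hu).chartOpDeriv (isClosed_tsupport u) N).vanishesOff
    (zero_mem_Ioo g)
  rw [opM_eq_chartOpDeriv (chartA x) hμ N hu (mem_chartA x),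
    ← toM_apply g (chartA x) _ (zero_mem_Ioo g) (mem_chartA x), h x hx, mul_zero]

theorem hasCompactSupport_opM (hμ : IsVolumeMeasure (g.toFun 0) μ) (N : ℕ) {u : M → ℝ}
    (hu : JSmooth g fun _ => u) (hc : HasCompactSupport u) : HasCompactSupport (opM g N u) :=
  HasCompactSupport.intro hc fun _ hx => opM_eq_zero hμ N hu hx

theorem integrable_coe (hμ : IsVolumeMeasure (g.toFun 0) μ) {f : smoothAlg g}
    (hf : HasCompactSupport (f : M → ℝ)) : Integrable (f : M → ℝ) μ := by
  have := isLocallyFiniteMeasure g hμ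
  exact (continuous_of_jSmooth (jSmooth_coe f)).integrable_of_hasCompactSupport hf

theorem integral_mul_opM_of_subset (hμ : IsVolumeMeasure (g.toFun 0) μ) (N : ℕ)
    {η u : smoothAlg g} (hc : HasCompactSupport (η : M → ℝ))
    (hs : tsupport (η : M → ℝ) ⊆ e.1.source) :
    ∫ x, ((η * opMLin hμ N u : smoothAlg g) : M → ℝ) x ∂μ
      = ∫ x, ((u * opMLin hμ N η : smoothAlg g) : M → ℝ) x ∂μ := by
  have hη' := jSmooth_coe η
  have hu' := jSmooth_coe u
  have hz : ZeroOff g e (tsupport (η : M → ℝ)) (hat e hη') := zeroOff_hat hη'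
  have h1 : Integrable ((η * opMLin hμ N u : smoothAlg g) : M → ℝ) μ :=
    integrable_coe hμ (HasCompactSupport.mul_right hc)
  have h2 : Integrable ((u * opMLin hμ N η : smoothAlg g) : M → ℝ) μ :=
    integrable_coe hμ (HasCompactSupport.mul_left (hasCompactSupport_opM hμ N hη' hc))
  have h3 : ∀ x, ((η * opMLin hμ N u : smoothAlg g) : M → ℝ) x
      - ((u * opMLin hμ N η : smoothAlg g) : M → ℝ) x
      = (N.factorial : ℝ) * (-2) ^ N * toM g e (vol0Inv g e * ∑ a, SF.d (dirc a)
        (hat e hη' * ∑ b, vol0 g e * cometricDeriv g e N a b * SF.d (dirc b) (hat e hu')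
          - hat e hu' * ∑ b, vol0 g e * cometricDeriv g e N a b * SF.d (dirc b) (hat e hη'))) 0 x := by
    intro x
    change (η : M → ℝ) x * opM g N u x - (u : M → ℝ) x * opM g N η x = _
    by_cases hx : x ∈ e.1.source
    · rw [← green_identity, toM_apply g e _ (zero_mem_Ioo g) hx, SF.sub_apply, SF.mul_apply,
        SF.mul_apply, hat_chartPt, hat_chartPt, opM_eq_chartOpDeriv e hμ N hη' hx,
        opM_eq_chartOpDeriv e hμ N hu' hx]
      ring
    · have hx' : x ∉ tsupport (η : M → ℝ) := fun h => hx (hs h)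
      rw [toM_of_notMem g e _ _ hx, opM_eq_zero hμ N hη' hx', image_eq_zero_of_notMem_tsupport hx']
      ring
  -- The difference of the integrands is a constant times a divergence supported in `tsupport η`, a
  -- compact subset of the chart.
  rw [← sub_eq_zero, ← integral_sub h1 h2, integral_congr_ae (Filter.Eventually.of_forall h3),
    integral_const_mul, integral_divergence g e hμ _ (zero_mem_Ioo g) hc hs, mul_zero]
  intro a
  refine ZeroOff.vanishesOff ((hz.mul_right _).sub (ZeroOff.mul_left (ZeroOff.sum fun b _ => ?_) _))
    (zero_mem_Ioo g)
  exact (hz.d (isClosed_tsupport _) (dirc b)).mul_left _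

/-- A smooth partition of unity on the support of `v`, subordinate to the charts; by compactness
only finitely many members meet the support. It reduces self-adjointness to functions supported in
one chart. -/
theorem exists_sum_eq_of_hasCompactSupport {v : smoothAlg g}
    (hc : HasCompactSupport (v : M → ℝ)) :
    ∃ (s : Finset M) (w : M → smoothAlg g), v = ∑ i ∈ s, w i ∧
      ∀ i, HasCompactSupport (w i : M → ℝ) ∧
        tsupport (w i : M → ℝ) ⊆ (chartA (n := n) i).1.source := by
  have : LocallyCompactSpace M := ChartedSpace.locallyCompactSpace (Eu n) M
  obtain ⟨f, hf⟩ := SmoothPartitionOfUnity.exists_isSubordinate (𝓡 n)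
    (isClosed_tsupport (v : M → ℝ))
    (fun i : M => (chartA (n := n) i).1.source) (fun i => (chartA i).1.open_source)
    fun x _ => mem_iUnion.2 ⟨x, mem_chartA x⟩
  have hfin := f.locallyFinite.finite_nonempty_inter_compact hc
  let F : M → smoothAlg g := fun i => ⟨f i, jSmooth_const (f i).contMDiff⟩
  refine ⟨hfin.toFinset, fun i => F i * v, Subtype.ext (funext fun x => ?_), fun i =>
    ⟨HasCompactSupport.mul_left hc, (tsupport_mul_subset_left).trans (hf i)⟩⟩
  rw [AddSubmonoidClass.coe_finsetSum, Finset.sum_apply]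
  change (v : M → ℝ) x = ∑ i ∈ hfin.toFinset, f i x * (v : M → ℝ) x
  by_cases hx : x ∈ tsupport (v : M → ℝ)
  · rw [← Finset.sum_mul, ← finsum_eq_sum_of_support_subset, f.sum_eq_one hx, one_mul]
    intro i hi
    exact hfin.mem_toFinset.2 ⟨x, hi, hx⟩
  · simp [image_eq_zero_of_notMem_tsupport hx]

theorem integral_mul_opM (hμ : IsVolumeMeasure (g.toFun 0) μ) (N : ℕ) {u v : smoothAlg g}
    (hc : HasCompactSupport (v : M → ℝ)) :
    ∫ x, ((v * opMLin hμ N u : smoothAlg g) : M → ℝ) x ∂μ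
      = ∫ x, ((u * opMLin hμ N v : smoothAlg g) : M → ℝ) x ∂μ := by
  obtain ⟨s, w, rfl, hw⟩ := exists_sum_eq_of_hasCompactSupport hc
  simp only [Finset.sum_mul, map_sum, Finset.mul_sum, AddSubmonoidClass.coe_finsetSum,
    Finset.sum_apply]
  rw [integral_finsetSum, integral_finsetSum]
  · exact Finset.sum_congr rfl fun i _ => integral_mul_opM_of_subset hμ N (hw i).1 (hw i).2
  · exact fun i _ => integrable_coe hμ
      (HasCompactSupport.mul_left (hasCompactSupport_opM hμ N (jSmooth_coe _) (hw i).1))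
  · exact fun i _ => integrable_coe hμ (HasCompactSupport.mul_right (hw i).1)

theorem hasCompactSupport_compList (hμ : IsVolumeMeasure (g.toFun 0) μ) (A : List ℕ)
    {u : smoothAlg g} (hc : HasCompactSupport (u : M → ℝ)) :
    HasCompactSupport (compList (opMLin hμ) A u : smoothAlg g).1 := by
  induction A generalizing u with
  | nil => exact hc
  | cons a A ih => exact ih (hasCompactSupport_opM hμ a (jSmooth_coe u) hc)

/-- The outermost operator moves first and lands innermost on `w`; hence the reversal. -/
theorem integral_mul_compList (hμ : IsVolumeMeasure (g.toFun 0) μ) (A : List ℕ) {w z : smoothAlg g}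
    (hw : HasCompactSupport (w : M → ℝ)) (hz : HasCompactSupport (z : M → ℝ)) :
    ∫ x, (w * compList (opMLin hμ) A z : smoothAlg g).1 x ∂μ
      = ∫ x, (compList (opMLin hμ) A.reverse w * z : smoothAlg g).1 x ∂μ := by
  induction A generalizing z with
  | nil => rfl
  | cons a A ih =>
    have hz' : HasCompactSupport (opMLin hμ a z).1 := hasCompactSupport_opM hμ a (jSmooth_coe z) hz
    rw [compList_cons, ih hz', List.reverse_cons,
      compList_concat, integral_mul_opM hμ a (hasCompactSupport_compList hμ _ hw), mul_comm z]

/-- After the reversal forced by `integral_mul_compList` the coefficient is a product of identical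
expressions in the three sequences, hence symmetric. -/
theorem juhlCoeff_reverse_eq_prod (U : ℕ) (L : ℝ) (B : Fin 3 → List ℕ) :
    juhlCoeff U L (B 0).reverse (B 1) (B 2)
      = (U.factorial : ℝ) ^ 2 * (∏ m ∈ Finset.Icc 1 U, (L - m))
        * ∏ i, factorialCoeff (B i) * partialSumCoeff L (B i) := by
  rw [juhlCoeff, factorialCoeff_reverse, List.reverse_reverse, Fin.prod_univ_three]
  ring

/-- The triples of finite sequences with total weight `U` as functions on `Fin 3`. -/
def seqFamilies (U : ℕ) : Finset (Fin 3 → List ℕ) :=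
  (seqTriples U).image fun A => ![A.1.reverse, A.2.1, A.2.2]

theorem mem_seqFamilies {U : ℕ} {B : Fin 3 → List ℕ} :
    B ∈ seqFamilies U ↔ ∑ i, weightSum (B i) = U := by
  rw [seqFamilies, Finset.mem_image, Fin.sum_univ_three]
  constructor
  · rintro ⟨A, hA, rfl⟩
    simpa [weightSum_reverse] using mem_seqTriples.1 hA
  · intro h
    refine ⟨((B 0).reverse, B 1, B 2), mem_seqTriples.2 (by simpa [weightSum_reverse] using h), ?_⟩
    funext i
    fin_cases i <;> simp

theorem sum_seqFamilies {W : Type*} [AddCommMonoid W] (U : ℕ) (f : (Fin 3 → List ℕ) → W) :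
    ∑ A ∈ seqTriples U, f ![A.1.reverse, A.2.1, A.2.2] = ∑ B ∈ seqFamilies U, f B := by
  rw [seqFamilies, Finset.sum_image]
  rintro ⟨A, A', A''⟩ - ⟨B, B', B''⟩ - h
  have h0 := congrFun h 0
  have h1 := congrFun h 1
  have h2 := congrFun h 2
  simp at h0 h1 h2
  rw [h0, h1, h2]

theorem integral_mul_sum_smul (hμ : IsVolumeMeasure (g.toFun 0) μ) {ι : Type*} (s : Finset ι)
    (c : ι → ℝ) (w : ι → smoothAlg g) {v : smoothAlg g} (hv : HasCompactSupport (v : M → ℝ)) :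
    Integrable (fun x => v.1 x * (∑ i ∈ s, c i • w i : smoothAlg g).1 x) μ ∧
    ∫ x, v.1 x * (∑ i ∈ s, c i • w i : smoothAlg g).1 x ∂μ
      = ∑ i ∈ s, c i * ∫ x, (v * w i : smoothAlg g).1 x ∂μ := by
  let F : ι → M → ℝ := fun i x => c i * (v * w i : smoothAlg g).1 x
  have h0 : (fun x => v.1 x * (∑ i ∈ s, c i • w i : smoothAlg g).1 x) = fun x => ∑ i ∈ s, F i x := by
    funext x
    rw [AddSubmonoidClass.coe_finsetSum, Finset.sum_apply, Finset.mul_sum]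
    refine Finset.sum_congr rfl fun i _ => ?_
    change v.1 x * (c i * (w i).1 x) = c i * (v.1 x * (w i).1 x)
    ring
  have hi : ∀ i ∈ s, Integrable (F i) μ := by
    intro i _
    have h1 : HasCompactSupport (v * w i : smoothAlg g).1 := HasCompactSupport.mul_right hv
    exact (integrable_coe hμ h1).const_mul (c i)
  have h2 : ∀ i ∈ s, ∫ x, F i x ∂μ = c i * ∫ x, (v * w i : smoothAlg g).1 x ∂μ := fun i _ =>
    integral_const_mul _ _
  rw [h0, integral_finsetSum s hi, Finset.sum_congr rfl h2]
  exact ⟨integrable_finsetSum s hi, rfl⟩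

theorem integral_mul_opD (hμ : IsVolumeMeasure (g.toFun 0) μ) {U : ℕ} {L : ℝ}
    (hL : ∀ m : ℕ, 1 ≤ m → 2 * m ≤ U → L ≠ m) (u : Fin 3 → smoothAlg g)
    (hc : ∀ i, HasCompactSupport (u i : M → ℝ)) :
    Integrable (fun x => (u 0).1 x * opD g U 0 L 0 0 (u 1) (u 2) x) μ ∧
    ∫ x, (u 0).1 x * opD g U 0 L 0 0 (u 1) (u 2) x ∂μ
      = ∑ B ∈ seqFamilies U, regularValue (fun z => (U.factorial : ℝ) ^ 2
          * (∏ m ∈ Finset.Icc 1 U, (z - m)) * ∏ i, factorialCoeff (B i) * partialSumCoeff z (B i)) L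
        * ∫ x, (∏ i, compList (opMLin hμ) (B i) (u i) : smoothAlg g).1 x ∂μ := by
  have h := integral_mul_sum_smul hμ (seqTriples U)
    (fun A => regularValue (fun z => juhlCoeff U z A.1 A.2.1 A.2.2) L)
    (fun A => compList (opMLin hμ) A.1
      (compList (opMLin hμ) A.2.1 (u 1) * compList (opMLin hμ) A.2.2 (u 2))) (hc 0)
  rw [opD_eq_coe hμ hL]
  refine ⟨h.1, h.2.trans ?_⟩
  rw [← sum_seqFamilies]
  refine Finset.sum_congr rfl fun A _ => ?_
  have h2 : HasCompactSupport
      (compList (opMLin hμ) A.2.1 (u 1) * compList (opMLin hμ) A.2.2 (u 2) : smoothAlg g).1 :=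
    HasCompactSupport.mul_right (hasCompactSupport_compList hμ _ (hc 1))
  rw [integral_mul_compList hμ _ (hc 0) h2, Fin.prod_univ_three, mul_assoc]
  simp only [← juhlCoeff_reverse_eq_prod, Matrix.cons_val_zero, Matrix.cons_val_one,
    List.reverse_reverse]
  rfl

theorem isFormallySelfAdjoint_opD (hμ : IsVolumeMeasure (g.toFun 0) μ) {U : ℕ} {L : ℝ}
    (hL : ∀ m : ℕ, 1 ≤ m → 2 * m ≤ U → L ≠ m) :
    IsFormallySelfAdjoint (n := n) μ (opD g U 0 L 0 0) := by
  intro u hu hc σ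
  let v : Fin 3 → smoothAlg g := fun i => ⟨u i, jSmooth_const (hu i)⟩
  have h1 := integral_mul_opD hμ hL v hc
  have h2 := integral_mul_opD hμ hL (fun i => v (σ i)) fun i => hc (σ i)
  refine ⟨h2.1, h2.2.trans (Eq.trans ?_ h1.2.symm)⟩
  -- Permuting the functions is undone by permuting the three sequences; the index set, the
  -- coefficients and the product under the integral are all symmetric.
  refine Finset.sum_nbij' (fun B i => B (σ.symm i)) (fun B i => B (σ i)) ?_ ?_ ?_ ?_ ?_
  · intro B hB
    rw [mem_seqFamilies] at hB ⊢
    rwa [Equiv.sum_comp σ.symm fun i => weightSum (B i)]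
  · intro B hB
    rw [mem_seqFamilies] at hB ⊢
    rwa [Equiv.sum_comp σ fun i => weightSum (B i)]
  · intro B _
    simp
  · intro B _
    simp
  · intro B _
    have h3 : ∀ z, ∏ i, factorialCoeff (B (σ.symm i)) * partialSumCoeff z (B (σ.symm i))
        = ∏ i, factorialCoeff (B i) * partialSumCoeff z (B i) := fun z =>
      Equiv.prod_comp σ.symm fun i => factorialCoeff (B i) * partialSumCoeff z (B i)
    have h4 : ∏ i, compList (opMLin hμ) (B (σ.symm i)) (v i)
        = ∏ i, compList (opMLin hμ) (B i) (v (σ i)) := by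
      rw [← Equiv.prod_comp σ]
      simp
    simp only [h3, h4]

end SelfAdjoint

end OvsienkoRedou

end

/-! ### The main theorem -/

open OvsienkoRedou in
theorem mainTheorem6 {n : ℕ} {M : Type*} [TopologicalSpace M] [T2Space M]
    [SecondCountableTopology M] [ChartedSpace (EuclideanSpace ℝ (Fin n)) M]
    [IsManifold (𝓡 n) ∞ M] [MeasurableSpace M] [BorelSpace M]
    (g : MetricFamily n M) (μ : MeasureTheory.Measure M) (hμ : IsVolumeMeasure (g.toFun 0) μ)
    (U : ℕ) (L : ℝ) (hL : ∀ m : ℕ, 1 ≤ m → 2 * m ≤ U → L ≠ m) :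
    (∀ u v : M → ℝ, ContMDiff (𝓡 n) 𝓘(ℝ, ℝ) ∞ u → ContMDiff (𝓡 n) 𝓘(ℝ, ℝ) ∞ v → ∀ x : M,
      opD g U 0 L 0 0 u v x =
        ∑ A ∈ seqTriples U, regularValue (fun z => juhlCoeff U z A.1 A.2.1 A.2.2) L *
          opMList g A.1 (fun y => opMList g A.2.1 u y * opMList g A.2.2 v y) x) ∧
    ((∀ m : ℕ, 1 ≤ m → m ≤ U → L ≠ m) →
      ∀ u v : M → ℝ, ContMDiff (𝓡 n) 𝓘(ℝ, ℝ) ∞ u → ContMDiff (𝓡 n) 𝓘(ℝ, ℝ) ∞ v → ∀ x : M,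
      opD g U 0 L 0 0 u v x =
        ∑ A ∈ seqTriples U, juhlCoeff U L A.1 A.2.1 A.2.2 *
          opMList g A.1 (fun y => opMList g A.2.1 u y * opMList g A.2.2 v y) x) ∧
    IsFormallySelfAdjoint (n := n) μ (opD g U 0 L 0 0) := by
  refine ⟨fun u v hu hv x => opD_eq_sum_opMList hμ hL (jSmooth_const hu) (jSmooth_const hv) x,
    fun hL' u v hu hv x => ?_, isFormallySelfAdjoint_opD hμ hL⟩
  rw [opD_eq_sum_opMList hμ hL (jSmooth_const hu) (jSmooth_const hv)]
  refine Finset.sum_congr rfl fun A hA => ?_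
  rw [regularValue_juhlCoeff (mem_seqTriples.1 hA) hL']
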